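/- We use a word RAM with words of $w$ bits: programs built from assignments, conditionals and while-loops, acting on registers and on a fixed number of arrays with random access, where evaluating a constant, reading a register or an array cell, storing a value, adding, subtracting (truncated at $0$), multiplying, comparing, each logical connective of a test, and each branching takes one unit of time, and where all values and cell indices that occur must be less than $2^w$. An input $(A,B,C)$ of strings over the alphabet $\{0,\dots,\sigma-1\}$ is given by its three lengths, in three registers, and its characters, one in each cell of three arrays; all other memory is initially $0$. For a string $X$, let $|X|$ be its length and $|\mathit{RLE}(X)|$ the size of its run-length encoding, i.e. the number of its maximal runs of equal characters. A string $Z$ is an STR-IC-LCS of $A,B,C$ if it is a longest string that includes $C$ as a (contiguous) substring and is a subsequence of both $A$ and $B$. **Theorem.** There are a single program and a constant $c$ such that the following holds for all $\sigma$, all nonempty strings $A,B$ and all strings $C$ over $\{0,\dots,\sigma-1\}$ with $|\mathit{RLE}(C)|>1$ (that is, $C$ contains at least two distinct characters), and for every word length $w$ with $2^w\ge\sigma$ and $2^w\ge(|A|+|B|+|C|)^c$. Let $M=|A|$, $N=|B|$, $m=|\mathit{RLE}(A)|$, $n=|\mathit{RLE}(B)|$. On input $(A,B,C)$ the program halts after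 at most $c\,(mN+nM)$ units of time, and its output is the length of an STR-IC-LCS of $A,B,C$ if one exists, and $0$ if none exists. That is, the length of an STR-IC-LCS of $A,B,C$ can be computed in $O(mN+nM)$ time. -/

import Mathlib

namespace StrIC

/-! ### Strings -/

/-- The run-length encoding of a string: the list of its maximal runs, each given as a pair of
a character and the length of the run.  Its size is the length of this list. -/
def rle {α : Type} [DecidableEq α] : List α → List (α × ℕ)
  | [] => []
  | a :: l =>
    match rle l with
    | [] => [(a, 1)]
    | (b, k) :: r => if a = b then (b, k + 1) :: r else (a, 1) :: (b, k) :: r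

/-- `Z` includes `C` as a (contiguous) substring and is a subsequence of both `A` and `B`. -/
def IsCandidate {α : Type} (A B C Z : List α) : Prop :=
  C <:+: Z ∧ List.Sublist Z A ∧ List.Sublist Z B

/-- `Z` is an STR-IC-LCS of `A`, `B`, `C`: a longest string that includes `C` as a substring
and is a subsequence of both `A` and `B`. -/
def IsSTRICLCS {α : Type} (A B C Z : List α) : Prop :=
  IsCandidate A B C Z ∧ ∀ Z' : List α, IsCandidate A B C Z' → Z'.length ≤ Z.length

/-! ### The word RAM

The machine has registers and arrays, numbered by natural numbers; a program mentions only
finitely many of them, and the name of a register or of an array is a fixed part of the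
program, whereas the index of an array cell is computed at run time.  Words have `w` bits:
a computation in which some value needs more than `w` bits is stuck. -/

/-- The memory: the contents of the registers and of the cells of the arrays. -/
structure State where
  reg : ℕ → ℕ
  arr : ℕ → ℕ → ℕ

/-- Set register `x` to `v`. -/
def State.setReg (s : State) (x v : ℕ) : State :=
  { s with reg := fun y => if y = x then v else s.reg y }

/-- Set cell `i` of array `a` to `v`. -/
def State.setArr (s : State) (a i v : ℕ) : State :=
  { s with arr := fun b j => if b = a ∧ j = i then v else s.arr b j }

/-- Arithmetic expressions; `get a i` reads cell `i` of array `a`. -/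
inductive Expr where
  | const (k : ℕ)
  | reg (x : ℕ)
  | get (a : ℕ) (i : Expr)
  | add (e f : Expr)
  | sub (e f : Expr)
  | mul (e f : Expr)

/-- The value of an expression (subtraction is truncated at `0`). -/
def Expr.eval (s : State) : Expr → ℕ
  | .const k => k
  | .reg x => s.reg x
  | .get a i => s.arr a (i.eval s)
  | .add e f => e.eval s + f.eval s
  | .sub e f => e.eval s - f.eval s
  | .mul e f => e.eval s * f.eval s

/-- The number of unit-time operations that evaluate an expression: one for each node. -/
def Expr.cost : Expr → ℕ
  | .const _ => 1
  | .reg _ => 1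
  | .get _ i => i.cost + 1
  | .add e f => e.cost + f.cost + 1
  | .sub e f => e.cost + f.cost + 1
  | .mul e f => e.cost + f.cost + 1

/-- Every value (also intermediate ones and cell indices) that occurs in the evaluation of the
expression fits in a word of `w` bits. -/
def Expr.Fits (w : ℕ) (s : State) : Expr → Prop
  | .const k => k < 2 ^ w
  | .reg x => s.reg x < 2 ^ w
  | .get a i => i.Fits w s ∧ s.arr a (i.eval s) < 2 ^ w
  | .add e f => e.Fits w s ∧ f.Fits w s ∧ e.eval s + f.eval s < 2 ^ w
  | .sub e f => e.Fits w s ∧ f.Fits w s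
  | .mul e f => e.Fits w s ∧ f.Fits w s ∧ e.eval s * f.eval s < 2 ^ w

/-- Tests. -/
inductive Test where
  | eq (e f : Expr)
  | lt (e f : Expr)
  | not (b : Test)
  | and (b c : Test)

/-- The truth of a test. -/
def Test.Holds (s : State) : Test → Prop
  | .eq e f => e.eval s = f.eval s
  | .lt e f => e.eval s < f.eval s
  | .not b => ¬ b.Holds s
  | .and b c => b.Holds s ∧ c.Holds s

/-- The number of unit-time operations that evaluate a test. -/
def Test.cost : Test → ℕ
  | .eq e f => e.cost + f.cost + 1
  | .lt e f => e.cost + f.cost + 1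
  | .not b => b.cost + 1
  | .and b c => b.cost + c.cost + 1

/-- Every value that occurs in the evaluation of the test fits in a word of `w` bits. -/
def Test.Fits (w : ℕ) (s : State) : Test → Prop
  | .eq e f => e.Fits w s ∧ f.Fits w s
  | .lt e f => e.Fits w s ∧ f.Fits w s
  | .not b => b.Fits w s
  | .and b c => b.Fits w s ∧ c.Fits w s

/-- Programs; `assign x e` sets register `x` to the value of `e`, `write a i e` sets cell `i` of
array `a` to the value of `e`, and `loop b p` repeats `p` as long as `b` holds. -/
inductive Prog where
  | skip
  | assign (x : ℕ) (e : Expr)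
  | write (a : ℕ) (i e : Expr)
  | seq (p q : Prog)
  | ite (b : Test) (p q : Prog)
  | loop (b : Test) (p : Prog)

/-- `Exec w p s t s'`: on a machine with words of `w` bits, the program `p` started in state `s`
halts in state `s'` after exactly `t` unit-time operations, and all values fit in words. -/
inductive Exec (w : ℕ) : Prog → State → ℕ → State → Prop
  | skip (s : State) : Exec w .skip s 1 s
  | assign (x : ℕ) (e : Expr) (s : State) (he : e.Fits w s) :
      Exec w (.assign x e) s (e.cost + 1) (s.setReg x (e.eval s))
  | write (a : ℕ) (i e : Expr) (s : State) (hi : i.Fits w s) (he : e.Fits w s) :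
      Exec w (.write a i e) s (i.cost + e.cost + 1) (s.setArr a (i.eval s) (e.eval s))
  | seq (p q : Prog) (s s' s'' : State) (t t' : ℕ)
      (hp : Exec w p s t s') (hq : Exec w q s' t' s'') :
      Exec w (.seq p q) s (t + t') s''
  | iteTrue (b : Test) (p q : Prog) (s s' : State) (t : ℕ)
      (hf : b.Fits w s) (hb : b.Holds s) (hp : Exec w p s t s') :
      Exec w (.ite b p q) s (b.cost + 1 + t) s'
  | iteFalse (b : Test) (p q : Prog) (s s' : State) (t : ℕ)
      (hf : b.Fits w s) (hb : ¬ b.Holds s) (hq : Exec w q s t s') :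
      Exec w (.ite b p q) s (b.cost + 1 + t) s'
  | loopTrue (b : Test) (p : Prog) (s s' s'' : State) (t t' : ℕ)
      (hf : b.Fits w s) (hb : b.Holds s)
      (hp : Exec w p s t s') (hl : Exec w (.loop b p) s' t' s'') :
      Exec w (.loop b p) s (b.cost + 1 + t + t') s''
  | loopFalse (b : Test) (p : Prog) (s : State)
      (hf : b.Fits w s) (hb : ¬ b.Holds s) :
      Exec w (.loop b p) s (b.cost + 1) s

/-- The initial memory for the input strings `A`, `B`, `C` over the alphabet `{0, …, σ - 1}`:
registers `0`, `1`, `2` hold the lengths of the strings, the first cells of the arrays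
`0`, `1`, `2` hold their characters, one in each cell, and everything else is `0`. -/
def initState {σ : ℕ} (A B C : List (Fin σ)) : State where
  reg x :=
    match x with
    | 0 => A.length
    | 1 => B.length
    | 2 => C.length
    | _ => 0
  arr a i :=
    match a with
    | 0 => (A.map Fin.val).getD i 0
    | 1 => (B.map Fin.val).getD i 0
    | 2 => (C.map Fin.val).getD i 0
    | _ => 0

end StrIC

/-! Write `C = a^p D`. Since `C` has two distinct characters, `p` can be the length of its first
run, and `D` begins with some `b ≠ a`. A candidate has the form `W C Y`. In an embedding of it into
`A`, let `e` be the end of the run of `A` that contains the image of the last `a` of `a^p`. As `b ≠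
a`, the rest `D Y` still embeds behind `e`. The copies of `a` may then be replaced by the last `p`
occurrences of `a` before `e`, the first of them at `s`, which only enlarges the prefix available to
`W`; embedding `D` greedily from `e`, up to a position `f`, leaves the largest suffix for `Y`. So
each run of `A` yields at most one slot `(s, f)`, and likewise for `B`. The answer is the maximum,
over pairs of slots, of the LCS of the two prefixes, plus `|C|`, plus the LCS of the two suffixes.
The exchange argument is `exists_isRunEnd`, its converse `sublist_of_isBlock`, and the conclusion
`IsMaxValue.spec`.

There are at most `m` slots in `A` and `n` in `B`, so the maximum takes `O(mn)` lookups. If `C` is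
longer than `A` or `B`, there is no candidate. Otherwise the greedy extension of all slots by one
character of `C` costs a number of steps proportional to the number of runs, because a search for a
character may start at the beginning of a run (`RunTable.next_run`). This gives `m|C| ≤ mN` and
`n|C| ≤ nM`.

The LCS tables need rows only at the slot positions of `A`. Adding the run boundaries makes at most
`2m` rows besides the zero row (`numMarks_marks_le`), and between consecutive rows the string is
constant. A row is obtained from the preceding one in `O(N)` time, however long the constant block:
along a column the block raises the value in steps of one, and the places of these steps form a
queue that changes by a bounded amount per column (`Deque.step_match`, `Deque.step_mismatch`). The
suffix table is the prefix table of the reversed strings.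

The program is verified with a Hoare-style calculus: `Run` records termination, time and
postcondition, `Run.loop` treats loops, and `Run.of_wp` treats loop-free code. -/

set_option linter.unusedSimpArgs false

namespace StrIC

/-! ### Reasoning about programs -/

/-- The number of words of `w` bits. -/
def cap (w : ℕ) : ℕ := 2 ^ w

/-- All memory contents fit in words of `w` bits. -/
def Bdd (w : ℕ) (s : State) : Prop :=
  (∀ x, s.reg x < cap w) ∧ ∀ a i, s.arr a i < cap w

/-- The part of `Expr.Fits` that does not follow from `Bdd`. -/
def Expr.Ok (w : ℕ) (s : State) : Expr → Prop
  | .const k => k < cap w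
  | .reg _ => True
  | .get _ i => i.Ok w s
  | .add e f => e.Ok w s ∧ f.Ok w s ∧ e.eval s + f.eval s < cap w
  | .sub e f => e.Ok w s ∧ f.Ok w s
  | .mul e f => e.Ok w s ∧ f.Ok w s ∧ e.eval s * f.eval s < cap w

/-- The part of `Test.Fits` that does not follow from `Bdd`. -/
def Test.Ok (w : ℕ) (s : State) : Test → Prop
  | .eq e f => e.Ok w s ∧ f.Ok w s
  | .lt e f => e.Ok w s ∧ f.Ok w s
  | .not b => b.Ok w s
  | .and b c => b.Ok w s ∧ c.Ok w s

/-- When the whole memory is bounded, reads need no check. Only constants, sums and products leave a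
proof obligation. -/
theorem Expr.Ok.fits {w : ℕ} {s : State} (hs : Bdd w s) :
    ∀ {e : Expr}, e.Ok w s → e.Fits w s
  | .const _, h => h
  | .reg x, _ => hs.1 x
  | .get a i, h => ⟨Expr.Ok.fits hs (e := i) h, hs.2 a _⟩
  | .add _ _, h => ⟨Expr.Ok.fits hs h.1, Expr.Ok.fits hs h.2.1, h.2.2⟩
  | .sub _ _, h => ⟨Expr.Ok.fits hs h.1, Expr.Ok.fits hs h.2⟩
  | .mul _ _, h => ⟨Expr.Ok.fits hs h.1, Expr.Ok.fits hs h.2.1, h.2.2⟩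

theorem Test.Ok.fits {w : ℕ} {s : State} (hs : Bdd w s) :
    ∀ {b : Test}, b.Ok w s → b.Fits w s
  | .eq _ _, h => ⟨h.1.fits hs, h.2.fits hs⟩
  | .lt _ _, h => ⟨h.1.fits hs, h.2.fits hs⟩
  | .not b, h => Test.Ok.fits hs (b := b) h
  | .and _ _, h => ⟨Test.Ok.fits hs h.1, Test.Ok.fits hs h.2⟩

theorem Expr.Fits.eval_lt {w : ℕ} {s : State} : ∀ {e : Expr}, e.Fits w s → e.eval s < cap w
  | .const _, h => h
  | .reg _, h => h
  | .get _ _, h => h.2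
  | .add _ _, h => h.2.2
  | .sub _ _, h => lt_of_le_of_lt (Nat.sub_le _ _) (Expr.Fits.eval_lt h.1)
  | .mul _ _, h => h.2.2

@[simp] theorem State.setReg_reg (s : State) (x v y : ℕ) :
    (s.setReg x v).reg y = if y = x then v else s.reg y := rfl

@[simp] theorem State.setReg_arr (s : State) (x v : ℕ) : (s.setReg x v).arr = s.arr := rfl

@[simp] theorem State.setArr_reg (s : State) (a i v : ℕ) : (s.setArr a i v).reg = s.reg := rfl

@[simp] theorem State.setArr_arr_self (s : State) (a i v : ℕ) :
    (s.setArr a i v).arr a = fun j => if j = i then v else s.arr a j := by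
  simp [State.setArr]

@[simp] theorem State.setArr_arr_of_ne (s : State) {a b : ℕ} (h : b ≠ a) (i v : ℕ) :
    (s.setArr a i v).arr b = s.arr b := by
  simp [State.setArr, h]

theorem State.setArr_arr (s : State) (a i v b j : ℕ) :
    (s.setArr a i v).arr b j = if b = a ∧ j = i then v else s.arr b j := rfl

theorem Bdd.setReg {w : ℕ} {s : State} (hs : Bdd w s) {x v : ℕ} (hv : v < cap w) :
    Bdd w (s.setReg x v) := by
  refine ⟨fun y => ?_, hs.2⟩
  rw [State.setReg_reg]
  split_ifs
  exacts [hv, hs.1 y]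

theorem Bdd.setArr {w : ℕ} {s : State} (hs : Bdd w s) {a i v : ℕ} (hv : v < cap w) :
    Bdd w (s.setArr a i v) := by
  refine ⟨hs.1, fun b j => ?_⟩
  rw [State.setArr_arr]
  split_ifs
  exacts [hv, hs.2 b j]

/-- The registers that a program may change. -/
def Prog.regs : Prog → List ℕ
  | .skip => []
  | .assign x _ => [x]
  | .write _ _ _ => []
  | .seq p q => p.regs ++ q.regs
  | .ite _ p q => p.regs ++ q.regs
  | .loop _ p => p.regs

/-- The arrays that a program may change. -/
def Prog.arrs : Prog → List ℕ
  | .skip => []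
  | .assign _ _ => []
  | .write a _ _ => [a]
  | .seq p q => p.arrs ++ q.arrs
  | .ite _ p q => p.arrs ++ q.arrs
  | .loop _ p => p.arrs

/-- The two states differ only in the memory that `p` may change. -/
def Frame (p : Prog) (s s' : State) : Prop :=
  (∀ x, x ∉ p.regs → s'.reg x = s.reg x) ∧ ∀ a, a ∉ p.arrs → s'.arr a = s.arr a

theorem Frame.refl (p : Prog) (s : State) : Frame p s s := ⟨fun _ _ => rfl, fun _ _ => rfl⟩

theorem Frame.trans {p : Prog} {s s' s'' : State} (h : Frame p s s') (h' : Frame p s' s'') :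
    Frame p s s'' :=
  ⟨fun x hx => (h'.1 x hx).trans (h.1 x hx), fun a ha => (h'.2 a ha).trans (h.2 a ha)⟩

theorem Frame.mono {p q : Prog} {s s' : State} (h : Frame p s s')
    (hr : ∀ x ∈ p.regs, x ∈ q.regs) (ha : ∀ a ∈ p.arrs, a ∈ q.arrs) : Frame q s s' :=
  ⟨fun x hx => h.1 x fun h => hx (hr x h), fun a h' => h.2 a fun h => h' (ha a h)⟩

/-- The footprint is syntactic, so that a concrete program preserves a given register or array can
be checked by `decide`. Specifications need mention only what changes. -/
theorem Exec.frame {w : ℕ} {p : Prog} {s s' : State} {t : ℕ} (h : Exec w p s t s') :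
    Frame p s s' := by
  induction h with
  | skip s => exact Frame.refl _ _
  | assign x e s he =>
    refine ⟨fun y hy => ?_, fun _ _ => rfl⟩
    simp only [Prog.regs, List.mem_singleton] at hy
    simp [hy]
  | write a i e s hi he =>
    refine ⟨fun _ _ => rfl, fun b hb => ?_⟩
    simp only [Prog.arrs, List.mem_singleton] at hb
    simp [hb]
  | seq p q s s' s'' t t' _ _ ih ih' =>
    exact (ih.mono (by simp +contextual [Prog.regs]) (by simp +contextual [Prog.arrs])).trans
      (ih'.mono (by simp +contextual [Prog.regs]) (by simp +contextual [Prog.arrs]))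
  | iteTrue b p q s s' t _ _ _ ih =>
    exact ih.mono (by simp +contextual [Prog.regs]) (by simp +contextual [Prog.arrs])
  | iteFalse b p q s s' t _ _ _ ih =>
    exact ih.mono (by simp +contextual [Prog.regs]) (by simp +contextual [Prog.arrs])
  | loopTrue b p s s' s'' t t' _ _ _ _ ih ih' => exact Frame.trans ih ih'
  | loopFalse b p s _ _ => exact Frame.refl _ _

theorem Exec.bdd {w : ℕ} {p : Prog} {s s' : State} {t : ℕ} (h : Exec w p s t s')
    (hs : Bdd w s) : Bdd w s' := by
  induction h with
  | skip s => exact hs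
  | assign x e s he => exact hs.setReg he.eval_lt
  | write a i e s hi he => exact hs.setArr he.eval_lt
  | seq p q s s' s'' t t' _ _ ih ih' => exact ih' (ih hs)
  | iteTrue b p q s s' t _ _ _ ih => exact ih hs
  | iteFalse b p q s s' t _ _ _ ih => exact ih hs
  | loopTrue b p s s' s'' t t' _ _ _ _ ih ih' => exact ih' (ih hs)
  | loopFalse b p s _ _ => exact hs

/-- From `s`, the program `p` halts within time `T` in a state that satisfies `Q`. -/
def Run (w : ℕ) (p : Prog) (s : State) (T : ℕ) (Q : State → Prop) : Prop :=
  ∃ t s', Exec w p s t s' ∧ t ≤ T ∧ Q s'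

/-- Boundedness and the frame condition are supplied here and in `Run.seq`, so postconditions do not
have to carry them. -/
theorem Run.mono {w : ℕ} {p : Prog} {s : State} {T T' : ℕ} {Q Q' : State → Prop}
    (h : Run w p s T Q) (hT : T ≤ T') (hs : Bdd w s)
    (hQ : ∀ s', Bdd w s' → Frame p s s' → Q s' → Q' s') : Run w p s T' Q' := by
  obtain ⟨t, s', he, ht, hq⟩ := h
  exact ⟨t, s', he, ht.trans hT, hQ s' (he.bdd hs) he.frame hq⟩

theorem Run.seq {w : ℕ} {p q : Prog} {s : State} {T T' : ℕ} {Q Q' : State → Prop}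
    (hp : Run w p s T Q) (hs : Bdd w s)
    (hq : ∀ s', Bdd w s' → Frame p s s' → Q s' → Run w q s' T' Q') :
    Run w (.seq p q) s (T + T') Q' := by
  obtain ⟨t, s', he, ht, h⟩ := hp
  obtain ⟨t', s'', he', ht', h'⟩ := hq s' (he.bdd hs) he.frame h
  exact ⟨t + t', s'', .seq _ _ _ _ _ _ _ he he', by lia, h'⟩

theorem Run.ite {w : ℕ} {b : Test} {p q : Prog} {s : State} {T : ℕ} {Q : State → Prop}
    (hs : Bdd w s) (hb : b.Ok w s) (hp : b.Holds s → Run w p s T Q)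
    (hq : ¬ b.Holds s → Run w q s T Q) : Run w (.ite b p q) s (b.cost + 1 + T) Q := by
  by_cases h : b.Holds s
  · obtain ⟨t, s', he, ht, h'⟩ := hp h
    exact ⟨_, s', .iteTrue _ _ _ _ _ _ (hb.fits hs) h he, by lia, h'⟩
  · obtain ⟨t, s', he, ht, h'⟩ := hq h
    exact ⟨_, s', .iteFalse _ _ _ _ _ _ (hb.fits hs) h he, by lia, h'⟩

/-- A loop that makes `n` rounds, the `k`-th of which takes time `cost k`. -/
theorem Run.loop {w : ℕ} {b : Test} {p : Prog} {s : State} (I : ℕ → State → Prop) (n : ℕ)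
    (cost : ℕ → ℕ) (hs : Bdd w s) (h0 : I 0 s)
    (hb : ∀ k s', k ≤ n → Bdd w s' → Frame p s s' → I k s' →
      b.Ok w s' ∧ (b.Holds s' ↔ k < n))
    (hp : ∀ k s', k < n → Bdd w s' → Frame p s s' → I k s' → Run w p s' (cost k) (I (k + 1))) :
    Run w (.loop b p) s (∑ k ∈ Finset.range n, (cost k + b.cost + 1) + b.cost + 1) (I n) := by
  -- Induction on the number `d` of remaining rounds. The frame always refers to the state before
  -- the loop.
  have key : ∀ d k, k + d = n → ∀ s', Bdd w s' → Frame p s s' → I k s' →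
      Run w (.loop b p) s' (∑ k ∈ Finset.Ico k n, (cost k + b.cost + 1) + b.cost + 1) (I n) := by
    intro d
    induction d with
    | zero =>
      intro k hk s' hs' hf hI
      obtain rfl : k = n := by simpa using hk
      obtain ⟨ho, hh⟩ := hb k s' le_rfl hs' hf hI
      exact ⟨_, s', .loopFalse _ _ _ (ho.fits hs') (by simp [hh]), by lia, hI⟩
    | succ d ih =>
      intro k hk s' hs' hf hI
      obtain ⟨ho, hh⟩ := hb k s' (by lia) hs' hf hI
      obtain ⟨t, s₁, he, ht, hI₁⟩ := hp k s' (by lia) hs' hf hI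
      obtain ⟨t', s₂, he', ht', hI₂⟩ :=
        ih (k + 1) (by lia) s₁ (he.bdd hs') (hf.trans he.frame) hI₁
      refine ⟨_, s₂, .loopTrue _ _ _ _ _ _ _ (ho.fits hs') (hh.2 (by lia)) he he', ?_, hI₂⟩
      rw [Finset.sum_eq_sum_Ico_succ_bot (by lia)]
      lia
  rw [Finset.range_eq_Ico]
  exact key n 0 (by simp) s hs (Frame.refl _ _) h0

theorem Run.loop_const {w : ℕ} {b : Test} {p : Prog} {s : State} (I : ℕ → State → Prop) (n c : ℕ)
    (hs : Bdd w s) (h0 : I 0 s)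
    (hb : ∀ k s', k ≤ n → Bdd w s' → Frame p s s' → I k s' →
      b.Ok w s' ∧ (b.Holds s' ↔ k < n))
    (hp : ∀ k s', k < n → Bdd w s' → Frame p s s' → I k s' → Run w p s' c (I (k + 1))) :
    Run w (.loop b p) s (n * (c + b.cost + 1) + b.cost + 1) (I n) := by
  simpa using Run.loop I n (fun _ => c) hs h0 hb hp

/-! ### Programs without loops -/

/-- The weakest precondition of a program without loops. -/
def Prog.wp (w : ℕ) : Prog → (State → Prop) → State → Prop
  | .skip, Q, s => Q s
  | .assign x e, Q, s => e.Ok w s ∧ Q (s.setReg x (e.eval s))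
  | .write a i e, Q, s => i.Ok w s ∧ e.Ok w s ∧ Q (s.setArr a (i.eval s) (e.eval s))
  | .seq p q, Q, s => p.wp w (q.wp w Q) s
  | .ite b p q, Q, s => b.Ok w s ∧ (b.Holds s → p.wp w Q s) ∧ (¬ b.Holds s → q.wp w Q s)
  | .loop _ _, _, _ => False

/-- A bound on the running time of a program without loops. -/
def Prog.cost : Prog → ℕ
  | .skip => 1
  | .assign _ e => e.cost + 1
  | .write _ i e => i.cost + e.cost + 1
  | .seq p q => p.cost + q.cost
  | .ite b p q => b.cost + 1 + (p.cost + q.cost)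
  -- A default value: `Prog.wp` is `False` for loops, so it never bounds a running time.
  | .loop _ _ => 0

theorem Run.of_wp {w : ℕ} {p : Prog} {s : State} {Q : State → Prop} (hs : Bdd w s)
    (h : p.wp w Q s) : Run w p s p.cost Q := by
  induction p generalizing s Q with
  | skip => exact ⟨1, s, .skip s, le_rfl, h⟩
  | assign x e => exact ⟨_, _, .assign x e s (h.1.fits hs), le_rfl, h.2⟩
  | write a i e => exact ⟨_, _, .write a i e s (h.1.fits hs) (h.2.1.fits hs), le_rfl, h.2.2⟩
  | seq p q ihp ihq => exact (ihp hs h).seq hs fun s' hs' _ h' => ihq hs' h'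
  | ite b p q ihp ihq =>
    exact Run.ite hs h.1 (fun hb => (ihp hs (h.2.1 hb)).mono (by lia) hs fun _ _ _ h => h)
      fun hb => (ihq hs (h.2.2 hb)).mono (by lia) hs fun _ _ _ h => h
  | loop b p => exact h.elim

/-- Set cell `i` of array `a` to the value of `e`, for all `i` below `n`; the counter is
register `12`. -/
def fill (a : ℕ) (n e : Expr) : Prog :=
  .seq (.assign 12 (.const 0)) (.loop (.lt (.reg 12) n)
    (.seq (.write a (.reg 12) e) (.assign 12 (.add (.reg 12) (.const 1)))))

theorem run_fill {w : ℕ} {a : ℕ} {n e : Expr} {s : State} (m : ℕ) (F : ℕ → ℕ) (hs : Bdd w s)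
    (hm : m + 1 < cap w)
    (hn : ∀ s', (∀ x, x ≠ 12 → s'.reg x = s.reg x) → n.Ok w s' ∧ n.eval s' = m)
    (he : ∀ i s', i < m → s'.reg 12 = i → (∀ x, x ≠ 12 → s'.reg x = s.reg x) →
      (∀ b, b ≠ a → s'.arr b = s.arr b) → e.Ok w s' ∧ e.eval s' = F i) :
    Run w (fill a n e) s (m * (n.cost + e.cost + 9) + n.cost + 5)
      (fun s' => ∀ i < m, s'.arr a i = F i) := by
  have h0 : (0 : ℕ) < cap w := by lia
  refine ((Run.of_wp (p := .assign 12 (.const 0)) (Q := fun s' => s'.reg 12 = 0) hs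
    (by simp [Prog.wp, Expr.Ok, Expr.eval, h0])).seq hs fun s₁ hs₁ hf₁ h₁ =>
    Run.loop_const (fun k s' => s'.reg 12 = k ∧ ∀ i < k, s'.arr a i = F i) m
      (e.cost + 6) hs₁ ⟨h₁, by simp⟩ ?_ ?_).mono ?_ hs fun s' _ _ h => h.2
  · rintro k s' hk hs' hf ⟨hr, -⟩
    have := hn s' fun x hx => (hf.1 x (by simpa [Prog.regs] using hx)).trans
      (hf₁.1 x (by simpa [Prog.regs] using hx))
    simp [Test.Ok, Test.Holds, Expr.Ok, Expr.eval, this, hr]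
  · rintro k s' hk hs' hf ⟨hr, hI⟩
    have := he k s' hk hr (fun x hx => (hf.1 x (by simpa [Prog.regs] using hx)).trans
      (hf₁.1 x (by simpa [Prog.regs] using hx)))
      (fun x hx => (hf.2 x (by simpa [Prog.arrs] using hx)).trans
      (hf₁.2 x (by simp [Prog.arrs])))
    refine (Run.of_wp hs' ?_).mono (T := _) ?_ hs' fun s' _ _ h => h
    · simp only [Prog.wp, Expr.Ok, Expr.eval, State.setReg_reg, State.setArr_reg, hr, this,
        State.setReg_arr, State.setArr_arr_self]
      refine ⟨trivial, trivial, ⟨trivial, by lia, by lia⟩, by simp, fun i hi => ?_⟩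
      by_cases hik : i = k
      · simp [hik]
      · simp [hik, hI i (by lia)]
    · simp [Prog.cost, Expr.cost]; lia
  · simp only [Prog.cost, Expr.cost, Test.cost]
    have : m * (e.cost + 6 + (1 + n.cost + 1) + 1) = m * (n.cost + e.cost + 9) := by
      congr 1; lia
    lia

/-! ### Longest common subsequences of prefixes -/

/-- The length of a longest common subsequence of the prefixes of lengths `i` and `j`. -/
def lcs (X Y : ℕ → ℕ) : ℕ → ℕ → ℕ
  | 0, _ => 0
  | _ + 1, 0 => 0
  | i + 1, j + 1 =>
    if X i = Y j then lcs X Y i j + 1 else max (lcs X Y i (j + 1)) (lcs X Y (i + 1) j)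

theorem lcs_zero_left (X Y : ℕ → ℕ) (j : ℕ) : lcs X Y 0 j = 0 := by simp [lcs]

theorem lcs_zero_right (X Y : ℕ → ℕ) (i : ℕ) : lcs X Y i 0 = 0 := by cases i <;> simp [lcs]

theorem lcs_succ_succ (X Y : ℕ → ℕ) (i j : ℕ) : lcs X Y (i + 1) (j + 1) =
    if X i = Y j then lcs X Y i j + 1 else max (lcs X Y i (j + 1)) (lcs X Y (i + 1) j) := by
  rw [lcs]

/-- The two directions have to be proved together: in each case of the recursion, a bound for one
argument uses bounds for the other at smaller indices. -/
theorem lcs_succ_bounds (X Y : ℕ → ℕ) (i j : ℕ) :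
    (lcs X Y i j ≤ lcs X Y i (j + 1) ∧ lcs X Y i (j + 1) ≤ lcs X Y i j + 1) ∧
    (lcs X Y i j ≤ lcs X Y (i + 1) j ∧ lcs X Y (i + 1) j ≤ lcs X Y i j + 1) := by
  induction i generalizing j with
  | zero =>
    induction j with
    | zero => simp [lcs]
    | succ j ih =>
      have := lcs_succ_succ X Y 0 j
      simp only [lcs_zero_left] at *
      split_ifs at this <;> lia
  | succ i ih =>
    induction j with
    | zero =>
      have h1 := lcs_succ_succ X Y i 0
      have h2 := ih 0
      simp only [lcs_zero_right] at *
      split_ifs at h1 <;> lia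
    | succ j ih' =>
      have h1 := lcs_succ_succ X Y i j
      have h2 := lcs_succ_succ X Y i (j + 1)
      have h3 := lcs_succ_succ X Y (i + 1) j
      have h4 := ih j
      have h5 := ih (j + 1)
      split_ifs at h1 h2 h3 <;> lia

theorem lcs_le_left (X Y : ℕ → ℕ) (i j : ℕ) : lcs X Y i j ≤ i := by
  induction i with
  | zero => simp [lcs]
  | succ i ih => have := lcs_succ_bounds X Y i j; lia

/-- The list as a function on the natural numbers. -/
def str (A : List ℕ) (i : ℕ) : ℕ := A.getD i 0

theorem take_succ_str {A : List ℕ} {i : ℕ} (h : i < A.length) :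
    A.take (i + 1) = A.take i ++ [str A i] := by
  rw [str, List.getD_eq_getElem _ _ h, List.take_append_getElem]

theorem drop_str {A : List ℕ} {i : ℕ} (h : i < A.length) :
    A.drop i = str A i :: A.drop (i + 1) := by
  rw [str, List.getD_eq_getElem _ _ h, List.drop_eq_getElem_cons]

theorem sublist_snoc {Z L : List ℕ} {z x : ℕ} (h : List.Sublist (Z ++ [z]) (L ++ [x])) :
    List.Sublist Z L ∧ (z = x ∨ List.Sublist (Z ++ [z]) L) := by
  obtain ⟨l₁, l₂, h1, h2, h3⟩ := List.sublist_append_iff.1 h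
  rcases List.sublist_singleton.1 h3 with rfl | rfl
  · rw [List.append_nil] at h1
    subst h1
    exact ⟨(List.sublist_append_left _ _).trans h2, .inr h2⟩
  · obtain ⟨rfl, h4⟩ := List.append_inj' h1 rfl
    exact ⟨h2, .inl (by simpa using h4)⟩

/-- With `length_le_lcs`, this identifies the recursively defined `lcs` with the maximal length of a
common subsequence. -/
theorem exists_lcs {A B : List ℕ} {i j : ℕ} (hi : i ≤ A.length) (hj : j ≤ B.length) :
    ∃ Z, List.Sublist Z (A.take i) ∧ List.Sublist Z (B.take j) ∧
      Z.length = lcs (str A) (str B) i j := by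
  induction i generalizing j with
  | zero => exact ⟨[], by simp [lcs]⟩
  | succ i ih =>
    induction j with
    | zero => exact ⟨[], by simp [lcs]⟩
    | succ j ih' =>
      rw [lcs_succ_succ]
      split_ifs with h
      · obtain ⟨Z, h1, h2, h3⟩ := ih (j := j) (by lia) (by lia)
        refine ⟨Z ++ [str A i], ?_, ?_, by simp [h3]⟩
        · rw [take_succ_str (by lia)]
          exact h1.append_right _
        · rw [take_succ_str (by lia), h]
          exact h2.append_right _
      · rcases le_total (lcs (str A) (str B) i (j + 1)) (lcs (str A) (str B) (i + 1) j) with h' | h'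
        · obtain ⟨Z, h1, h2, h3⟩ := ih' (by lia)
          refine ⟨Z, h1, h2.trans (List.take_sublist_take_left (by lia)), by lia⟩
        · obtain ⟨Z, h1, h2, h3⟩ := ih (j := j + 1) (by lia) (by lia)
          refine ⟨Z, h1.trans (List.take_sublist_take_left (by lia)), h2, by lia⟩

theorem length_le_lcs {A B Z : List ℕ} {i j : ℕ} (hi : i ≤ A.length) (hj : j ≤ B.length)
    (hA : List.Sublist Z (A.take i)) (hB : List.Sublist Z (B.take j)) :
    Z.length ≤ lcs (str A) (str B) i j := by
  induction i generalizing j Z with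
  | zero => simp_all
  | succ i ih =>
    induction j generalizing Z with
    | zero => simp_all
    | succ j ih' =>
      rcases List.eq_nil_or_concat' Z with rfl | ⟨Z, z, rfl⟩
      · simp
      have hA' := hA
      have hB' := hB
      rw [take_succ_str (by lia)] at hA' hB'
      obtain ⟨h1, h2⟩ := sublist_snoc hA'
      obtain ⟨h3, h4⟩ := sublist_snoc hB'
      rw [lcs_succ_succ]
      split_ifs with h
      · have := ih (by lia) (by lia) h1 h3
        simpa using this
      -- The last characters of the prefixes differ, so `z` can be matched to at most one of them;
      -- the other one can be dropped.
      · rcases h2 with rfl | h2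
        · rcases h4 with h4 | h4
          · exact absurd h4 h
          · exact le_max_of_le_right (ih' (by lia) hA h4)
        · exact le_max_of_le_left (ih (by lia) hj h2 hB)

/-! ### Adding a block of equal characters -/

/-- While a block of `l` copies of `c` is added after the prefix of length `i₀` of `X`, and the
columns up to `j` are done, the entries `q hd, …, q (tl - 1)` describe the column: each of them is
the number of an occurrence of `c` in `Y`, and determines one row in which the value increases. -/
structure Deque (X Y : ℕ → ℕ) (i₀ l j cn hd tl : ℕ) (q : ℕ → ℕ) : Prop where
  hd_le : hd ≤ tl
  tl_le : tl ≤ j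
  cn_le : cn ≤ j
  mono : ∀ x y, hd ≤ x → x < y → y < tl → q x < q y
  range : ∀ x, hd ≤ x → x < tl → cn < q x + l ∧ q x ≤ cn
  col : ∀ k ≤ l, lcs X Y (i₀ + k) j =
    lcs X Y i₀ j + ∑ x ∈ Finset.Ico hd tl, if cn < q x + k then 1 else 0

theorem Deque.init (X Y : ℕ → ℕ) (i₀ l : ℕ) (q : ℕ → ℕ) : Deque X Y i₀ l 0 0 0 0 q :=
  ⟨le_rfl, le_rfl, le_rfl, by lia, by lia, by simp [lcs_zero_right]⟩

/-- Every entry in the queue has taken effect by row `l`, so the new row is the old one plus the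
length of the queue. No intermediate row is ever computed. -/
theorem Deque.value {X Y : ℕ → ℕ} {i₀ l j cn hd tl : ℕ} {q : ℕ → ℕ}
    (h : Deque X Y i₀ l j cn hd tl q) : lcs X Y (i₀ + l) j = lcs X Y i₀ j + (tl - hd) := by
  rw [h.col l le_rfl, Finset.sum_congr rfl fun x hx => if_pos
    (h.range x (Finset.mem_Ico.1 hx).1 (Finset.mem_Ico.1 hx).2).1]
  simp

/-- The oldest entry expires. -/
theorem Deque.expire {X Y : ℕ → ℕ} {i₀ l j cn hd tl : ℕ} {q : ℕ → ℕ}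
    (h : Deque X Y i₀ l j cn hd tl q) :
    ∃ hd', hd' = (if hd < tl ∧ q hd + l ≤ cn + 1 then hd + 1 else hd) ∧ hd' ≤ tl ∧
      (∀ x, hd' ≤ x → x < tl → hd ≤ x ∧ cn + 1 < q x + l) ∧
      ∀ k < l, ∑ x ∈ Finset.Ico hd tl, (if cn < q x + k then 1 else 0) =
        ∑ x ∈ Finset.Ico hd' tl, if cn < q x + k then 1 else 0 := by
  refine ⟨_, rfl, ?_⟩
  split_ifs with hc
  · refine ⟨by lia, fun x hx hx' => ⟨by lia, ?_⟩, fun k hk => ?_⟩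
    -- Entries strictly increase and all satisfy `cn < q x + l`, so raising `cn` by one can
    -- invalidate only the oldest.
    · have := h.mono hd x le_rfl (by lia) hx'
      have := h.range hd le_rfl hc.1
      lia
    · rw [Finset.sum_eq_sum_Ico_succ_bot hc.1, if_neg (by lia), zero_add]
  · refine ⟨h.hd_le, fun x hx hx' => ⟨hx, ?_⟩, fun k hk => rfl⟩
    rcases hx.eq_or_lt with rfl | hlt
    · have := h.range hd le_rfl hx'
      lia
    · have := h.mono hd x le_rfl hlt hx'
      have := h.range hd le_rfl (by lia)
      lia

/-- A match moves along the diagonal: row `k + 1` of the new column is row `k` of the old one plus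
one. Hence all steps move down by one row, which is expressed by increasing `cn` instead of changing
the entries, and the one that leaves the block expires. The extra one is already present in row `0`
if the old LCS row grows at this column; otherwise it is a new step between rows `0` and `1`, given
by the entry `cn + 1`. -/
theorem Deque.step_match {X Y : ℕ → ℕ} {i₀ l j cn hd tl hd' tl' : ℕ} {q q' : ℕ → ℕ}
    (h : Deque X Y i₀ l j cn hd tl q) (hl : 0 < l) (hX : ∀ k < l, X (i₀ + k) = Y j)
    (hhd : hd' = if hd < tl ∧ q hd + l ≤ cn + 1 then hd + 1 else hd)
    (htl : tl' = if lcs X Y i₀ (j + 1) = lcs X Y i₀ j then tl + 1 else tl)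
    (hq : ∀ x < tl, q' x = q x)
    (hq' : lcs X Y i₀ (j + 1) = lcs X Y i₀ j → q' tl = cn + 1) :
    Deque X Y i₀ l (j + 1) (cn + 1) hd' tl' q' := by
  obtain ⟨hd'', h1, h2, h3, h4⟩ := h.expire
  rw [← h1] at hhd
  subst hhd
  clear h1
  have htj := h.tl_le
  have hcj := h.cn_le
  have hb := (lcs_succ_bounds X Y i₀ j).1
  have hcol : ∀ k < l, lcs X Y (i₀ + (k + 1)) (j + 1) = lcs X Y i₀ j + 1 +
      ∑ x ∈ Finset.Ico hd' tl, if cn + 1 < q' x + (k + 1) then 1 else 0 := by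
    intro k hk
    rw [← add_assoc, lcs_succ_succ, if_pos (hX k hk), h.col k hk.le, h4 k hk, add_right_comm]
    congr 1
    refine Finset.sum_congr rfl fun x hx => ?_
    rw [hq x (Finset.mem_Ico.1 hx).2]
    congr 1
    simp only [eq_iff_iff]
    lia
  -- Row `0` lies above all the steps, because no entry exceeds the current count.
  have hzero : ∀ tl'', tl'' = tl ∨ tl'' = tl' → 
      ∑ x ∈ Finset.Ico hd' tl'', (if cn + 1 < q' x + 0 then 1 else 0) = 0 := by
    intro tl'' ht
    refine Finset.sum_eq_zero fun x hx => if_neg ?_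
    rw [Finset.mem_Ico] at hx
    by_cases hx' : x < tl
    · have := h.range x (h3 x hx.1 hx').1 hx'
      rw [hq x hx']
      lia
    · split_ifs at htl with heq
      · obtain rfl : x = tl := by lia
        rw [hq' heq]
        lia
      · lia
  split_ifs at htl with heq
  · subst htl
    refine ⟨by lia, by lia, by lia, fun x y hx hxy hy => ?_, fun x hx hx' => ?_, fun k hk => ?_⟩
    · rw [hq x (by lia)]
      by_cases hy' : y < tl
      · rw [hq y hy']
        exact h.mono x y (h3 x hx (by lia)).1 hxy hy'
      · obtain rfl : y = tl := by lia
        have := h.range x (h3 x hx (by lia)).1 (by lia)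
        rw [hq' heq]
        lia
    · by_cases hx'' : x < tl
      · have := h3 x hx hx''
        have := h.range x this.1 hx''
        rw [hq x hx'']
        lia
      · obtain rfl : x = tl := by lia
        rw [hq' heq]
        lia
    · rcases k with _ | k
      · rw [hzero _ (.inr rfl)]
        rfl
      · rw [hcol k (by lia), Finset.sum_Ico_succ_top h2, hq' heq, if_pos (by lia), heq]
        lia
  · subst htl
    refine ⟨by lia, by lia, by lia, fun x y hx hxy hy => ?_, fun x hx hx' => ?_, fun k hk => ?_⟩
    · rw [hq x (by lia), hq y hy]
      exact h.mono x y (h3 x hx (by lia)).1 hxy hy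
    · have := h3 x hx hx'
      have := h.range x this.1 hx'
      rw [hq x hx']
      lia
    · rcases k with _ | k
      · rw [hzero _ (.inr rfl)]
        rfl
      · rw [hcol k (by lia)]
        lia

/-- Without a match, the new column is the maximum of the old column and the new value in row `0`.
If that value has grown by one, the maximum swallows the uppermost step, which is the newest entry.
-/
theorem Deque.step_mismatch {X Y : ℕ → ℕ} {i₀ l j cn hd tl tl' : ℕ} {q : ℕ → ℕ}
    (h : Deque X Y i₀ l j cn hd tl q) (hX : ∀ k < l, X (i₀ + k) ≠ Y j)
    (htl : tl' = if ¬ lcs X Y i₀ (j + 1) = lcs X Y i₀ j ∧ hd < tl then tl - 1 else tl) :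
    Deque X Y i₀ l (j + 1) cn hd tl' q := by
  have hhd := h.hd_le
  have htj := h.tl_le
  have hcj := h.cn_le
  have hb := (lcs_succ_bounds X Y i₀ j).1
  have htl' : tl' ≤ tl := by split_ifs at htl <;> lia
  have hhd' : hd ≤ tl' := by split_ifs at htl <;> lia
  refine ⟨hhd', by lia, by lia, fun x y hx hxy hy => h.mono x y hx hxy (by lia),
    fun x hx hx' => h.range x hx (by lia), fun k hk => ?_⟩
  have hzero : ∑ x ∈ Finset.Ico hd tl', (if cn < q x + 0 then 1 else 0) = 0 := by
    refine Finset.sum_eq_zero fun x hx => if_neg ?_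
    rw [Finset.mem_Ico] at hx
    have := h.range x hx.1 (by lia)
    lia
  -- Unrolling the mismatch recursion down the block; the intermediate old values disappear by
  -- monotonicity.
  have hmax : ∀ k ≤ l, lcs X Y (i₀ + k) (j + 1) =
      max (lcs X Y i₀ (j + 1)) (lcs X Y (i₀ + k) j) := by
    intro k hk
    induction k with
    | zero => rw [add_zero]; lia
    | succ k ih =>
      have h1 := ih (by lia)
      have h2 := (lcs_succ_bounds X Y (i₀ + k) j).2
      rw [← add_assoc, lcs_succ_succ, if_neg (hX k (by lia)), h1]
      lia
  rw [hmax k hk, h.col k hk]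
  split_ifs at htl with hc
  · obtain ⟨t, rfl⟩ : ∃ t, tl = t + 1 := ⟨tl - 1, by lia⟩
    obtain rfl : tl' = t := by lia
    rw [Finset.sum_Ico_succ_top (by lia)]
    by_cases ht : cn < q tl' + k
    · rw [if_pos ht]
      lia
    -- The newest entry is the largest, so if it has no effect at row `k`, none has.
    · have : ∑ x ∈ Finset.Ico hd tl', (if cn < q x + k then 1 else 0) = 0 := by
        refine Finset.sum_eq_zero fun x hx => if_neg ?_
        rw [Finset.mem_Ico] at hx
        have := h.mono x tl' hx.1 hx.2 (by lia)
        lia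
      rw [this, if_neg ht]
      lia
  · subst htl
    rcases not_and_or.1 hc with hc | hc
    · lia
    · rw [Finset.Ico_eq_empty (by lia)]
      simp only [Finset.sum_empty]
      lia

/-! ### Greedy embeddings -/

/-- The first position from `i` on that lies outside the string or holds the character `c`. -/
noncomputable def next (X : ℕ → ℕ) (L c i : ℕ) : ℕ :=
  Nat.find (⟨max i L, le_max_left _ _, .inl (le_max_right _ _)⟩ :
    ∃ k, i ≤ k ∧ (L ≤ k ∨ X k = c))

theorem next_spec (X : ℕ → ℕ) (L c i : ℕ) : i ≤ next X L c i ∧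
    (L ≤ next X L c i ∨ X (next X L c i) = c) ∧
    ∀ l, i ≤ l → l < next X L c i → l < L ∧ X l ≠ c := by
  have h : ∃ k, i ≤ k ∧ (L ≤ k ∨ X k = c) := ⟨max i L, le_max_left _ _, .inl (le_max_right _ _)⟩
  refine ⟨(Nat.find_spec h).1, (Nat.find_spec h).2, fun l hl hl' => ?_⟩
  have := Nat.find_min h hl'
  constructor <;> by_contra h' <;> exact this ⟨hl, by left; lia⟩

theorem next_eq {X : ℕ → ℕ} {L c i k : ℕ} (h1 : i ≤ k) (h2 : L ≤ k ∨ X k = c)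
    (h3 : ∀ l, i ≤ l → l < k → l < L ∧ X l ≠ c) : next X L c i = k := by
  obtain ⟨h4, h5, h6⟩ := next_spec X L c i
  rcases lt_trichotomy (next X L c i) k with h | h | h
  · have := h3 _ h4 h
    rcases h5 with h5 | h5
    · lia
    · exact absurd h5 this.2
  · exact h
  · have := h6 _ h1 h
    rcases h2 with h2 | h2
    · lia
    · exact absurd h2 this.2

theorem next_le (X : ℕ → ℕ) (L c i : ℕ) : next X L c i ≤ max i L := by
  by_contra! h
  have := ((next_spec X L c i).2.2 _ (le_max_left i L) h).1
  lia

/-- The end of the greedy embedding of the string `D` into `X`, starting at position `i`; it is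
greater than `L` if there is no embedding. -/
noncomputable def greedy (X : ℕ → ℕ) (L i : ℕ) (D : List ℕ) : ℕ :=
  D.foldl (fun i c => next X L c i + 1) i

theorem greedy_snoc (X : ℕ → ℕ) (L i : ℕ) (D : List ℕ) (c : ℕ) :
    greedy X L i (D ++ [c]) = next X L c (greedy X L i D) + 1 := by
  simp [greedy]

theorem le_greedy (X : ℕ → ℕ) (L i : ℕ) (D : List ℕ) : i ≤ greedy X L i D := by
  induction D using List.reverseRecOn with
  | nil => simp [greedy]
  | append_singleton D c ih =>
    rw [greedy_snoc]
    have := (next_spec X L c (greedy X L i D)).1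
    lia

theorem greedy_le (X : ℕ → ℕ) (L i : ℕ) (D : List ℕ) :
    greedy X L i D ≤ max i L + D.length := by
  induction D using List.reverseRecOn with
  | nil => simp [greedy]
  | append_singleton D c ih =>
    rw [greedy_snoc, List.length_append]
    have := next_le X L c (greedy X L i D)
    simp only [List.length_singleton]
    lia

/-- The positions visited by the greedy search form an embedding of `D`, provided that it stays
inside the string. -/
theorem append_sublist_of_greedy {A D Y : List ℕ} {e : ℕ}
    (hg : greedy (str A) A.length e D ≤ A.length)
    (hY : List.Sublist Y (A.drop (greedy (str A) A.length e D))) :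
    List.Sublist (D ++ Y) (A.drop e) := by
  induction D using List.reverseRecOn generalizing Y with
  | nil => simpa [greedy] using hY
  | append_singleton D c ih =>
    rw [greedy_snoc] at hg hY
    obtain ⟨h1, h2, -⟩ := next_spec (str A) A.length c (greedy (str A) A.length e D)
    rw [List.append_assoc]
    refine ih (by lia) ?_
    refine List.Sublist.trans ?_ (List.drop_sublist_drop_left A h1)
    rw [drop_str (by lia), h2.resolve_left (by lia)]
    exact hY.cons_cons c

/-- The exchange step for greedy embeddings: the first character may be moved to its earliest
occurrence. -/
theorem cons_sublist_drop {A Y : List ℕ} {c i : ℕ} (hi : i ≤ A.length)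
    (h : List.Sublist (c :: Y) (A.drop i)) :
    next (str A) A.length c i < A.length ∧
      List.Sublist Y (A.drop (next (str A) A.length c i + 1)) := by
  obtain ⟨d, hd⟩ : ∃ d, i + d = A.length := ⟨A.length - i, by lia⟩
  induction d generalizing i with
  | zero =>
    rw [List.drop_eq_nil_of_le (by lia)] at h
    simp at h
  | succ d ih =>
    have h' := h
    rw [drop_str (by lia)] at h'
    by_cases hc : str A i = c
    · have : next (str A) A.length c i = i := next_eq le_rfl (.inr hc) (by lia)
      rw [this]
      rw [hc] at h'
      exact ⟨by lia, by simpa using h'⟩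
    · have h1 : List.Sublist (c :: Y) (A.drop (i + 1)) := by
        rcases List.sublist_cons_iff.1 h' with h' | ⟨r, h', -⟩
        · exact h'
        · exact absurd (List.cons.inj h').1.symm hc
      have h2 : next (str A) A.length c i = next (str A) A.length c (i + 1) := by
        obtain ⟨h3, h4, h5⟩ := next_spec (str A) A.length c (i + 1)
        refine next_eq (by lia) h4 fun l hl hl' => ?_
        rcases hl.eq_or_lt with rfl | hl
        · exact ⟨by lia, hc⟩
        · exact h5 l hl hl'
      rw [h2]
      exact ih (by lia) h1 (by lia)

/-- Greedy stays ahead: no embedding of `D` from `e` ends earlier, so any `Y` that fits behind some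
embedding fits behind the greedy one. -/
theorem greedy_of_append_sublist {A D Y : List ℕ} {e : ℕ} (he : e ≤ A.length)
    (h : List.Sublist (D ++ Y) (A.drop e)) : greedy (str A) A.length e D ≤ A.length ∧
      List.Sublist Y (A.drop (greedy (str A) A.length e D)) := by
  induction D using List.reverseRecOn generalizing Y with
  | nil => exact ⟨he, h⟩
  | append_singleton D c ih =>
    rw [List.append_assoc] at h
    obtain ⟨h1, h2⟩ := ih h
    rw [greedy_snoc]
    exact cons_sublist_drop h1 h2

/-! ### Slots for the pattern -/

/-- The number of occurrences of `a` among the first `i` characters. -/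
def cnt (X : ℕ → ℕ) (a : ℕ) : ℕ → ℕ
  | 0 => 0
  | i + 1 => cnt X a i + if X i = a then 1 else 0

theorem cnt_le (X : ℕ → ℕ) (a i : ℕ) : cnt X a i ≤ i := by
  induction i with
  | zero => simp [cnt]
  | succ i ih => simp only [cnt]; split_ifs <;> lia

theorem cnt_mono (X : ℕ → ℕ) (a : ℕ) {i j : ℕ} (h : i ≤ j) : cnt X a i ≤ cnt X a j := by
  induction h with
  | refl => exact le_rfl
  | step _ ih => exact ih.trans (by simp [cnt])

theorem count_take {A : List ℕ} {a i : ℕ} (hi : i ≤ A.length) :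
    (A.take i).count a = cnt (str A) a i := by
  induction i with
  | zero => simp [cnt]
  | succ i ih =>
    rw [take_succ_str (by lia), List.count_append, ih (by lia), cnt, List.count_singleton]
    simp

theorem count_drop_take {A : List ℕ} {a s e : ℕ} (hs : s ≤ e) (he : e ≤ A.length) :
    cnt (str A) a s + ((A.take e).drop s).count a = cnt (str A) a e := by
  rw [← count_take (hs.trans he), ← count_take he, ← List.count_append]
  congr 1
  conv_rhs => rw [← List.take_append_drop s (A.take e), List.take_take, min_eq_left hs]

/-- `e` is a position behind a run of `a`, with at least `p` copies of `a` before it. -/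
def IsRunEnd (X : ℕ → ℕ) (L a p e : ℕ) : Prop :=
  0 < e ∧ e ≤ L ∧ X (e - 1) = a ∧ (e = L ∨ X e ≠ a) ∧ p ≤ cnt X a e

/-- From position `s` to position `e` there are exactly `p` copies of `a`, the first one at `s`. -/
def IsBlock (X : ℕ → ℕ) (L a p s e : ℕ) : Prop :=
  s < e ∧ e ≤ L ∧ X s = a ∧ cnt X a s + p = cnt X a e

/-- Soundness of a slot: `W`, the copies of `a` and `D ++ Y` go into the three pieces into which `s`
and `e` cut `A`. -/
theorem sublist_of_isBlock {A D W Y : List ℕ} {a p s e : ℕ}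
    (h : IsBlock (str A) A.length a p s e) (hg : greedy (str A) A.length e D ≤ A.length)
    (hW : List.Sublist W (A.take s)) (hY : List.Sublist Y (A.drop (greedy (str A) A.length e D))) :
    List.Sublist (W ++ (List.replicate p a ++ D) ++ Y) A := by
  obtain ⟨h1, h2, -, h4⟩ := h
  have h5 := append_sublist_of_greedy hg hY
  have h6 : List.Sublist (List.replicate p a) ((A.take e).drop s) := by
    rw [List.replicate_sublist_iff]
    have := count_drop_take (a := a) h1.le h2
    lia
  have h7 : A = A.take s ++ ((A.take e).drop s ++ A.drop e) := by
    conv_lhs => rw [← List.take_append_drop e A, ← List.take_append_drop s (A.take e),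
      List.take_take, min_eq_left h1.le, List.append_assoc]
  have h8 := hW.append (h6.append h5)
  rw [← h7] at h8
  simpa using h8

/-- Completeness of the slots. Moving the last copy of `a` to the end of its run costs the rest
nothing, because the rest begins with `b ≠ a` and cannot use the skipped copies of `a`. -/
theorem exists_isRunEnd {A D W Y : List ℕ} {a b p : ℕ} (hp : 0 < p) (hb : b ≠ a)
    (h : List.Sublist (W ++ (List.replicate p a ++ b :: D) ++ Y) A) :
    ∃ e, IsRunEnd (str A) A.length a p e ∧ greedy (str A) A.length e (b :: D) ≤ A.length ∧
      List.Sublist Y (A.drop (greedy (str A) A.length e (b :: D))) ∧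
      ∀ s, IsBlock (str A) A.length a p s e → List.Sublist W (A.take s) := by
  obtain ⟨p, rfl⟩ : ∃ p', p = p' + 1 := ⟨p - 1, by lia⟩
  -- Isolate the last `a` of the first run of the pattern; its image determines the run of `A`.
  replace h : List.Sublist ((W ++ List.replicate p a) ++ a :: (b :: D ++ Y)) A := by
    simpa [List.replicate_succ'] using h
  obtain ⟨l₁, l₂, rfl, h1, h2⟩ := List.append_sublist_iff.1 h
  set A := l₁ ++ l₂ with hA
  have hl : l₁.length ≤ A.length := by simp [hA]
  have h1' : List.Sublist (W ++ List.replicate p a) (A.take l₁.length) := by simpa [hA] using h1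
  have h2' : List.Sublist (a :: (b :: D ++ Y)) (A.drop l₁.length) := by simpa [hA] using h2
  obtain ⟨h3, h4⟩ := cons_sublist_drop hl h2'
  obtain ⟨h5, h6, -⟩ := next_spec (str A) A.length a l₁.length
  set k := next (str A) A.length a l₁.length with hk
  clear_value k
  replace h6 := h6.resolve_left (by lia)
  have h7 : List.Sublist (W ++ List.replicate (p + 1) a) (A.take (k + 1)) := by
    rw [take_succ_str h3, h6, List.replicate_succ', ← List.append_assoc]
    exact (h1'.trans (List.take_sublist_take_left h5)).append_right _
  clear h1' h2' h1 h2 h5 hA hk h hl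
  clear_value A
  -- move to the end of the run
  obtain ⟨e, he1, he2, he3, he4, he5⟩ : ∃ e, k < e ∧ e ≤ A.length ∧ str A (e - 1) = a ∧
      (e = A.length ∨ str A e ≠ a) ∧ List.Sublist (b :: D ++ Y) (A.drop e) := by
    obtain ⟨d, hd⟩ : ∃ d, k + 1 + d = A.length := ⟨A.length - k - 1, by lia⟩
    induction d generalizing k with
    | zero => exact ⟨k + 1, by lia, by lia, h6, .inl (by lia), h4⟩
    | succ d ih =>
      by_cases hk : str A (k + 1) = a
      · obtain ⟨e, he⟩ := ih (k + 1) (by lia) (by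
          rw [drop_str (by lia), hk] at h4
          rcases List.sublist_cons_iff.1 h4 with h' | ⟨r, h', -⟩
          · exact h'
          · exact absurd (List.cons.inj h').1 hb) hk
          (h7.trans (List.take_sublist_take_left (by lia))) (by lia)
        exact ⟨e, by lia, he.2⟩
      · exact ⟨k + 1, by lia, by lia, h6, .inr hk, h4⟩
  have h8 : List.Sublist (W ++ List.replicate (p + 1) a) (A.take e) :=
    h7.trans (List.take_sublist_take_left (by lia))
  obtain ⟨h9, h10⟩ := greedy_of_append_sublist he2 he5
  refine ⟨e, ⟨by lia, he2, he3, he4, ?_⟩, h9, h10, ?_⟩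
  · rw [← count_take he2, ← List.replicate_sublist_iff]
    exact (List.sublist_append_right _ _).trans h8
  · rintro s ⟨hs1, -, hs2, hs3⟩
    obtain ⟨r₁, r₂, hr, hr1, hr2⟩ := List.append_sublist_iff.1 h8
    have hlen : r₁.length ≤ e := by
      have := congrArg List.length hr
      rw [List.length_take, List.length_append] at this
      omega
    have hr1' : r₁ = A.take r₁.length := by
      have := congrArg (List.take r₁.length) hr
      rw [List.take_take, min_eq_left hlen] at this
      simpa using this.symm
    have hr2' : r₂ = (A.take e).drop r₁.length := by simp [hr]
    rw [hr2'] at hr2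
    have h11 := List.replicate_sublist_iff.1 hr2
    have h12 := count_drop_take (a := a) hlen he2
    -- The part behind `r₁` contains all the required copies of `a`, and from `s` to `e` there are
    -- exactly that many. A cut behind `s` would lose the copy at `s`.
    have h13 : r₁.length ≤ s := by
      by_contra! hlt
      have := cnt_mono (str A) a (i := s + 1) (j := r₁.length) (by lia)
      simp only [cnt, hs2, if_true] at this
      lia
    rw [hr1'] at hr1
    exact hr1.trans (List.take_sublist_take_left h13)

/-! ### Runs -/

/-- The number of runs among the first `i` characters. -/
def runs (X : ℕ → ℕ) : ℕ → ℕ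
  | 0 => 0
  | i + 1 => runs X i + if 0 < i ∧ X i = X (i - 1) then 0 else 1

/-- `rle` recurses from the front, whereas the scan and `runs` proceed from left to right; this is
the recursion at the other end. -/
theorem rle_snoc {α : Type} [DecidableEq α] (l : List α) (x : α) :
    (rle (l ++ [x])).length = (rle l).length + if l.getLast? = some x then 0 else 1 := by
  have hhead : ∀ (a : α) (l : List α), (rle (a :: l)).head?.map Prod.fst = some a := by
    intro a l
    rw [rle]
    split
    · rfl
    · split_ifs with h
      · simp [h]
      · rfl
  induction l with
  | nil => simp [rle]
  | cons a l ih =>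
    rcases l with _ | ⟨b, l⟩
    · by_cases h : a = x <;> simp [rle, h]
    · have key : ∀ l' : List α, (rle (a :: b :: l')).length =
          (rle (b :: l')).length + if a = b then 0 else 1 := by
        intro l'
        have := hhead b l'
        conv_lhs => rw [rle]
        rcases hr : rle (b :: l') with _ | ⟨⟨c, k⟩, r⟩
        · simp [hr] at this
        · have hc : c = b := by simpa [hr] using this
          subst hc
          simp only
          split_ifs <;> simp
      rw [List.cons_append, List.cons_append, key, key, ← List.cons_append, ih,
        List.getLast?_cons_cons]
      lia

theorem runs_eq (A : List ℕ) : (rle A).length = runs (str A) A.length := by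
  have key : ∀ i ≤ A.length, (rle (A.take i)).length = runs (str A) i := by
    intro i hi
    induction i with
    | zero => simp [rle, runs]
    | succ i ih =>
      rw [take_succ_str (by lia), rle_snoc, ih (by lia), runs]
      congr 2
      rcases i with _ | i
      · simp
      · rw [take_succ_str (by lia)]
        simp [eq_comm]
  simpa using key A.length le_rfl

theorem rle_map {α β : Type} [DecidableEq α] [DecidableEq β] {f : α → β}
    (hf : Function.Injective f) (l : List α) :
    rle (l.map f) = (rle l).map (Prod.map f id) := by
  induction l with
  | nil => rfl
  | cons a l ih =>
    rw [List.map_cons, rle, rle, ih]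
    rcases rle l with _ | ⟨⟨b, k⟩, r⟩
    · rfl
    · by_cases h : a = b
      · simp [h]
      · simp [h, hf.ne h]

theorem runs_le (X : ℕ → ℕ) (i : ℕ) : runs X i ≤ i := by
  induction i with
  | zero => simp [runs]
  | succ i ih => rw [runs]; split_ifs <;> lia

local infixr:60 " ;; " => Prog.seq

/-! ### Scanning a string

The string is in array `3`, its length `L` in register `3`; register `4` holds the length `p` and
register `5` the character `a` of the first run of the pattern.  Register `12` is the position,
register `10` the number of runs so far and register `11` the number of occurrences of `a`. -/

/-- The starts `st r` of the runs among the first `i` characters, and the number `ro l` of the run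
of each position `l`. -/
structure RunTable (X : ℕ → ℕ) (i R : ℕ) (st ro : ℕ → ℕ) : Prop where
  eq_runs : R = runs X i
  st_lt : ∀ r < R, st r < i
  run_of : ∀ l < i, ro l < R ∧ st (ro l) ≤ l ∧ ∀ x, st (ro l) ≤ x → x ≤ l → X x = X l
  segment : ∀ r, r + 1 < R → st r < st (r + 1) ∧ ∀ x, st r ≤ x → x < st (r + 1) → X x = X (st r)
  last : 0 < R → ∀ x, st (R - 1) ≤ x → x < i → X x = X (st (R - 1))
  boundary : ∀ k, 0 < k → k < i → X k ≠ X (k - 1) → ∃ r < R, st r = k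

theorem runs_pos {X : ℕ → ℕ} {i : ℕ} (hi : 0 < i) : 0 < runs X i := by
  induction i with
  | zero => omega
  | succ i ih =>
    rw [runs]
    rcases Nat.eq_zero_or_pos i with rfl | h
    · simp
    · have := ih h
      omega

theorem RunTable.step_same {X : ℕ → ℕ} {i R : ℕ} {st ro ro' : ℕ → ℕ} (h : RunTable X i R st ro)
    (hi : 0 < i) (hX : X i = X (i - 1)) (hro : ∀ l, ro' l = if l = i then R - 1 else ro l) :
    RunTable X (i + 1) R st ro' := by
  have hR : 0 < R := by rw [h.eq_runs]; exact runs_pos hi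
  have hst := h.st_lt (R - 1) (by omega)
  have hi' : X i = X (st (R - 1)) := by rw [hX]; exact h.last hR _ (by omega) (by omega)
  have hlast : ∀ x, st (R - 1) ≤ x → x < i + 1 → X x = X (st (R - 1)) := by
    intro x hx hx'
    by_cases hxi : x = i
    · rw [hxi, hi']
    · exact h.last hR x hx (by omega)
  refine ⟨?_, fun r hr => (h.st_lt r hr).trans (by omega), fun l hl => ?_, h.segment,
    fun _ => hlast, fun k hk hk' hne => ?_⟩
  · rw [runs, if_pos ⟨hi, hX⟩, h.eq_runs, add_zero]
  · rw [hro]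
    split_ifs with hli
    · subst hli
      exact ⟨by omega, by omega, fun x hx hx' => by rw [hi', hlast x hx (by omega)]⟩
    · exact h.run_of l (by omega)
  · by_cases hki : k = i
    · rw [hki] at hne
      exact absurd hX hne
    · exact h.boundary k hk (by omega) hne

theorem RunTable.step_new {X : ℕ → ℕ} {i R : ℕ} {st ro st' ro' : ℕ → ℕ} (h : RunTable X i R st ro)
    (hX : ¬ (0 < i ∧ X i = X (i - 1))) (hst : ∀ r, st' r = if r = R then i else st r)
    (hro : ∀ l, ro' l = if l = i then R else ro l) :
    RunTable X (i + 1) (R + 1) st' ro' := by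
  have hst' : ∀ r < R, st' r = st r := fun r hr => by rw [hst, if_neg (by omega)]
  have hstR : st' R = i := by rw [hst, if_pos rfl]
  refine ⟨?_, fun r hr => ?_, fun l hl => ?_, fun r hr => ?_, fun _ x hx hx' => ?_,
    fun k hk hk' hne => ?_⟩
  · rw [runs, if_neg hX, h.eq_runs]
  · rw [hst]
    split_ifs
    · omega
    · have := h.st_lt r (by omega)
      omega
  · rw [hro]
    split_ifs with hli
    · rw [hstR, hli]
      exact ⟨by omega, le_rfl, fun x hx hx' => by rw [le_antisymm hx' hx]⟩
    · have := h.run_of l (by omega)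
      rw [hst' _ this.1]
      exact ⟨by omega, this.2⟩
  · rw [hst' r (by omega)]
    by_cases hr' : r + 1 < R
    · rw [hst' _ hr']
      exact h.segment r hr'
    · obtain rfl : R = r + 1 := by omega
      rw [hstR]
      exact ⟨h.st_lt r (by omega), fun x hx hx' => h.last (by omega) x hx hx'⟩
  · rw [Nat.add_sub_cancel, hstR] at *
    rw [show x = i by omega]
  · by_cases hki : k = i
    · exact ⟨R, by omega, by rw [hstR, hki]⟩
    · obtain ⟨r, hr, h'⟩ := h.boundary k hk (by omega) hne
      exact ⟨r, by omega, by rw [hst' r hr, h']⟩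

/-- Record the run of the current position. -/
def scanRun : Prog :=
  .ite (.and (.lt (.const 0) (.reg 12))
      (.eq (.get 3 (.reg 12)) (.get 3 (.sub (.reg 12) (.const 1)))))
    .skip (.write 10 (.reg 10) (.reg 12) ;; .assign 10 (.add (.reg 10) (.const 1))) ;;
  .write 11 (.reg 12) (.sub (.reg 10) (.const 1))

theorem run_scanRun {w : ℕ} {s : State} {X : ℕ → ℕ} {i : ℕ} (hs : Bdd w s) (hw : i + 1 < cap w)
    (hi : s.reg 12 = i) (hX : ∀ k ≤ i, s.arr 3 k = X k)
    (h : RunTable X i (s.reg 10) (s.arr 10) (s.arr 11)) :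
    Run w scanRun s scanRun.cost
      fun s' => RunTable X (i + 1) (s'.reg 10) (s'.arr 10) (s'.arr 11) := by
  refine Run.of_wp hs ?_
  have hR := h.eq_runs
  have hR' := runs_le X i
  have h3 := hX i le_rfl
  -- At `i = 0` truncated subtraction makes the test compare cell `0` with itself; the other
  -- conjunct excludes this case.
  have h4 := hX (i - 1) (by omega)
  simp only [scanRun, hi, h3, h4, Prog.wp, Test.Ok, Test.Holds, Expr.Ok, Expr.eval,
    State.setReg_reg, State.setReg_arr, State.setArr_reg, State.setArr_arr_self,
    State.setArr_arr_of_ne, ne_eq, Nat.reduceEqDiff, not_false_eq_true,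
    if_true, if_false, true_and, and_true]
  refine ⟨by omega, fun hc => ⟨by omega, ?_⟩, fun hc => ⟨by omega, by omega, ?_⟩⟩
  · exact h.step_same hc.1 hc.2 fun l => rfl
  · exact h.step_new hc (fun r => rfl) fun l => rfl

/-- `occ t` is the position of the `t`-th occurrence of `a`. -/
def Occ (X : ℕ → ℕ) (a i : ℕ) (occ : ℕ → ℕ) : Prop :=
  ∀ t < cnt X a i, X (occ t) = a ∧ cnt X a (occ t) = t ∧ occ t < i

/-- Record an occurrence of `a`. -/
def scanOcc : Prog :=
  .ite (.eq (.get 3 (.reg 12)) (.reg 5))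
    (.write 12 (.reg 11) (.reg 12) ;; .assign 11 (.add (.reg 11) (.const 1))) .skip

theorem run_scanOcc {w : ℕ} {s : State} {X : ℕ → ℕ} {i a : ℕ} (hs : Bdd w s) (hw : i + 1 < cap w)
    (hi : s.reg 12 = i) (ha : s.reg 5 = a) (hX : s.arr 3 i = X i) (hc : s.reg 11 = cnt X a i)
    (h : Occ X a i (s.arr 12)) :
    Run w scanOcc s scanOcc.cost
      fun s' => s'.reg 11 = cnt X a (i + 1) ∧ Occ X a (i + 1) (s'.arr 12) := by
  refine Run.of_wp hs ?_
  have hle := cnt_le X a i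
  simp only [scanOcc, hi, ha, hX, hc, Prog.wp, Test.Ok, Test.Holds, Expr.Ok, Expr.eval,
    State.setReg_reg, State.setReg_arr, State.setArr_reg, State.setArr_arr_self,
    State.setArr_arr_of_ne, ne_eq, Nat.reduceEqDiff, not_false_eq_true,
    if_true, if_false, true_and, and_true]
  refine ⟨fun hXi => ⟨by omega, ?_, ?_⟩, fun hXi => ⟨?_, ?_⟩⟩
  · simp [cnt, hXi]
  · intro t ht
    rw [cnt, if_pos hXi] at ht
    by_cases htc : t = cnt X a i
    · simp [htc, hXi]
    · obtain ⟨h1, h2, h3⟩ := h t (by omega)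
      simp only [htc, if_false]
      exact ⟨h1, h2, by omega⟩
  · simp [cnt, hXi]
  · intro t ht
    rw [cnt, if_neg hXi] at ht
    obtain ⟨h1, h2, h3⟩ := h t ht
    exact ⟨h1, h2, by omega⟩

/-- For each of the first `R` runs, a block of `p` copies of `a` that ends where the run ends;
`cur r = L + 1` if there is none. -/
structure Slots (X : ℕ → ℕ) (L a p i R : ℕ) (cur sr : ℕ → ℕ) : Prop where
  sound : ∀ r < R, cur r ≤ L → IsBlock X L a p (sr r) (cur r)
  bound : ∀ r < R, cur r ≤ L + 1 ∧ sr r ≤ L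
  complete : ∀ e, 0 < e → e ≤ i → X (e - 1) = a → (e = i ∨ X e ≠ a) → p ≤ cnt X a e →
    ∃ r < R, cur r = e
  last : 0 < i → cur (R - 1) = i ∨ cur (R - 1) = L + 1

/-- The slot of the current run is overwritten at every position of the run, so the block at the end
of the run is the one that survives. The field `last` guarantees that overwriting loses nothing. -/
theorem Slots.step {X : ℕ → ℕ} {L a p i R R' : ℕ} {cur sr cur' sr' : ℕ → ℕ}
    (h : Slots X L a p i R cur sr) (hi : i < L) (hR : R' = R ∧ X i = X (i - 1) ∧ 0 < i ∧ 0 < R ∨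
      R' = R + 1 ∧ ¬ (0 < i ∧ X i = X (i - 1)))
    (hcur : ∀ r ≠ R' - 1, cur' r = cur r) (hsr : ∀ r ≠ R' - 1, sr' r = sr r)
    (hv : X i = a ∧ p ≤ cnt X a (i + 1) ∧ cur' (R' - 1) = i + 1 ∧
        IsBlock X L a p (sr' (R' - 1)) (i + 1) ∨
      ¬ (X i = a ∧ p ≤ cnt X a (i + 1)) ∧ cur' (R' - 1) = L + 1 ∧ sr' (R' - 1) = 0) :
    Slots X L a p (i + 1) R' cur' sr' := by
  have hlt : ∀ r < R', r ≠ R' - 1 → r < R := by omega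
  refine ⟨fun r hr hrL => ?_, fun r hr => ?_, fun e he he' hea hend hp => ?_, fun _ => ?_⟩
  · by_cases hr' : r = R' - 1
    · subst hr'
      rcases hv with ⟨-, -, h1, h2⟩ | ⟨-, h1, -⟩
      · rw [h1]
        exact h2
      · omega
    · rw [hcur r hr'] at hrL ⊢
      rw [hsr r hr']
      exact h.sound r (hlt r hr hr') hrL
  · by_cases hr' : r = R' - 1
    · subst hr'
      rcases hv with ⟨-, -, h1, h2⟩ | ⟨-, h1, h2⟩
      · have := h2.1
        omega
      · omega
    · rw [hcur r hr', hsr r hr']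
      exact h.bound r (hlt r hr hr')
  · by_cases hei : e = i + 1
    · subst hei
      rw [Nat.add_sub_cancel] at hea
      rcases hv with ⟨-, -, h1, h2⟩ | ⟨h1, -⟩
      · exact ⟨R' - 1, by omega, h1⟩
      · exact absurd ⟨hea, hp⟩ h1
    · have hne : X e ≠ a := by
        rcases hend with h' | h'
        · exact absurd h' hei
        · exact h'
      obtain ⟨r, hr, h'⟩ := h.complete e he (by omega) hea (.inr hne) hp
      refine ⟨r, by omega, ?_⟩
      rw [hcur r, h']
      -- If the overwritten slot were the one for `e`, the run would continue and `e = i` by `last`;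
      -- then `X e = X (e - 1) = a`, so `e` would not be the end of a run.
      rintro rfl
      rcases hR with ⟨rfl, h1, h2, -⟩ | ⟨rfl, -⟩
      · rcases h.last h2 with h3 | h3
        · rw [h'] at h3
          subst h3
          exact hne (h1.trans hea)
        · omega
      · omega
  · rcases hv with ⟨-, -, h1, -⟩ | ⟨-, h1, -⟩
    · exact .inl h1
    · exact .inr h1

/-- Record the block that ends at the current position, as the block of the current run. -/
def scanSlot : Prog :=
  .ite (.and (.eq (.get 3 (.reg 12)) (.reg 5)) (.not (.lt (.reg 11) (.reg 4))))
    (.write 13 (.sub (.reg 10) (.const 1)) (.add (.reg 12) (.const 1)) ;;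
      .write 14 (.sub (.reg 10) (.const 1)) (.get 12 (.sub (.reg 11) (.reg 4))))
    (.write 13 (.sub (.reg 10) (.const 1)) (.add (.reg 3) (.const 1)) ;;
      .write 14 (.sub (.reg 10) (.const 1)) (.const 0))

theorem run_scanSlot {w : ℕ} {s : State} {X : ℕ → ℕ} {L i a p R : ℕ} (hs : Bdd w s)
    (hw : L + 1 < cap w) (hi : s.reg 12 = i) (hiL : i < L) (hL : s.reg 3 = L) (hp : s.reg 4 = p)
    (ha : s.reg 5 = a) (hp0 : 0 < p) (hX : s.arr 3 i = X i) (hc : s.reg 11 = cnt X a (i + 1))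
    (hocc : Occ X a (i + 1) (s.arr 12))
    (hR : s.reg 10 = R ∧ X i = X (i - 1) ∧ 0 < i ∧ 0 < R ∨
      s.reg 10 = R + 1 ∧ ¬ (0 < i ∧ X i = X (i - 1)))
    (h : Slots X L a p i R (s.arr 13) (s.arr 14)) :
    Run w scanSlot s scanSlot.cost
      fun s' => Slots X L a p (i + 1) (s'.reg 10) (s'.arr 13) (s'.arr 14) := by
  refine Run.of_wp hs ?_
  simp only [scanSlot, hi, ha, hX, hc, hL, hp, Prog.wp, Test.Ok, Test.Holds, Expr.Ok, Expr.eval,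
    State.setReg_reg, State.setReg_arr, State.setArr_reg, State.setArr_arr_self,
    State.setArr_arr_of_ne, ne_eq, Nat.reduceEqDiff, not_false_eq_true,
    if_true, if_false, true_and, and_true]
  refine ⟨fun hXi => ⟨by omega, by omega, by omega, ?_⟩,
    fun hXi => ⟨by omega, by omega, by omega, by omega, ?_⟩⟩
  · refine h.step hiL hR (fun r hr => by simp [hr]) (fun r hr => by simp [hr]) (.inl ?_)
    obtain ⟨h1, h2⟩ := hXi
    rw [not_lt] at h2
    -- Occurrences are numbered from `0`, so this is the `p`-th from the last: exactly `p` copies of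
    -- `a` lie from it up to position `i`.
    obtain ⟨h3, h4, h5⟩ := hocc (cnt X a (i + 1) - p) (by omega)
    simp only [if_true]
    exact ⟨h1, h2, trivial, h5, by omega, h3, by omega⟩
  · refine h.step hiL hR (fun r hr => by simp [hr]) (fun r hr => by simp [hr]) (.inr ?_)
    rw [not_lt] at hXi
    simpa using hXi

/-- Find the runs and the blocks. -/
def scan : Prog :=
  (.assign 10 (.const 0) ;; .assign 11 (.const 0) ;; .assign 12 (.const 0)) ;;
  .loop (.lt (.reg 12) (.reg 3))
    (scanRun ;; scanOcc ;; scanSlot ;; .assign 12 (.add (.reg 12) (.const 1)))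

theorem run_scan {w : ℕ} {s : State} {X : ℕ → ℕ} {L a p : ℕ} (hs : Bdd w s)
    (hw : L + 1 < cap w) (hL : s.reg 3 = L) (hp : s.reg 4 = p) (ha : s.reg 5 = a) (hp0 : 0 < p)
    (hX : ∀ k < L, s.arr 3 k = X k) :
    Run w scan s (L * 100 + 10) fun s' => RunTable X L (s'.reg 10) (s'.arr 10) (s'.arr 11) ∧
      Slots X L a p L (s'.reg 10) (s'.arr 13) (s'.arr 14) := by
  have hinit : Run w (.assign 10 (.const 0) ;; .assign 11 (.const 0) ;; .assign 12 (.const 0)) s 6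
      fun s' => s'.reg 10 = 0 ∧ s'.reg 11 = 0 ∧ s'.reg 12 = 0 := by
    refine Run.of_wp hs ?_
    simp [Prog.wp, Expr.Ok, Expr.eval]
    omega
  obtain ⟨t, s₁, he, ht, h1, h2, h3⟩ := hinit
  have hs₁ := he.bdd hs
  have hf₁ := he.frame
  have hloop := Run.loop_const (w := w) (s := s₁) (b := .lt (.reg 12) (.reg 3))
    (p := scanRun ;; scanOcc ;; scanSlot ;; .assign 12 (.add (.reg 12) (.const 1)))
    (fun i s' => s'.reg 12 = i ∧ RunTable X i (s'.reg 10) (s'.arr 10) (s'.arr 11) ∧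
      s'.reg 11 = cnt X a i ∧ Occ X a i (s'.arr 12) ∧
      Slots X L a p i (s'.reg 10) (s'.arr 13) (s'.arr 14)) L 90 hs₁ ?_ ?_ ?_
  · obtain ⟨t', s₂, he', ht', -, h4, -, -, h5⟩ := hloop
    refine ⟨_, s₂, .seq _ _ _ _ _ _ _ he he', ?_, h4, h5⟩
    simp only [Test.cost, Expr.cost] at ht'
    omega
  · rw [h1]
    exact ⟨h3, ⟨rfl, by simp, by simp, by simp, by simp, by simp⟩, h2, by simp [Occ, cnt],
      by simp, by simp, by omega, by simp⟩
  · rintro k s' hk hs' hf ⟨h4, -⟩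
    have := (hf.1 3 (by decide)).trans (hf₁.1 3 (by decide))
    simp [Test.Ok, Test.Holds, Expr.Ok, Expr.eval, h4, this, hL]
  · rintro i s' hi hs' hf ⟨h4, h5, h6, h7, h8⟩
    have e3 := ((hf.1 3 (by decide)).trans (hf₁.1 3 (by decide))).trans hL
    have e4 := ((hf.1 4 (by decide)).trans (hf₁.1 4 (by decide))).trans hp
    have e5 := ((hf.1 5 (by decide)).trans (hf₁.1 5 (by decide))).trans ha
    have eX : ∀ k < L, s'.arr 3 k = X k := fun k hk => by
      rw [hf.2 3 (by decide), hf₁.2 3 (by decide), hX k hk]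
    refine Run.mono (T := scanRun.cost + (scanOcc.cost + (scanSlot.cost +
      (Prog.assign 12 (.add (.reg 12) (.const 1))).cost))) ?_ (by decide) hs' fun s' _ _ h => h
    refine (run_scanRun hs' (by omega) h4 (fun k hk => eX k (by omega)) h5).seq hs' ?_
    intro s₂ hs₂ hf₂ h9
    refine (run_scanOcc (X := X) (i := i) (a := a) hs₂ (by omega)
      (by rw [hf₂.1 12 (by decide), h4]) (by rw [hf₂.1 5 (by decide), e5])
      (by rw [hf₂.2 3 (by decide), eX i hi]) (by rw [hf₂.1 11 (by decide), h6])
      (by rw [hf₂.2 12 (by decide)]; exact h7)).seq hs₂ ?_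
    rintro s₃ hs₃ hf₃ ⟨h10, h11⟩
    have h9' : RunTable X (i + 1) (s₃.reg 10) (s₃.arr 10) (s₃.arr 11) := by
      rw [hf₃.1 10 (by decide), hf₃.2 10 (by decide), hf₃.2 11 (by decide)]
      exact h9
    refine (run_scanSlot (X := X) (L := L) (i := i) (a := a) (p := p) (R := s'.reg 10) hs₃ hw
      (by rw [hf₃.1 12 (by decide), hf₂.1 12 (by decide), h4]) hi
      (by rw [hf₃.1 3 (by decide), hf₂.1 3 (by decide), e3])
      (by rw [hf₃.1 4 (by decide), hf₂.1 4 (by decide), e4])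
      (by rw [hf₃.1 5 (by decide), hf₂.1 5 (by decide), e5]) hp0
      (by rw [hf₃.2 3 (by decide), hf₂.2 3 (by decide), eX i hi]) h10 h11 ?_
      (by rw [hf₃.2 13 (by decide), hf₃.2 14 (by decide), hf₂.2 13 (by decide),
        hf₂.2 14 (by decide)]; exact h8)).seq hs₃ ?_
    · have hR := h9'.eq_runs
      rw [runs] at hR
      have hR' := h5.eq_runs
      split_ifs at hR with hc
      · exact .inl ⟨by omega, hc.2, hc.1, by rw [hR']; exact runs_pos hc.1⟩
      · exact .inr ⟨by omega, hc⟩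
    · intro s₄ hs₄ hf₄ h12
      have e12 : s₄.reg 12 = i := by
        rw [hf₄.1 12 (by decide), hf₃.1 12 (by decide), hf₂.1 12 (by decide), h4]
      refine Run.of_wp hs₄ ?_
      simp only [Prog.wp, Expr.Ok, Expr.eval, State.setReg_reg, State.setReg_arr, e12]
      refine ⟨⟨trivial, by omega, by omega⟩, by simp, ?_⟩
      simp only [show (10 : ℕ) ≠ 12 by simp, show (11 : ℕ) ≠ 12 by simp, if_false]
      rw [hf₄.1 10 (by decide), hf₄.2 10 (by decide), hf₄.2 11 (by decide), hf₄.1 11 (by decide),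
        hf₄.2 12 (by decide)]
      rw [hf₄.1 10 (by decide)] at h12
      exact ⟨h9', h10, h11, h12⟩

/-! ### Extending the blocks greedily

After a scan, the blocks are extended by the rest of the pattern, which is in array `2` and has its
length in register `2`.  For each character `c` of it, array `15` receives the first position from
the start of each run on that holds `c`. -/

/-- A run either consists of `c` or does not contain it, in which case the search continues at the
next run. This recursion gives all answers in one pass over the runs from right to left. -/
theorem RunTable.next_start {X : ℕ → ℕ} {L R : ℕ} {st ro : ℕ → ℕ} (h : RunTable X L R st ro)
    (c : ℕ) {r : ℕ} (hr : r < R) : next X L c (st r) =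
      if X (st r) = c then st r else if r + 1 < R then next X L c (st (r + 1)) else L := by
  split_ifs with h1 h2
  · exact next_eq le_rfl (.inr h1) (by omega)
  · obtain ⟨h3, h4⟩ := h.segment r h2
    obtain ⟨h5, h6, h7⟩ := next_spec X L c (st (r + 1))
    refine next_eq (by omega) h6 fun l hl hl' => ?_
    by_cases hlt : l < st (r + 1)
    · rw [h4 l hl hlt]
      exact ⟨hlt.trans (h.st_lt _ h2), h1⟩
    · exact h7 l (by omega) hl'
  · obtain rfl : r = R - 1 := by omega
    refine next_eq (h.st_lt _ hr).le (.inl le_rfl) fun l hl hl' => ⟨hl', ?_⟩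
    rw [h.last (by omega) l hl hl']
    exact h1

/-- If `l` does not hold `c`, neither does any earlier position of its run. Hence one table entry
per run answers the search from every position. -/
theorem RunTable.next_run {X : ℕ → ℕ} {L R : ℕ} {st ro : ℕ → ℕ} (h : RunTable X L R st ro)
    {c l : ℕ} (hl : l < L) (hc : X l ≠ c) : next X L c (st (ro l)) = next X L c l := by
  obtain ⟨-, h1, h2⟩ := h.run_of l hl
  obtain ⟨h5, h6, h7⟩ := next_spec X L c l
  refine next_eq (by omega) h6 fun x hx hx' => ?_
  by_cases hlt : x ≤ l
  · rw [h2 x hx hlt]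
    exact ⟨by omega, hc⟩
  · exact h7 x (by omega) hx'

/-- Compute the first position of the character in register `16` from each run on. -/
def nextOfRuns : Prog :=
  (.assign 15 (.reg 3) ;; .assign 13 (.reg 10)) ;;
  .loop (.lt (.const 0) (.reg 13))
    (.assign 13 (.sub (.reg 13) (.const 1)) ;;
      .ite (.eq (.get 3 (.get 10 (.reg 13))) (.reg 16)) (.assign 15 (.get 10 (.reg 13))) .skip ;;
      .write 15 (.reg 13) (.reg 15))

theorem run_nextOfRuns {w : ℕ} {s : State} {X : ℕ → ℕ} {L R c : ℕ} (hs : Bdd w s)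
    (hw : L + 1 < cap w) (hL : s.reg 3 = L) (hR : s.reg 10 = R) (hc : s.reg 16 = c)
    (hX : ∀ k < L, s.arr 3 k = X k) (h : RunTable X L R (s.arr 10) (s.arr 11)) :
    Run w nextOfRuns s (R * 50 + 20)
      fun s' => ∀ r < R, s'.arr 15 r = next X L c (s.arr 10 r) := by
  have hinit : Run w (.assign 15 (.reg 3) ;; .assign 13 (.reg 10)) s 4
      fun s' => s'.reg 15 = L ∧ s'.reg 13 = R := by
    refine Run.of_wp hs ?_
    simp [Prog.wp, Expr.Ok, Expr.eval, hL, hR]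
  refine Run.mono (hinit.seq hs fun s₁ hs₁ hf₁ h₁ => Run.loop_const
    (fun k s' => s'.reg 13 = R - k ∧
      -- The register holds the answer for the run treated last; `L` stands for the end of the
      -- string before any run is treated.
      s'.reg 15 = (if k = 0 then L else next X L c (s.arr 10 (R - k))) ∧
      ∀ r < R, R - k ≤ r → s'.arr 15 r = next X L c (s.arr 10 r)) R 40 hs₁
    ⟨h₁.2, by simp [h₁.1], by omega⟩ ?_ ?_) ?_ hs
    fun s' _ _ h' r hr => h'.2.2 r hr (by omega)
  · rintro k s' hk hs' hf ⟨h4, -⟩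
    simp only [Test.Ok, Test.Holds, Expr.Ok, Expr.eval, h4, true_and, and_true]
    omega
  · rintro k s' hk hs' hf ⟨h4, h5, h6⟩
    have e16 := ((hf.1 16 (by decide)).trans (hf₁.1 16 (by decide))).trans hc
    have e10 := (hf.2 10 (by decide)).trans (hf₁.2 10 (by decide))
    have e3 := (hf.2 3 (by decide)).trans (hf₁.2 3 (by decide))
    obtain ⟨r, hr⟩ : ∃ r, R = r + 1 + k := ⟨R - k - 1, by omega⟩
    have h4' : s'.reg 13 = r + 1 := by omega
    have hX' := hX _ (h.st_lt r (by omega))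
    have hn := h.next_start c (r := r) (by omega)
    refine (Run.of_wp hs' ?_).mono (by decide) hs' fun _ _ _ h => h
    simp only [h4', e16, e10, e3, Nat.add_sub_cancel, hX', Prog.wp, Test.Ok, Test.Holds, Expr.Ok,
      Expr.eval, State.setReg_reg, State.setReg_arr, State.setArr_reg, State.setArr_arr_self,
      State.setArr_arr_of_ne, ne_eq, Nat.reduceEqDiff, not_false_eq_true, if_true, if_false,
      true_and, and_true]
    have hr' : R - (k + 1) = r := by omega
    rw [hr']
    have hnext : ∀ v, v = next X L c (s.arr 10 r) → ∀ r' < R, r ≤ r' →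
        (if r' = r then v else s'.arr 15 r') = next X L c (s.arr 10 r') := by
      intro v hv r' hr' hle
      split_ifs with heq
      · rw [hv, heq]
      · exact h6 r' hr' (by omega)
    refine ⟨by omega, fun hc => ?_, fun hc => ?_⟩
    · rw [if_pos hc] at hn
      exact ⟨rfl, by simp [hn], hnext _ hn.symm⟩
    · have h5' : s'.reg 15 = next X L c (s.arr 10 r) := by
        rw [hn, if_neg hc, h5]
        split_ifs with hk1 hk2 hk2
        · omega
        · rfl
        · rw [show R - k = r + 1 by omega]
        · omega
      exact ⟨rfl, by simp [h5'], hnext _ h5'⟩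
  · simp only [Test.cost, Expr.cost]
    omega

/-- Extend all blocks by the character in register `16`. -/
def extendSlots : Prog :=
  .assign 13 (.const 0) ;;
  .loop (.lt (.reg 13) (.reg 10))
    (.assign 17 (.get 13 (.reg 13)) ;;
      .ite (.and (.lt (.reg 17) (.reg 3)) (.not (.eq (.get 3 (.reg 17)) (.reg 16))))
        (.assign 17 (.get 15 (.get 11 (.reg 17)))) .skip ;;
      .write 13 (.reg 13) (.add (.reg 17) (.const 1)) ;;
      .assign 13 (.add (.reg 13) (.const 1)))

theorem run_extendSlots {w : ℕ} {s : State} {X : ℕ → ℕ} {L R c b : ℕ} (hs : Bdd w s)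
    (hw : L + b + 2 < cap w) (hL : s.reg 3 = L) (hR : s.reg 10 = R) (hc : s.reg 16 = c)
    (hX : ∀ k < L, s.arr 3 k = X k) (h : RunTable X L R (s.arr 10) (s.arr 11))
    (hnext : ∀ r < R, s.arr 15 r = next X L c (s.arr 10 r)) (hcur : ∀ r < R, s.arr 13 r ≤ b) :
    Run w extendSlots s (R * 50 + 20)
      fun s' => ∀ r < R, s'.arr 13 r = next X L c (s.arr 13 r) + 1 := by
  have hRL := runs_le X L
  rw [← h.eq_runs] at hRL
  have hinit : Run w (.assign 13 (.const 0)) s 2 fun s' => s'.reg 13 = 0 := by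
    refine Run.of_wp hs ?_
    simp [Prog.wp, Expr.Ok, Expr.eval]
    omega
  refine Run.mono (hinit.seq hs fun s₁ hs₁ hf₁ h₁ => Run.loop_const
    (fun k s' => s'.reg 13 = k ∧ ∀ r < R, s'.arr 13 r =
      if r < k then next X L c (s.arr 13 r) + 1 else s.arr 13 r) R 40 hs₁
    ⟨h₁, by simp [hf₁.2 13 (by decide)]⟩ ?_ ?_) ?_ hs
    fun s' _ _ h' r hr => by rw [h'.2 r hr, if_pos hr]
  · rintro k s' hk hs' hf ⟨h4, -⟩
    have e10 := ((hf.1 10 (by decide)).trans (hf₁.1 10 (by decide))).trans hR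
    simp only [Test.Ok, Test.Holds, Expr.Ok, Expr.eval, h4, e10, true_and, and_true]
  · rintro k s' hk hs' hf ⟨h4, h5⟩
    have e16 := ((hf.1 16 (by decide)).trans (hf₁.1 16 (by decide))).trans hc
    have e3 := ((hf.1 3 (by decide)).trans (hf₁.1 3 (by decide))).trans hL
    have a3 := (hf.2 3 (by decide)).trans (hf₁.2 3 (by decide))
    have a11 := (hf.2 11 (by decide)).trans (hf₁.2 11 (by decide))
    have a15 := (hf.2 15 (by decide)).trans (hf₁.2 15 (by decide))
    have h5' := h5 k hk
    rw [if_neg (by omega)] at h5'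
    have hb := hcur k hk
    have hle := next_le X L c (s.arr 13 k)
    refine (Run.of_wp hs' ?_).mono (by decide) hs' fun _ _ _ h => h
    simp only [h4, e16, e3, a3, a11, a15, h5', Prog.wp, Test.Ok, Test.Holds, Expr.Ok,
      Expr.eval, State.setReg_reg, State.setReg_arr, State.setArr_reg, State.setArr_arr_self,
      State.setArr_arr_of_ne, ne_eq, Nat.reduceEqDiff, not_false_eq_true, if_true, if_false,
      true_and, and_true]
    have hfin : ∀ v, v = next X L c (s.arr 13 k) → ∀ r < R, (if r = k then v + 1 else
        s'.arr 13 r) = if r < k + 1 then next X L c (s.arr 13 r) + 1 else s.arr 13 r := by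
      intro v hv r hr
      split_ifs with h6 h7 h7
      · rw [hv, h6]
      · omega
      · rw [h5 r hr, if_pos (by omega)]
      · rw [h5 r hr, if_neg (by omega)]
    refine ⟨fun hc => ?_, fun hc => ?_⟩
    · have hv : s.arr 15 (s.arr 11 (s.arr 13 k)) = next X L c (s.arr 13 k) := by
        rw [hX _ hc.1] at hc
        rw [hnext _ (h.run_of _ hc.1).1, h.next_run hc.1 hc.2]
      exact ⟨by omega, by omega, hfin _ hv⟩
    -- The search stops at once, either on `c` or because the slot has already left the string.
    · have hv : s.arr 13 k = next X L c (s.arr 13 k) := by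
        by_cases hlt : s.arr 13 k < L
        · rw [hX _ hlt] at hc
          exact (next_eq le_rfl (.inr (by tauto)) (by omega)).symm
        · exact (next_eq le_rfl (.inl (by omega)) (by omega)).symm
      exact ⟨by omega, by omega, hfin _ hv⟩
  · simp only [Test.cost, Expr.cost]
    omega

/-- Extend all blocks by the rest of the pattern. -/
def embed : Prog :=
  .assign 14 (.reg 4) ;;
  .loop (.lt (.reg 14) (.reg 2))
    (.assign 16 (.get 2 (.reg 14)) ;; nextOfRuns ;; extendSlots ;;
      .assign 14 (.add (.reg 14) (.const 1)))

theorem take_drop_succ {C : List ℕ} {p k : ℕ} (h : p + k < C.length) :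
    (C.drop p).take (k + 1) = (C.drop p).take k ++ [str C (p + k)] := by
  rw [List.take_add_one, List.getElem?_drop, str, List.getElem?_eq_getElem h,
    List.getD_eq_getElem _ _ h]
  rfl

theorem run_embed {w : ℕ} {s : State} {X : ℕ → ℕ} {L R p : ℕ} {C : List ℕ} (hs : Bdd w s)
    (hw : 2 * L + C.length + 4 < cap w) (hL : s.reg 3 = L) (hR : s.reg 10 = R) (hp : s.reg 4 = p)
    (hpC : p ≤ C.length) (hK : s.reg 2 = C.length) (hC : ∀ k < C.length, s.arr 2 k = str C k)
    (hX : ∀ k < L, s.arr 3 k = X k) (h : RunTable X L R (s.arr 10) (s.arr 11))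
    (hcur : ∀ r < R, s.arr 13 r ≤ L + 1) :
    Run w embed s (C.length * (R * 100 + 100) + 10)
      fun s' => ∀ r < R, s'.arr 13 r = greedy X L (s.arr 13 r) (C.drop p) := by
  have hinit : Run w (.assign 14 (.reg 4)) s 2 fun s' => s'.reg 14 = p := by
    refine Run.of_wp hs ?_
    simp [Prog.wp, Expr.Ok, Expr.eval, hp]
  refine Run.mono (hinit.seq hs fun s₁ hs₁ hf₁ h₁ => Run.loop_const
    (fun k s' => s'.reg 14 = p + k ∧ ∀ r < R, s'.arr 13 r =
      greedy X L (s.arr 13 r) ((C.drop p).take k)) (C.length - p) (R * 100 + 60) hs₁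
    ⟨h₁, by simp [hf₁.2 13 (by decide), greedy]⟩ ?_ ?_) ?_ hs
    fun s' _ _ h' r hr => by rw [h'.2 r hr, List.take_of_length_le (by simp)]
  · rintro k s' hk hs' hf ⟨h4, -⟩
    have e2 := ((hf.1 2 (by decide)).trans (hf₁.1 2 (by decide))).trans hK
    simp only [Test.Ok, Test.Holds, Expr.Ok, Expr.eval, h4, e2, true_and, and_true]
    omega
  · rintro k s' hk hs' hf ⟨h4, h5⟩
    have e3 := ((hf.1 3 (by decide)).trans (hf₁.1 3 (by decide))).trans hL
    have e10 := ((hf.1 10 (by decide)).trans (hf₁.1 10 (by decide))).trans hR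
    have a2 := (hf.2 2 (by decide)).trans (hf₁.2 2 (by decide))
    have a3 := (hf.2 3 (by decide)).trans (hf₁.2 3 (by decide))
    have a10 := (hf.2 10 (by decide)).trans (hf₁.2 10 (by decide))
    have a11 := (hf.2 11 (by decide)).trans (hf₁.2 11 (by decide))
    have hload : Run w (.assign 16 (.get 2 (.reg 14))) s' 3
        fun s'' => s''.reg 16 = str C (p + k) := by
      refine Run.of_wp hs' ?_
      simp only [Prog.wp, Expr.Ok, Expr.eval, h4, a2, State.setReg_reg, if_true, true_and]
      exact hC _ (by omega)
    refine Run.mono (T := 3 + (R * 50 + 20 + (R * 50 + 20 +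
      (Prog.assign 14 (.add (.reg 14) (.const 1))).cost))) ?_
      (by simp only [Prog.cost, Expr.cost]; omega) hs' fun _ _ _ h => h
    refine hload.seq hs' fun s₂ hs₂ hf₂ h₂ => ?_
    refine (run_nextOfRuns (X := X) (L := L) (R := R) hs₂ (by omega) (by rw [hf₂.1 3 (by decide), e3])
      (by rw [hf₂.1 10 (by decide), e10]) h₂ (by rw [hf₂.2 3 (by decide), a3]; exact hX)
      (by rw [hf₂.2 10 (by decide), hf₂.2 11 (by decide), a10, a11]; exact h)).seq hs₂
      fun s₃ hs₃ hf₃ h₃ => ?_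
    -- A failed slot keeps growing by one with each character, so the word bound has to allow for
    -- `C.length` beyond `L + 1`.
    have h5' : ∀ r < R, s₃.arr 13 r ≤ L + 1 + C.length := by
      intro r hr
      rw [hf₃.2 13 (by decide), hf₂.2 13 (by decide), h5 r hr]
      have h6 := greedy_le X L (s.arr 13 r) ((C.drop p).take k)
      have h7 := hcur r hr
      simp only [List.length_take, List.length_drop] at h6
      omega
    refine (run_extendSlots (X := X) (L := L) (R := R) (c := str C (p + k))
      (b := L + 1 + C.length) hs₃ (by omega)
      (by rw [hf₃.1 3 (by decide), hf₂.1 3 (by decide), e3])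
      (by rw [hf₃.1 10 (by decide), hf₂.1 10 (by decide), e10])
      (by rw [hf₃.1 16 (by decide), h₂]) (by rw [hf₃.2 3 (by decide), hf₂.2 3 (by decide), a3]; exact hX)
      (by rw [hf₃.2 10 (by decide), hf₃.2 11 (by decide), hf₂.2 10 (by decide),
        hf₂.2 11 (by decide), a10, a11]; exact h)
      (by rw [hf₃.2 10 (by decide)]; exact h₃) h5').seq hs₃ fun s₄ hs₄ hf₄ h₄ => ?_
    have e14 : s₄.reg 14 = p + k := by
      rw [hf₄.1 14 (by decide), hf₃.1 14 (by decide), hf₂.1 14 (by decide), h4]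
    refine Run.of_wp hs₄ ?_
    simp only [Prog.wp, Expr.Ok, Expr.eval, State.setReg_reg, State.setReg_arr, e14, if_true,
      true_and]
    refine ⟨⟨by omega, by omega⟩, by omega, fun r hr => ?_⟩
    rw [take_drop_succ (by omega), greedy_snoc, ← h5 r hr, h₄ r hr, hf₃.2 13 (by decide),
      hf₂.2 13 (by decide)]
  · have : (C.length - p) * (R * 100 + 60 + (Test.lt (.reg 14) (.reg 2)).cost + 1) ≤
        C.length * (R * 100 + 100) :=
      Nat.mul_le_mul (by omega) (by simp only [Test.cost, Expr.cost]; omega)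
    simp only [Test.cost, Expr.cost] at *
    omega

/-! ### The table of longest common subsequences

The strings are in the arrays `3` and `4`, with lengths in the registers `3` and `6`.  Some
positions of the first string are marked by `1` in array `5`, among them the boundaries of the
runs.  Only the rows of the table at the marked positions are computed: array `7` holds the rows one
after the other, and array `6` tells for each marked position where its row starts. -/

/-- Update the queue for column `j`. -/
def rowQueue : Prog :=
  .ite (.eq (.get 4 (.reg 27)) (.reg 23))
    (.assign 26 (.add (.reg 26) (.const 1)) ;;
      .ite (.and (.lt (.reg 24) (.reg 25))
        (.not (.lt (.sub (.reg 26) (.get 8 (.reg 24))) (.reg 21))))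
        (.assign 24 (.add (.reg 24) (.const 1))) .skip ;;
      .ite (.eq (.get 7 (.add (.add (.reg 20) (.reg 27)) (.const 1)))
        (.get 7 (.add (.reg 20) (.reg 27))))
        (.write 8 (.reg 25) (.reg 26) ;; .assign 25 (.add (.reg 25) (.const 1))) .skip)
    (.ite (.and (.not (.eq (.get 7 (.add (.add (.reg 20) (.reg 27)) (.const 1)))
        (.get 7 (.add (.reg 20) (.reg 27))))) (.lt (.reg 24) (.reg 25)))
      (.assign 25 (.sub (.reg 25) (.const 1))) .skip)

theorem run_rowQueue {w : ℕ} {s : State} {X Y : ℕ → ℕ} {i₀ l j base c : ℕ} (hs : Bdd w s)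
    (hw : base + j + 2 < cap w) (hbase : s.reg 20 = base) (hl : s.reg 21 = l) (hl0 : 0 < l)
    (hc : s.reg 23 = c) (hj : s.reg 27 = j) (hY : s.arr 4 j = Y j)
    (hX : ∀ k < l, X (i₀ + k) = c)
    (hT : s.arr 7 (base + j) = lcs X Y i₀ j) (hT' : s.arr 7 (base + j + 1) = lcs X Y i₀ (j + 1))
    (h : Deque X Y i₀ l j (s.reg 26) (s.reg 24) (s.reg 25) (s.arr 8)) :
    Run w rowQueue s rowQueue.cost fun s' =>
      Deque X Y i₀ l (j + 1) (s'.reg 26) (s'.reg 24) (s'.reg 25) (s'.arr 8) := by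
  refine Run.of_wp hs ?_
  have hcn := h.cn_le
  have htl := h.tl_le
  have hhd := h.hd_le
  simp only [rowQueue, hbase, hl, hc, hj, hY, hT, hT', Prog.wp, Test.Ok, Test.Holds, Expr.Ok,
    Expr.eval, State.setReg_reg, State.setReg_arr, State.setArr_reg, State.setArr_arr_self,
    State.setArr_arr_of_ne, ne_eq, Nat.reduceEqDiff, not_false_eq_true, if_true, if_false,
    true_and, and_true]
  -- The program subtracts instead of adding: both conjuncts are evaluated even when the queue is
  -- empty, where the cell is arbitrary and a sum might overflow. Truncation does no harm since `0 <
  -- l`.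
  have hexp : (s.reg 24 < s.reg 25 ∧ ¬ s.reg 26 + 1 - s.arr 8 (s.reg 24) < l) ↔
      (s.reg 24 < s.reg 25 ∧ s.arr 8 (s.reg 24) + l ≤ s.reg 26 + 1) := by omega
  refine ⟨fun hYc => ⟨⟨by omega, by omega⟩, fun he => ⟨⟨by omega, by omega⟩, ⟨by omega, by omega⟩,
    fun hh => ⟨⟨by omega, by omega⟩, ?_⟩, fun hh => ?_⟩, fun he => ⟨⟨by omega, by omega⟩,
    fun hh => ⟨⟨by omega, by omega⟩, ?_⟩, fun hh => ?_⟩⟩, fun hYc => ⟨⟨by omega, by omega⟩,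
    fun hh => ⟨by omega, ?_⟩, fun hh => ?_⟩⟩
  · exact h.step_match hl0 (by simpa [hYc] using hX) (by rw [if_pos (hexp.1 he)])
      (by rw [if_pos hh]) (fun x hx => if_neg (by omega)) fun _ => if_pos rfl
  · exact h.step_match hl0 (by simpa [hYc] using hX) (by rw [if_pos (hexp.1 he)])
      (by rw [if_neg hh]) (fun x hx => rfl) fun h' => absurd h' hh
  · exact h.step_match hl0 (by simpa [hYc] using hX) (by rw [if_neg (mt hexp.2 he)])
      (by rw [if_pos hh]) (fun x hx => if_neg (by omega)) fun _ => if_pos rfl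
  · exact h.step_match hl0 (by simpa [hYc] using hX) (by rw [if_neg (mt hexp.2 he)])
      (by rw [if_neg hh]) (fun x hx => rfl) fun h' => absurd h' hh
  · exact h.step_mismatch (fun k hk h' => hYc (by rw [← h', hX k hk])) (by rw [if_pos hh])
  · exact h.step_mismatch (fun k hk h' => hYc (by rw [← h', hX k hk])) (by rw [if_neg hh])

/-- Append the row behind a block of `l` copies of `c`, where `c` is in register `23` and `l` in
register `21`, to the table, which ends with the row that starts at register `20`. -/
def addRow : Prog :=
  (.assign 28 (.add (.add (.reg 20) (.reg 6)) (.const 1)) ;; .assign 24 (.const 0) ;;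
    .assign 25 (.const 0) ;; .assign 26 (.const 0) ;; .assign 27 (.const 0) ;;
    .write 7 (.reg 28) (.const 0)) ;;
  .loop (.lt (.reg 27) (.reg 6))
    (rowQueue ;; .assign 27 (.add (.reg 27) (.const 1)) ;;
      .write 7 (.add (.reg 28) (.reg 27))
        (.add (.get 7 (.add (.reg 20) (.reg 27))) (.sub (.reg 25) (.reg 24))))

theorem run_addRow {w : ℕ} {s : State} {X Y : ℕ → ℕ} {i₀ l n base c : ℕ} (hs : Bdd w s)
    (hw : base + 2 * n + i₀ + l + 3 < cap w) (hbase : s.reg 20 = base) (hl : s.reg 21 = l)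
    (hl0 : 0 < l) (hc : s.reg 23 = c) (hn : s.reg 6 = n) (hY : ∀ k < n, s.arr 4 k = Y k)
    (hX : ∀ k < l, X (i₀ + k) = c) (hT : ∀ j ≤ n, s.arr 7 (base + j) = lcs X Y i₀ j) :
    Run w addRow s (n * 150 + 50) fun s' => s'.reg 28 = base + n + 1 ∧
      (∀ x < base + n + 1, s'.arr 7 x = s.arr 7 x) ∧
      ∀ j ≤ n, s'.arr 7 (base + n + 1 + j) = lcs X Y (i₀ + l) j := by
  have hinit : Run w (.assign 28 (.add (.add (.reg 20) (.reg 6)) (.const 1)) ;;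
    .assign 24 (.const 0) ;; .assign 25 (.const 0) ;; .assign 26 (.const 0) ;;
    .assign 27 (.const 0) ;; .write 7 (.reg 28) (.const 0)) s 20
      fun s' => s'.reg 28 = base + n + 1 ∧ s'.reg 24 = 0 ∧ s'.reg 25 = 0 ∧ s'.reg 26 = 0 ∧
        s'.reg 27 = 0 ∧ ∀ x, s'.arr 7 x = if x = base + n + 1 then 0 else s.arr 7 x := by
    refine (Run.of_wp hs ?_).mono (by decide) hs fun _ _ _ h => h
    simp [Prog.wp, Expr.Ok, Expr.eval, hbase, hn]
    omega
  refine Run.mono (hinit.seq hs fun s₁ hs₁ hf₁ h₁ => Run.loop_const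
    (fun j s' => s'.reg 27 = j ∧ s'.reg 28 = base + n + 1 ∧
      Deque X Y i₀ l j (s'.reg 26) (s'.reg 24) (s'.reg 25) (s'.arr 8) ∧
      (∀ x < base + n + 1, s'.arr 7 x = s.arr 7 x) ∧
      ∀ j' ≤ j, s'.arr 7 (base + n + 1 + j') = lcs X Y (i₀ + l) j') n 140 hs₁
    ?_ ?_ ?_) ?_ hs fun s' _ _ h => ⟨h.2.1, h.2.2.2⟩
  · obtain ⟨h1, h2, h3, h4, h5, h6⟩ := h₁
    refine ⟨h5, h1, ?_, fun x hx => ?_, fun j hj => ?_⟩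
    · rw [h2, h3, h4]
      exact Deque.init _ _ _ _ _
    · rw [h6, if_neg (by omega)]
    · obtain rfl : j = 0 := by omega
      rw [h6, if_pos rfl, lcs_zero_right]
  · rintro j s' hj hs' hf ⟨h4, -⟩
    have e6 := ((hf.1 6 (by decide)).trans (hf₁.1 6 (by decide))).trans hn
    simp only [Test.Ok, Test.Holds, Expr.Ok, Expr.eval, h4, e6, true_and, and_true]
  · rintro j s' hj hs' hf ⟨h1, h2, h3, h4, h5⟩
    have e20 := ((hf.1 20 (by decide)).trans (hf₁.1 20 (by decide))).trans hbase
    have e21 := ((hf.1 21 (by decide)).trans (hf₁.1 21 (by decide))).trans hl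
    have e23 := ((hf.1 23 (by decide)).trans (hf₁.1 23 (by decide))).trans hc
    have a4 := (hf.2 4 (by decide)).trans (hf₁.2 4 (by decide))
    have hTj : ∀ j ≤ n, s'.arr 7 (base + j) = lcs X Y i₀ j := fun j hj => by
      rw [h4 _ (by omega), hT j hj]
    refine Run.mono (T := rowQueue.cost + (Prog.seq (.assign 27 (.add (.reg 27) (.const 1)))
      (.write 7 (.add (.reg 28) (.reg 27))
        (.add (.get 7 (.add (.reg 20) (.reg 27))) (.sub (.reg 25) (.reg 24))))).cost)
      ?_ (by decide) hs' fun _ _ _ h => h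
    refine (run_rowQueue (X := X) (Y := Y) hs' (by omega) e20 e21 hl0 e23 h1
      (by rw [a4, hY j hj]) hX (hTj j (by omega)) (hTj (j + 1) (by omega)) h3).seq hs'
      fun s₂ hs₂ hf₂ h₂ => ?_
    have b20 := (hf₂.1 20 (by decide)).trans e20
    have b27 := (hf₂.1 27 (by decide)).trans h1
    have b28 := (hf₂.1 28 (by decide)).trans h2
    have b7 := hf₂.2 7 (by decide)
    have hv := h₂.value
    have hle := lcs_le_left X Y (i₀ + l) (j + 1)
    have hTj' := hTj (j + 1) (by omega)
    refine Run.of_wp hs₂ ?_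
    simp only [b20, b27, b28, b7, hTj', Prog.wp, Test.Ok, Test.Holds, Expr.Ok,
      Expr.eval, State.setReg_reg, State.setReg_arr, State.setArr_reg, State.setArr_arr_self,
      State.setArr_arr_of_ne, ne_eq, Nat.reduceEqDiff, not_false_eq_true, if_true, if_false,
      true_and, and_true]
    refine ⟨⟨by omega, by omega⟩, by omega, ⟨by omega, by omega⟩, h₂, fun x hx => ?_,
      fun j' hj' => ?_⟩
    · rw [if_neg (by omega), h4 x hx]
    · split_ifs with heq
      · obtain rfl : j' = j + 1 := by omega
        exact hv.symm
      · exact h5 j' (by omega)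
  · simp only [Test.cost, Expr.cost]
    omega

/-- The number of marked positions from `1` to `i`. -/
def numMarks (mk : ℕ → ℕ) (i : ℕ) : ℕ := ∑ k ∈ Finset.range i, if mk (k + 1) = 1 then 1 else 0

/-- The rows of the table at the marked positions up to `i`, none of which starts behind `base`. -/
def IsTable (X Y mk : ℕ → ℕ) (n i base : ℕ) (row tab : ℕ → ℕ) : Prop :=
  ∀ e ≤ i, (e = 0 ∨ mk e = 1) →
    row e ≤ base ∧ ∀ j ≤ n, tab (row e + j) = lcs X Y e j

/-- Compute the table. -/
def buildTable : Prog :=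
  fill 7 (.add (.reg 6) (.const 1)) (.const 0) ;;
  (.assign 20 (.const 0) ;; .assign 21 (.const 0) ;; .assign 22 (.const 0) ;;
    .write 6 (.const 0) (.const 0)) ;;
  .loop (.lt (.reg 22) (.reg 3))
    ((.assign 23 (.get 3 (.reg 22)) ;; .assign 22 (.add (.reg 22) (.const 1)) ;;
      .assign 21 (.add (.reg 21) (.const 1))) ;;
    .ite (.eq (.get 5 (.reg 22)) (.const 1))
      (addRow ;; (.assign 20 (.reg 28) ;; .write 6 (.reg 22) (.reg 28) ;; .assign 21 (.const 0)))
      .skip)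

theorem numMarks_le (mk : ℕ → ℕ) (i : ℕ) : numMarks mk i ≤ i := by
  calc numMarks mk i ≤ ∑ k ∈ Finset.range i, 1 :=
        Finset.sum_le_sum fun k _ => by split_ifs <;> omega
    _ = i := by simp

/-- An unmarked position costs constant time and a marked one `O(n)`, whatever the length of the
block before it. So the factor `n + 1` is multiplied by the number of marks and not by `L`. -/
theorem run_buildTable {w : ℕ} {s : State} {X Y mk : ℕ → ℕ} {L n : ℕ} (hs : Bdd w s)
    (hw : (L + 2) * (n + 1) + 2 * n + L + 10 < cap w) (hL : s.reg 3 = L) (hn : s.reg 6 = n)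
    (hX : ∀ k < L, s.arr 3 k = X k) (hY : ∀ k < n, s.arr 4 k = Y k)
    (hmk : ∀ k ≤ L, s.arr 5 k = mk k) (hb : ∀ k, 0 < k → k < L → X k ≠ X (k - 1) → mk k = 1) :
    Run w buildTable s ((L + 1) * 50 + (n + 1) * 50 + numMarks mk L * (n + 1) * 200)
      fun s' => s'.reg 20 = numMarks mk L * (n + 1) ∧
        IsTable X Y mk n L (s'.reg 20) (s'.arr 6) (s'.arr 7) := by
  have hfill := run_fill (a := 7) (n := .add (.reg 6) (.const 1)) (e := .const 0) (w := w)
    (s := s) (n + 1) (fun _ => 0) hs (by omega)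
    (fun s' hs' => by simp [Expr.Ok, Expr.eval, hs' 6 (by simp), hn]; omega)
    (fun i s' _ _ _ _ => ⟨by simp only [Expr.Ok]; omega, rfl⟩)
  refine Run.mono (T := ((n + 1) * (3 + 1 + 9) + 3 + 5) + (10 + (∑ k ∈ Finset.range L,
    ((30 + if mk (k + 1) = 1 then (n + 1) * 200 else 0) + 3 + 1) + 3 + 1)))
    (hfill.seq hs fun s₀ hs₀ hf₀ h₀ => ?_) ?_ hs fun _ _ _ h => h
  · have hinit : Run w (.assign 20 (.const 0) ;; .assign 21 (.const 0) ;; .assign 22 (.const 0) ;;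
        .write 6 (.const 0) (.const 0)) s₀ 10 fun s' => s'.reg 20 = 0 ∧ s'.reg 21 = 0 ∧
          s'.reg 22 = 0 ∧ s'.arr 6 0 = 0 := by
      refine (Run.of_wp hs₀ ?_).mono (by decide) hs₀ fun _ _ _ h => h
      simp [Prog.wp, Expr.Ok, Expr.eval]
      omega
    -- Invariant: register `21` counts the characters since the last computed row, which starts at
    -- register `20`; these characters are all equal, and if there are any, the current position is
    -- unmarked.
    refine Run.mono (hinit.seq hs₀ fun s₁ hs₁ hf₁ h₁ => Run.loop
      (fun i s' => s'.reg 22 = i ∧ s'.reg 21 ≤ i ∧ (0 < s'.reg 21 → mk i ≠ 1) ∧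
        (∀ k k', i - s'.reg 21 ≤ k → k < i → i - s'.reg 21 ≤ k' → k' < i → X k = X k') ∧
        s'.reg 20 = numMarks mk i * (n + 1) ∧
        (∀ j ≤ n, s'.arr 7 (s'.reg 20 + j) = lcs X Y (i - s'.reg 21) j) ∧
        IsTable X Y mk n i (s'.reg 20) (s'.arr 6) (s'.arr 7))
      L (fun k => 30 + if mk (k + 1) = 1 then (n + 1) * 200 else 0) hs₁ ?_ ?_ ?_) le_rfl hs₀
      fun s' _ _ h => ⟨h.2.2.2.2.1, h.2.2.2.2.2.2⟩
    · obtain ⟨h1, h2, h3, h4⟩ := h₁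
      have hz : ∀ j ≤ n, s₁.arr 7 j = 0 := fun j hj => by
        rw [hf₁.2 7 (by decide), h₀ j (by omega)]
      refine ⟨h3, by omega, by omega, by omega, by simp [h1, numMarks], fun j hj => ?_, ?_⟩
      · rw [h1, zero_add, hz j hj, Nat.zero_sub, lcs_zero_left]
      · intro e he _
        obtain rfl : e = 0 := by omega
        rw [h4]
        refine ⟨by omega, fun j hj => ?_⟩
        rw [zero_add, hz j hj, lcs_zero_left]
    · rintro i s' hi hs' hf ⟨h4, -⟩
      have e3 := (((hf.1 3 (by decide)).trans (hf₁.1 3 (by decide))).trans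
        (hf₀.1 3 (by decide))).trans hL
      simp only [Test.Ok, Test.Holds, Expr.Ok, Expr.eval, h4, e3, true_and, and_true]
    · rintro i s' hi hs' hf ⟨h1, h2, h3, h4, h5, h6, h7⟩
      have e6 := (((hf.1 6 (by decide)).trans (hf₁.1 6 (by decide))).trans
        (hf₀.1 6 (by decide))).trans hn
      have a3 := ((hf.2 3 (by decide)).trans (hf₁.2 3 (by decide))).trans (hf₀.2 3 (by decide))
      have a4 := ((hf.2 4 (by decide)).trans (hf₁.2 4 (by decide))).trans (hf₀.2 4 (by decide))
      have a5 := ((hf.2 5 (by decide)).trans (hf₁.2 5 (by decide))).trans (hf₀.2 5 (by decide))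
      set ell := s'.reg 21 with hell
      have hset : Run w (.assign 23 (.get 3 (.reg 22)) ;;
          .assign 22 (.add (.reg 22) (.const 1)) ;; .assign 21 (.add (.reg 21) (.const 1))) s' 11
          fun s'' => s''.reg 23 = X i ∧ s''.reg 22 = i + 1 ∧ s''.reg 21 = ell + 1 := by
        refine (Run.of_wp hs' ?_).mono (by decide) hs' fun _ _ _ h => h
        simp only [h1, a3, hX i hi, ← hell, Prog.wp, Expr.Ok, Expr.eval, State.setReg_reg,
          State.setReg_arr, if_true, if_false, Nat.reduceEqDiff, true_and, and_true]
        omega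
      -- A change of character at `i` would make `i` marked, and then the pending block would be
      -- empty.
      have hXall : ∀ k, i - ell ≤ k → k < i + 1 → X k = X i := by
        intro k hk hk'
        by_cases hki : k = i
        · rw [hki]
        · have h8 : X i = X (i - 1) := by
            by_contra hne
            exact h3 (by omega) (hb i (by omega) hi hne)
          rw [h8]
          exact h4 k (i - 1) hk (by omega) (by omega) (by omega)
      have hmarks : numMarks mk (i + 1) = numMarks mk i + if mk (i + 1) = 1 then 1 else 0 :=
        Finset.sum_range_succ _ _
      have hbase : s'.reg 20 ≤ L * (n + 1) := by
        rw [h5]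
        exact Nat.mul_le_mul_right _ ((numMarks_le mk i).trans hi.le)
      rw [Nat.add_mul] at hw
      refine Run.mono (T := 11 + (4 + 1 + (1 + if mk (i + 1) = 1 then (n + 1) * 200 else 0)))
        (hset.seq hs' fun s₂ hs₂ hf₂ h₂ => ?_) (by omega) hs' fun _ _ _ h => h
      obtain ⟨g1, g2, g3⟩ := h₂
      have b20 := hf₂.1 20 (by decide)
      have b6 := (hf₂.1 6 (by decide)).trans e6
      have c3 := (hf₂.2 3 (by decide)).trans a3
      have c4 := (hf₂.2 4 (by decide)).trans a4
      have c5 := (hf₂.2 5 (by decide)).trans a5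
      have c6 := hf₂.2 6 (by decide)
      have c7 := hf₂.2 7 (by decide)
      refine Run.ite hs₂ (by simp only [Test.Ok, Expr.Ok, true_and]; omega) (fun hm => ?_) fun hm => ?_
      · simp only [Test.Holds, Expr.eval, g2, c5, hmk (i + 1) (by omega)] at hm
        rw [if_pos hm] at hmarks ⊢
        refine Run.mono (T := (n * 150 + 50) + 8) ((run_addRow (X := X) (Y := Y) (i₀ := i - ell)
          (l := ell + 1) (n := n) (base := s'.reg 20) (c := X i) hs₂ (by omega) b20 g3 (by omega)
          g1 b6 (by rw [c4]; exact hY) (fun k hk => hXall _ (by omega) (by omega))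
          (by rw [c7]; exact h6)).seq hs₂ fun s₃ hs₃ hf₃ h₃ => ?_) (by omega) hs₂
          fun _ _ _ h => h
        obtain ⟨k1, k2, k3⟩ := h₃
        have d22 := (hf₃.1 22 (by decide)).trans g2
        have d6 := (hf₃.2 6 (by decide)).trans c6
        refine (Run.of_wp hs₃ ?_).mono (by decide) hs₃ fun _ _ _ h => h
        simp only [k1, d22, d6, Prog.wp, Expr.Ok, Expr.eval, State.setReg_reg, State.setReg_arr,
          State.setArr_reg, State.setArr_arr_self, State.setArr_arr_of_ne, ne_eq,
          Nat.reduceEqDiff, not_false_eq_true, if_true, if_false, true_and, and_true]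
        have hrow : i - ell + (ell + 1) = i + 1 := by omega
        rw [hrow] at k3
        have hb' : numMarks mk (i + 1) * (n + 1) = s'.reg 20 + n + 1 := by
          rw [hmarks, Nat.add_mul, ← h5]
          omega
        refine ⟨by omega, by omega, by omega, by omega, hb'.symm, k3, fun e he hme => ?_⟩
        beta_reduce
        split_ifs with hei
        · subst hei
          exact ⟨le_rfl, k3⟩
        · obtain ⟨h8, h9⟩ := h7 e (by omega) hme
          refine ⟨by omega, fun j hj => ?_⟩
          rw [k2 _ (by omega), c7, h9 j hj]
      · simp only [Test.Holds, Expr.eval, g2, c5, hmk (i + 1) (by omega)] at hm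
        rw [if_neg hm] at hmarks ⊢
        refine (Run.of_wp hs₂ ?_).mono (by decide) hs₂ fun _ _ _ h => h
        simp only [Prog.wp, g2, g3, b20, c6, c7, hmarks]
        have hrow : i + 1 - (ell + 1) = i - ell := by omega
        rw [hrow]
        refine ⟨trivial, by omega, fun _ => hm, fun k k' hk hk1 hk' hk1' => ?_, h5, h6,
          fun e he hme => h7 e ?_ hme⟩
        · rw [hXall k hk hk1, hXall k' hk' hk1']
        · rcases hme with rfl | hme
          · omega
          · by_contra hlt
            obtain rfl : e = i + 1 := by omega
            exact hm hme
  · have hsum : ∑ k ∈ Finset.range L, ((30 + if mk (k + 1) = 1 then (n + 1) * 200 else 0) + 3 + 1) =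
        L * 34 + numMarks mk L * (n + 1) * 200 := by
      simp only [numMarks, Finset.sum_add_distrib, Finset.sum_const, Finset.card_range,
        Finset.sum_mul, smul_eq_mul]
      rw [show ∑ k ∈ Finset.range L, (if mk (k + 1) = 1 then (n + 1) * 200 else 0) =
        ∑ k ∈ Finset.range L, (if mk (k + 1) = 1 then 1 else 0) * (n + 1) * 200 from
        Finset.sum_congr rfl fun k _ => by split_ifs <;> simp]
      omega
    rw [hsum]
    omega

theorem run_copy {w : ℕ} {a b x m : ℕ} {s : State} (hs : Bdd w s) (hx : x ≠ 12) (hab : b ≠ a)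
    (hm : m + 1 < cap w) (hxm : s.reg x = m) :
    Run w (fill a (.reg x) (.get b (.reg 12))) s (m * 12 + 6)
      fun s' => ∀ i < m, s'.arr a i = s.arr b i :=
  (run_fill (n := .reg x) (e := .get b (.reg 12)) m (s.arr b) hs hm (fun s' hs' => ⟨trivial, (hs' x hx).trans hxm⟩)
    fun i s' _ hi _ ha => ⟨trivial, by simp only [Expr.eval, hi, ha b hab]⟩).mono
    (by simp only [Expr.cost]; omega) hs fun _ _ _ h => h

/-! ### The choice of the rows and the size of the table -/

/-- The positions `U r` and `V r` for `r < R` are marked. -/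
noncomputable def marks (R : ℕ) (U V : ℕ → ℕ) (i : ℕ) : ℕ :=
  open Classical in if ∃ r < R, U r = i ∨ V r = i then 1 else 0

theorem marks_eq_one {R : ℕ} {U V : ℕ → ℕ} {i : ℕ} :
    marks R U V i = 1 ↔ ∃ r < R, U r = i ∨ V r = i := by
  simp [marks, or_iff_not_imp_left]

/-- Each run contributes at most two marks, one for its boundary and one for its slot. This makes
the table of size `O(mN)`. -/
theorem numMarks_marks_le (R : ℕ) (U V : ℕ → ℕ) (i : ℕ) : numMarks (marks R U V) i ≤ 2 * R := by
  have h1 : numMarks (marks R U V) i =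
      ((Finset.range i).filter fun k => marks R U V (k + 1) = 1).card := by
    rw [numMarks, Finset.card_filter]
  have h2 : (((Finset.range i).filter fun k => marks R U V (k + 1) = 1).image (· + 1)) ⊆
      (Finset.range R).image U ∪ (Finset.range R).image V := by
    intro x hx
    simp only [Finset.mem_image, Finset.mem_filter, marks_eq_one] at hx
    obtain ⟨k, ⟨-, r, hr, h⟩, rfl⟩ := hx
    simp only [Finset.mem_union, Finset.mem_image, Finset.mem_range]
    rcases h with h | h
    · exact .inl ⟨r, hr, h⟩
    · exact .inr ⟨r, hr, h⟩
  rw [h1, ← Finset.card_image_of_injective _ (add_left_injective 1)]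
  refine (Finset.card_le_card h2).trans ((Finset.card_union_le _ _).trans ?_)
  have h3 := Finset.card_image_le (s := Finset.range R) (f := U)
  have h4 := Finset.card_image_le (s := Finset.range R) (f := V)
  rw [Finset.card_range] at h3 h4
  omega

/-- Mark the positions in the first cells of the arrays `16` and `17`; register `10` holds the
number of these cells. -/
def setMarks : Prog :=
  fill 5 (.add (.reg 3) (.const 1)) (.const 0) ;;
  .assign 13 (.const 0) ;;
  .loop (.lt (.reg 13) (.reg 10))
    (.write 5 (.get 16 (.reg 13)) (.const 1) ;; .write 5 (.get 17 (.reg 13)) (.const 1) ;;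
      .assign 13 (.add (.reg 13) (.const 1)))

theorem run_setMarks {w : ℕ} {s : State} {L R : ℕ} {U V : ℕ → ℕ} (hs : Bdd w s)
    (hw : L + R + 2 < cap w) (hL : s.reg 3 = L) (hR : s.reg 10 = R)
    (hU : ∀ r < R, s.arr 16 r = U r) (hV : ∀ r < R, s.arr 17 r = V r) :
    Run w setMarks s ((L + 1) * 20 + R * 30 + 20)
      fun s' => ∀ i ≤ L, s'.arr 5 i = marks R U V i := by
  have hfill := run_fill (a := 5) (n := .add (.reg 3) (.const 1)) (e := .const 0) (w := w)
    (s := s) (L + 1) (fun _ => 0) hs (by omega)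
    (fun s' hs' => by simp [Expr.Ok, Expr.eval, hs' 3 (by simp), hL]; omega)
    (fun i s' _ _ _ _ => ⟨by simp only [Expr.Ok]; omega, rfl⟩)
  refine Run.mono (hfill.seq hs fun s₀ hs₀ hf₀ h₀ => Run.seq (T := 2)
    (Q := fun s' => s'.reg 13 = 0) ?_ hs₀ fun s₁ hs₁ hf₁ h₁ => Run.loop_const
    (fun k s' => s'.reg 13 = k ∧ ∀ i ≤ L, s'.arr 5 i = marks k U V i) R 20 hs₁ ?_ ?_ ?_) ?_ hs
    fun s' _ _ h => h.2
  · refine Run.of_wp hs₀ ?_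
    simp [Prog.wp, Expr.Ok, Expr.eval]
    omega
  · refine ⟨h₁, fun i hi => ?_⟩
    rw [hf₁.2 5 (by decide), h₀ i (by omega)]
    simp [marks]
  · rintro k s' hk hs' hf ⟨h4, -⟩
    have e10 := (((hf.1 10 (by decide)).trans (hf₁.1 10 (by decide))).trans
      (hf₀.1 10 (by decide))).trans hR
    simp only [Test.Ok, Test.Holds, Expr.Ok, Expr.eval, h4, e10, true_and, and_true]
  · rintro k s' hk hs' hf ⟨h4, h5⟩
    have a16 := ((hf.2 16 (by decide)).trans (hf₁.2 16 (by decide))).trans (hf₀.2 16 (by decide))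
    have a17 := ((hf.2 17 (by decide)).trans (hf₁.2 17 (by decide))).trans (hf₀.2 17 (by decide))
    refine (Run.of_wp hs' ?_).mono (by decide) hs' fun _ _ _ h => h
    simp only [h4, a16, a17, hU k hk, hV k hk, Prog.wp, Expr.Ok, Expr.eval, State.setReg_reg,
      State.setReg_arr, State.setArr_reg, State.setArr_arr_self, State.setArr_arr_of_ne, ne_eq,
      Nat.reduceEqDiff, not_false_eq_true, if_true, if_false, true_and, and_true]
    refine ⟨by omega, by omega, ⟨by omega, by omega⟩, fun i hi => ?_⟩
    rw [h5 i hi]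
    by_cases hUi : i = U k
    · have : marks (k + 1) U V i = 1 := marks_eq_one.2 ⟨k, by omega, .inl hUi.symm⟩
      rw [this, if_pos hUi, ite_self]
    · by_cases hVi : i = V k
      · have : marks (k + 1) U V i = 1 := marks_eq_one.2 ⟨k, by omega, .inr hVi.symm⟩
        rw [this, if_pos hVi]
      · rw [if_neg hUi, if_neg hVi]
        have : (∃ r < k + 1, U r = i ∨ V r = i) ↔ ∃ r < k, U r = i ∨ V r = i := by
          constructor
          · rintro ⟨r, hr, h⟩
            have : r ≠ k := by rintro rfl; omega
            exact ⟨r, by omega, h⟩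
          · rintro ⟨r, hr, h⟩
            exact ⟨r, by omega, h⟩
        simp only [marks, this]
  · simp only [Test.cost, Expr.cost]
    omega

/-- Compute the table with rows at the positions in the arrays `16` and `17`. -/
def table : Prog := setMarks ;; buildTable

/-- Of the two bounds on the start of the last row, the one in terms of `R` serves the time for
copying the table, and the one in terms of `L` serves the word length. -/
theorem run_table {w : ℕ} {s : State} {X Y U V : ℕ → ℕ} {L n R : ℕ} (hs : Bdd w s)
    (hw : (L + 2) * (n + 1) + 2 * n + L + R + 10 < cap w) (hL : s.reg 3 = L) (hn : s.reg 6 = n)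
    (hR : s.reg 10 = R) (hX : ∀ k < L, s.arr 3 k = X k) (hY : ∀ k < n, s.arr 4 k = Y k)
    (hU : ∀ r < R, s.arr 16 r = U r) (hV : ∀ r < R, s.arr 17 r = V r)
    (hb : ∀ k, 0 < k → k < L → X k ≠ X (k - 1) → ∃ r < R, U r = k) :
    Run w table s ((L + 1) * 100 + R * 1000 + (n + 1) * 100 + R * n * 400)
      fun s' => s'.reg 20 ≤ 2 * (R * n) + 2 * R ∧ s'.reg 20 ≤ L * (n + 1) ∧
        IsTable X Y (marks R U V) n L (s'.reg 20) (s'.arr 6) (s'.arr 7) := by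
  have h1 := numMarks_marks_le R U V L
  have h1' := numMarks_le (marks R U V) L
  have h2 : numMarks (marks R U V) L * (n + 1) ≤ 2 * R * (n + 1) := Nat.mul_le_mul_right _ h1
  have h2' : numMarks (marks R U V) L * (n + 1) ≤ L * (n + 1) := Nat.mul_le_mul_right _ h1'
  have h3 : 2 * R * (n + 1) = 2 * (R * n) + 2 * R := by ring
  refine Run.mono ((run_setMarks hs (by omega) hL hR hU hV).seq hs fun s₁ hs₁ hf₁ h₁ =>
    run_buildTable (X := X) (Y := Y) (mk := marks R U V) (L := L) (n := n) hs₁ (by omega)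
      ((hf₁.1 3 (by decide)).trans hL) ((hf₁.1 6 (by decide)).trans hn)
      (by rw [hf₁.2 3 (by decide)]; exact hX) (by rw [hf₁.2 4 (by decide)]; exact hY) h₁
      fun k hk hk' hne => ?_) (by omega) hs fun s' _ _ h => ⟨by rw [h.1]; omega, by rw [h.1]; omega, h.2⟩
  obtain ⟨r, hr, h⟩ := hb k hk hk' hne
  exact marks_eq_one.2 ⟨r, hr, .inl h⟩

/-! ### Combining the slots of two strings -/

/-- The result of scanning `A` for the pattern `C`, which starts with a run of `p` copies of
`a`: the starts of the `R` runs, and for some of the runs a block that starts at `sr r` and in which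
`C` embeds up to `cur r`. -/
structure Analysis (A C : List ℕ) (a p R : ℕ) (st cur sr : ℕ → ℕ) : Prop where
  eq_runs : R = runs (str A) A.length
  st_lt : ∀ r < R, st r < A.length
  boundary : ∀ k, 0 < k → k < A.length → str A k ≠ str A (k - 1) → ∃ r < R, st r = k
  sr_le : ∀ r < R, sr r ≤ A.length
  sound : ∀ r < R, cur r ≤ A.length → ∃ e, IsBlock (str A) A.length a p (sr r) e ∧
    cur r = greedy (str A) A.length e (C.drop p)
  complete : ∀ e, IsRunEnd (str A) A.length a p e → greedy (str A) A.length e (C.drop p) ≤ A.length →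
    ∃ r < R, IsBlock (str A) A.length a p (sr r) e ∧
      cur r = greedy (str A) A.length e (C.drop p)

theorem Analysis.congr {A C : List ℕ} {a p R : ℕ} {st cur sr st' cur' sr' : ℕ → ℕ}
    (h : Analysis A C a p R st cur sr) (hst : ∀ r < R, st' r = st r)
    (hcur : ∀ r < R, cur' r = cur r) (hsr : ∀ r < R, sr' r = sr r) :
    Analysis A C a p R st' cur' sr' := by
  refine ⟨h.eq_runs, fun r hr => by rw [hst r hr]; exact h.st_lt r hr, fun k hk hk' hne => ?_,
    fun r hr => by rw [hsr r hr]; exact h.sr_le r hr, fun r hr hle => ?_, fun e he hg => ?_⟩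
  · obtain ⟨r, hr, h'⟩ := h.boundary k hk hk' hne
    exact ⟨r, hr, (hst r hr).trans h'⟩
  · rw [hcur r hr] at hle ⊢
    rw [hsr r hr]
    exact h.sound r hr hle
  · obtain ⟨r, hr, h'⟩ := h.complete e he hg
    exact ⟨r, hr, by rw [hsr r hr]; exact h'.1, by rw [hcur r hr]; exact h'.2⟩

theorem Analysis.of_slots {A C : List ℕ} {a p R : ℕ} {st ro e cur sr : ℕ → ℕ}
    (h : RunTable (str A) A.length R st ro) (h' : Slots (str A) A.length a p A.length R e sr)
    (hcur : ∀ r < R, cur r = greedy (str A) A.length (e r) (C.drop p)) :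
    Analysis A C a p R st cur sr := by
  refine ⟨h.eq_runs, h.st_lt, h.boundary, fun r hr => (h'.bound r hr).2, fun r hr hle => ?_,
    fun x hx hg => ?_⟩
  -- Greedy extension never moves back, so a run without a block, whose initial end is beyond the
  -- string, cannot become valid.
  · have := le_greedy (str A) A.length (e r) (C.drop p)
    rw [← hcur r hr] at this
    exact ⟨e r, h'.sound r hr (by omega), hcur r hr⟩
  · obtain ⟨h1, h2, h3, h4, h5⟩ := hx
    obtain ⟨r, hr, rfl⟩ := h'.complete x h1 h2 h3 h4 h5
    exact ⟨r, hr, h'.sound r hr h2, hcur r hr⟩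

/-- The length of a candidate for a slot in `A`, which starts at `s` and ends at `f`, and a slot in
`B`, which starts at `s'` and ends at `f'`. -/
def pairValue (A B C : List ℕ) (s f s' f' : ℕ) : ℕ :=
  lcs (str A) (str B) s s' + C.length +
    lcs (str A.reverse) (str B.reverse) (A.length - f) (B.length - f')

theorem Analysis.sublist {A C W Y : List ℕ} {a p R r : ℕ} {st cur sr : ℕ → ℕ}
    (h : Analysis A C a p R st cur sr) (hC : C.take p = List.replicate p a) (hr : r < R)
    (hcur : cur r ≤ A.length) (hW : List.Sublist W (A.take (sr r)))
    (hY : List.Sublist Y (A.drop (cur r))) : List.Sublist (W ++ C ++ Y) A := by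
  obtain ⟨e, h1, h2⟩ := h.sound r hr hcur
  rw [h2] at hcur hY
  have := sublist_of_isBlock h1 hcur hW hY
  rwa [← hC, List.take_append_drop] at this

theorem Analysis.exists_slot {A C W Y : List ℕ} {a p R : ℕ} {st cur sr : ℕ → ℕ}
    (h : Analysis A C a p R st cur sr) (hp : 0 < p) (hC : C.take p = List.replicate p a)
    (hpC : p < C.length) (hne : str C p ≠ a) (hs : List.Sublist (W ++ C ++ Y) A) :
    ∃ r < R, cur r ≤ A.length ∧ List.Sublist W (A.take (sr r)) ∧
      List.Sublist Y (A.drop (cur r)) := by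
  have hdrop := drop_str hpC
  have hs' : List.Sublist (W ++ (List.replicate p a ++ str C p :: C.drop (p + 1)) ++ Y) A := by
    rwa [← hC, ← hdrop, List.take_append_drop]
  obtain ⟨e, h1, h2, h3, h4⟩ := exists_isRunEnd hp hne hs'
  rw [← hdrop] at h2 h3
  obtain ⟨r, hr, h5, h6⟩ := h.complete e h1 h2
  rw [← h6] at h2 h3
  exact ⟨r, hr, h2, h4 _ h5, h3⟩

/-- Glue an LCS of the prefixes, `C` and an LCS of the suffixes; the last one is found in the
reversed strings, where suffixes become prefixes. -/
theorem exists_candidate {A B C : List ℕ} {a p RA RB r r' : ℕ} {st cur sr st' cur' sr' : ℕ → ℕ}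
    (hA : Analysis A C a p RA st cur sr) (hB : Analysis B C a p RB st' cur' sr')
    (hC : C.take p = List.replicate p a) (hr : r < RA) (hr' : r' < RB) (hcur : cur r ≤ A.length)
    (hcur' : cur' r' ≤ B.length) : ∃ Z, IsCandidate A B C Z ∧
      Z.length = pairValue A B C (sr r) (cur r) (sr' r') (cur' r') := by
  obtain ⟨W, h1, h2, h3⟩ := exists_lcs (hA.sr_le r hr) (hB.sr_le r' hr')
  obtain ⟨Y, h4, h5, h6⟩ := exists_lcs (A := A.reverse) (B := B.reverse)
    (i := A.length - cur r) (j := B.length - cur' r') (by simp) (by simp)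
  rw [List.take_reverse, Nat.sub_sub_self hcur] at h4
  rw [List.take_reverse, Nat.sub_sub_self hcur'] at h5
  refine ⟨W ++ C ++ Y.reverse, ⟨⟨W, Y.reverse, rfl⟩,
    hA.sublist hC hr hcur h1 (by simpa using h4.reverse),
    hB.sublist hC hr' hcur' h2 (by simpa using h5.reverse)⟩, ?_⟩
  simp only [List.length_append, List.length_reverse, h3, h6, pairValue]

/-- The slots in `A` and `B` may be chosen independently for the same decomposition of `Z`, since
each normalization leaves `W` and `Y` unchanged. -/
theorem exists_pair {A B C Z : List ℕ} {a p RA RB : ℕ} {st cur sr st' cur' sr' : ℕ → ℕ}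
    (hA : Analysis A C a p RA st cur sr) (hB : Analysis B C a p RB st' cur' sr') (hp : 0 < p)
    (hC : C.take p = List.replicate p a) (hpC : p < C.length) (hne : str C p ≠ a)
    (hZ : IsCandidate A B C Z) : ∃ r < RA, ∃ r' < RB, cur r ≤ A.length ∧ cur' r' ≤ B.length ∧
      Z.length ≤ pairValue A B C (sr r) (cur r) (sr' r') (cur' r') := by
  obtain ⟨⟨W, Y, rfl⟩, h1, h2⟩ := hZ
  obtain ⟨r, hr, h3, h4, h5⟩ := hA.exists_slot hp hC hpC hne h1
  obtain ⟨r', hr', h3', h4', h5'⟩ := hB.exists_slot hp hC hpC hne h2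
  refine ⟨r, hr, r', hr', h3, h3', ?_⟩
  have h6 := length_le_lcs (hA.sr_le r hr) (hB.sr_le r' hr') h4 h4'
  have h7 := length_le_lcs (A := A.reverse) (B := B.reverse) (Z := Y.reverse)
    (i := A.length - cur r) (j := B.length - cur' r') (by simp) (by simp)
    (by rw [List.take_reverse, Nat.sub_sub_self h3]; exact h5.reverse)
    (by rw [List.take_reverse, Nat.sub_sub_self h3']; exact h5'.reverse)
  rw [List.length_reverse] at h7
  simp only [List.length_append, pairValue]
  omega

/-- `v` is the maximum of `f` on `S`, or `0` if `S` is empty. -/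
def IsMaxValue (S : ℕ → ℕ → Prop) (f : ℕ → ℕ → ℕ) (v : ℕ) : Prop :=
  (∀ r r', S r r' → f r r' ≤ v) ∧ (v = 0 ∨ ∃ r r', S r r' ∧ v = f r r')

theorem IsMaxValue.congr {S S' : ℕ → ℕ → Prop} {f : ℕ → ℕ → ℕ} {v : ℕ} (h : IsMaxValue S f v)
    (hS : ∀ r r', S' r r' ↔ S r r') : IsMaxValue S' f v := by
  obtain rfl : S' = S := by
    ext r r'
    exact hS r r'
  exact h

theorem IsMaxValue.insert {S S' : ℕ → ℕ → Prop} {f : ℕ → ℕ → ℕ} {v v' k j : ℕ} (h : IsMaxValue S f v)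
    (hS : ∀ r r', S' r r' ↔ S r r' ∨ r = k ∧ r' = j) (hv : v' = max v (f k j)) :
    IsMaxValue S' f v' := by
  refine ⟨fun r r' hr => ?_, ?_⟩
  · rcases (hS r r').1 hr with h' | ⟨rfl, rfl⟩
    · have := h.1 r r' h'
      omega
    · omega
  · by_cases hlt : v < f k j
    · exact .inr ⟨k, j, (hS k j).2 (.inr ⟨rfl, rfl⟩), by omega⟩
    · rcases h.2 with h' | ⟨r, r', h1, h2⟩
      · left
        omega
      · exact .inr ⟨r, r', (hS r r').2 (.inl h1), by omega⟩

/-- Every candidate has length at most `v`, and a nonzero `v` is attained by a candidate. The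
default `0` is harmless: a value above the optimum would be nonzero, hence attained. -/
theorem IsMaxValue.spec {A B C : List ℕ} {a p RA RB v : ℕ} {st cur sr st' cur' sr' : ℕ → ℕ}
    (hA : Analysis A C a p RA st cur sr) (hB : Analysis B C a p RB st' cur' sr') (hp : 0 < p)
    (hC : C.take p = List.replicate p a) (hpC : p < C.length) (hne : str C p ≠ a)
    (hv : IsMaxValue (fun r r' => r < RA ∧ r' < RB ∧ cur r ≤ A.length ∧ cur' r' ≤ B.length)
      (fun r r' => pairValue A B C (sr r) (cur r) (sr' r') (cur' r')) v) :
    (∀ Z, IsSTRICLCS A B C Z → v = Z.length) ∧ ((¬ ∃ Z, IsSTRICLCS A B C Z) → v = 0) := by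
  have hle : ∀ Z, IsCandidate A B C Z → Z.length ≤ v := by
    intro Z hZ
    obtain ⟨r, hr, r', hr', h1, h2, h3⟩ := exists_pair hA hB hp hC hpC hne hZ
    exact h3.trans (hv.1 r r' ⟨hr, hr', h1, h2⟩)
  have hex : v ≠ 0 → ∃ Z, IsCandidate A B C Z ∧ Z.length = v := by
    intro h0
    obtain ⟨r, r', ⟨hr, hr', h1, h2⟩, h3⟩ := hv.2.resolve_left h0
    rw [h3]
    exact exists_candidate hA hB hC hr hr' h1 h2
  refine ⟨fun Z hZ => ?_, fun hno => ?_⟩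
  · have h1 := hle Z hZ.1
    by_contra hvZ
    obtain ⟨Z', h2, h3⟩ := hex (by omega)
    have h4 := hZ.2 Z' h2
    omega
  · by_contra h0
    obtain ⟨Z, h1, h2⟩ := hex h0
    exact hno ⟨Z, h1, fun Z' hZ' => by rw [h2]; exact hle Z' hZ'⟩

/-! ### Changing the alphabet -/

theorem isCandidate_map {α β : Type} {f : α → β} (hf : Function.Injective f) {A B C Z : List α} :
    IsCandidate (A.map f) (B.map f) (C.map f) (Z.map f) ↔ IsCandidate A B C Z := by
  have hsub : ∀ {X Y : List α}, List.Sublist (X.map f) (Y.map f) ↔ List.Sublist X Y := by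
    intro X Y
    refine ⟨fun h => ?_, fun h => h.map f⟩
    obtain ⟨X', h1, h2⟩ := List.sublist_map_iff.1 h
    rwa [List.map_injective_iff.2 hf h2]
  have hinf : C.map f <:+: Z.map f ↔ C <:+: Z := by
    constructor
    · rintro ⟨s, t, h⟩
      obtain ⟨l₁, l₂, rfl, h1, h2⟩ := List.map_eq_append_iff.1 h.symm
      obtain ⟨l₃, l₄, rfl, h3, h4⟩ := List.map_eq_append_iff.1 h1
      rw [List.map_injective_iff.2 hf h4.symm]
      exact ⟨l₃, l₂, rfl⟩
    · rintro ⟨s, t, rfl⟩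
      exact ⟨s.map f, t.map f, by simp⟩
  rw [IsCandidate, IsCandidate, hsub, hsub, hinf]

theorem IsCandidate.exists_map {α β : Type} {f : α → β} {A B C : List α} {Z : List β}
    (h : IsCandidate (A.map f) (B.map f) (C.map f) Z) : ∃ Z' : List α, Z = Z'.map f := by
  obtain ⟨Z', -, h'⟩ := List.sublist_map_iff.1 h.2.1
  exact ⟨Z', h'⟩

/-- Over `β` maximality ranges over more strings, but a candidate is a subsequence of `A.map f` and
therefore comes from a string over `α`. -/
theorem isSTRICLCS_map {α β : Type} {f : α → β} (hf : Function.Injective f) {A B C Z : List α} :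
    IsSTRICLCS (A.map f) (B.map f) (C.map f) (Z.map f) ↔ IsSTRICLCS A B C Z := by
  refine and_congr (isCandidate_map hf) ⟨fun h Z' hZ' => ?_, fun h Z' hZ' => ?_⟩
  · simpa using h _ ((isCandidate_map hf).2 hZ')
  · obtain ⟨Z'', rfl⟩ := hZ'.exists_map
    simpa using h _ ((isCandidate_map hf).1 hZ')

/-! ### The program -/

/-- The registers and arrays that hold the input. -/
structure Input (A B C : List ℕ) (s : State) : Prop where
  lenA : s.reg 0 = A.length
  lenB : s.reg 1 = B.length
  lenC : s.reg 2 = C.length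
  strA : s.arr 0 = str A
  strB : s.arr 1 = str B
  strC : s.arr 2 = str C

theorem Input.frame {A B C : List ℕ} {s s' : State} {p : Prog} (h : Input A B C s)
    (hf : Frame p s s') (hp : ∀ x ∈ [0, 1, 2], x ∉ p.regs ∧ x ∉ p.arrs) : Input A B C s' :=
  ⟨(hf.1 0 (hp 0 (by simp)).1).trans h.lenA, (hf.1 1 (hp 1 (by simp)).1).trans h.lenB,
    (hf.1 2 (hp 2 (by simp)).1).trans h.lenC, (hf.2 0 (hp 0 (by simp)).2).trans h.strA,
    (hf.2 1 (hp 1 (by simp)).2).trans h.strB, (hf.2 2 (hp 2 (by simp)).2).trans h.strC⟩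

/-- `p` is the first position whose character differs from that at `0`; without such a position `C`
would have at most one run. -/
theorem exists_first_run {C : List ℕ} (h : 1 < (rle C).length) : ∃ p, 0 < p ∧ p < C.length ∧
    str C p ≠ str C 0 ∧ (∀ k < p, str C k = str C 0) ∧ C.take p = List.replicate p (str C 0) := by
  have hex : ∃ p, p < C.length ∧ str C p ≠ str C 0 := by
    by_contra! hno
    have key : ∀ i ≤ C.length, runs (str C) i ≤ 1 := by
      intro i hi
      induction i with
      | zero => simp [runs]
      | succ i ih =>
        rw [runs]
        rcases Nat.eq_zero_or_pos i with rfl | h0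
        · simp [runs]
        · rw [if_pos ⟨h0, (hno i (by omega)).trans (hno (i - 1) (by omega)).symm⟩]
          exact ih (by omega)
    have := key _ le_rfl
    rw [← runs_eq] at this
    omega
  obtain ⟨hlt, hne⟩ := Nat.find_spec hex
  have hmin : ∀ k < Nat.find hex, str C k = str C 0 := by
    intro k hk
    by_contra h'
    exact Nat.find_min hex hk ⟨by omega, h'⟩
  refine ⟨Nat.find hex, Nat.pos_of_ne_zero fun h0 => hne (by rw [h0]), hlt, hne, hmin, ?_⟩
  refine List.eq_replicate_iff.2 ⟨by rw [List.length_take]; omega, fun b hb => ?_⟩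
  obtain ⟨k, hk, rfl⟩ := List.mem_iff_getElem.1 hb
  rw [List.length_take] at hk
  have := hmin k (by omega)
  rw [str, List.getD_eq_getElem _ _ (by omega)] at this
  rw [List.getElem_take, this]

/-- Find the first run of the pattern. -/
def firstRun : Prog :=
  (.assign 5 (.get 2 (.const 0)) ;; .assign 4 (.const 1)) ;;
  .loop (.and (.lt (.reg 4) (.reg 2)) (.eq (.get 2 (.reg 4)) (.reg 5)))
    (.assign 4 (.add (.reg 4) (.const 1)))

theorem run_firstRun {w : ℕ} {s : State} {A B C : List ℕ} {p : ℕ} (hs : Bdd w s)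
    (hw : C.length + 2 < cap w) (hin : Input A B C s) (hp : 0 < p) (hpC : p < C.length)
    (hne : str C p ≠ str C 0) (hrun : ∀ k < p, str C k = str C 0) :
    Run w firstRun s (C.length * 20 + 20) fun s' => s'.reg 4 = p ∧ s'.reg 5 = str C 0 := by
  have hinit : Run w (.assign 5 (.get 2 (.const 0)) ;; .assign 4 (.const 1)) s 5
      fun s' => s'.reg 4 = 1 ∧ s'.reg 5 = str C 0 := by
    refine Run.of_wp hs ?_
    simp [Prog.wp, Expr.Ok, Expr.eval, hin.strC]
    omega
  refine Run.mono (hinit.seq hs fun s₁ hs₁ hf₁ h₁ => Run.loop_const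
    (fun k s' => s'.reg 4 = k + 1 ∧ s'.reg 5 = str C 0) (p - 1) 4 hs₁ h₁ ?_ ?_) ?_ hs
    fun s' hs' hf h => ⟨by omega, h.2⟩
  · rintro k s' hk hs' hf ⟨h4, e5⟩
    have e2 := ((hf.1 2 (by decide)).trans (hf₁.1 2 (by decide))).trans hin.lenC
    have a2 := ((hf.2 2 (by decide)).trans (hf₁.2 2 (by decide))).trans hin.strC
    simp only [Test.Ok, Test.Holds, Expr.Ok, Expr.eval, h4, e2, e5, a2, true_and, and_true]
    constructor
    · rintro ⟨h1, h2⟩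
      have : k + 1 ≠ p := by
        rintro rfl
        exact hne h2
      omega
    · intro h
      exact ⟨by omega, hrun _ (by omega)⟩
  · rintro k s' hk hs' hf ⟨h4, e5⟩
    refine Run.of_wp hs' ?_
    simp only [h4, e5, Prog.wp, Expr.Ok, Expr.eval, State.setReg_reg, Nat.reduceEqDiff, if_true,
      if_false, true_and, and_true]
    omega
  · simp only [Test.cost, Expr.cost]
    omega

/-- Analyze the string in array `a`, whose length is in register `x`. -/
def analyze (a x : ℕ) : Prog :=
  fill 3 (.reg x) (.get a (.reg 12)) ;; .assign 3 (.reg x) ;; scan ;; embed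

theorem run_analyze {w a x p c : ℕ} {s : State} {A C : List ℕ} (hs : Bdd w s)
    (hw : 2 * A.length + C.length + 4 < cap w) (ha : a ≠ 3) (hx : x ≠ 12)
    (hxA : s.reg x = A.length) (haA : s.arr a = str A) (hK : s.reg 2 = C.length)
    (hC : s.arr 2 = str C) (hp : s.reg 4 = p) (hc : s.reg 5 = c) (hp0 : 0 < p)
    (hpC : p ≤ C.length) :
    Run w (analyze a x) s
      (A.length * 112 + C.length * (runs (str A) A.length * 100 + 100) + 30)
      fun s' => Analysis A C c p (s'.reg 10) (s'.arr 10) (s'.arr 13) (s'.arr 14) := by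
  refine Run.mono (T := (A.length * 12 + 6) + (2 + ((A.length * 100 + 10) +
    (C.length * (runs (str A) A.length * 100 + 100) + 10)))) ?_ (by omega) hs fun _ _ _ h => h
  refine (run_copy (a := 3) hs hx ha (by omega) hxA).seq hs fun s₁ hs₁ hf₁ h₁ => ?_
  have hf₁' : (∀ y, y ≠ 12 → s₁.reg y = s.reg y) ∧ ∀ b, b ≠ 3 → s₁.arr b = s.arr b :=
    ⟨fun y hy => hf₁.1 y (by simpa [fill, Prog.regs] using hy),
      fun b hb => hf₁.2 b (by simpa [fill, Prog.arrs] using hb)⟩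
  have hset : Run w (.assign 3 (.reg x)) s₁ 2 fun s' => s'.reg 3 = A.length := by
    refine Run.of_wp hs₁ ?_
    simp [Prog.wp, Expr.Ok, Expr.eval, hf₁'.1 x hx, hxA]
  refine hset.seq hs₁ fun s₂ hs₂ hf₂ h₂ => ?_
  have hf₂' : (∀ y, y ≠ 3 → s₂.reg y = s₁.reg y) ∧ ∀ b, s₂.arr b = s₁.arr b :=
    ⟨fun y hy => hf₂.1 y (by simpa [Prog.regs] using hy), fun b => hf₂.2 b (by simp [Prog.arrs])⟩
  have hX : ∀ k < A.length, s₂.arr 3 k = str A k := fun k hk => by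
    rw [hf₂'.2, h₁ k hk, haA]
  have e4 : s₂.reg 4 = p := by rw [hf₂'.1 4 (by simp), hf₁'.1 4 (by simp), hp]
  refine (run_scan (X := str A) (L := A.length) (a := c) (p := p) hs₂ (by omega) h₂ e4
    (by rw [hf₂'.1 5 (by simp), hf₁'.1 5 (by simp), hc]) hp0 hX).seq hs₂ fun s₃ hs₃ hf₃ h₃ => ?_
  obtain ⟨hT, hS⟩ := h₃
  have hR := hT.eq_runs
  refine (run_embed (X := str A) (L := A.length) (C := C) (p := p) hs₃ hw
    ((hf₃.1 3 (by decide)).trans h₂) hR ((hf₃.1 4 (by decide)).trans e4) hpC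
    (by rw [hf₃.1 2 (by decide), hf₂'.1 2 (by simp), hf₁'.1 2 (by simp), hK])
    (by rw [hf₃.2 2 (by decide), hf₂'.2, hf₁'.2 2 (by simp), hC]; exact fun _ _ => rfl)
    (by rw [hf₃.2 3 (by decide)]; exact hX) (by rw [← hR]; exact hT)
    (fun r hr => (hS.bound r (by omega)).1)).mono le_rfl hs₃ fun s₄ _ hf₄ h₄ => ?_
  rw [← hR] at h₄
  rw [hf₄.1 10 (by decide), hf₄.2 10 (by decide), hf₄.2 14 (by decide)]
  exact Analysis.of_slots hT hS h₄

/-- Analyze the first string. -/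
def analyzeA : Prog :=
  analyze 0 0 ;; .assign 30 (.reg 10) ;; fill 20 (.reg 30) (.get 10 (.reg 12)) ;;
  fill 21 (.reg 30) (.get 13 (.reg 12)) ;; fill 22 (.reg 30) (.get 14 (.reg 12))

theorem run_analyzeA {w p c : ℕ} {s : State} {A B C : List ℕ} (hs : Bdd w s)
    (hw : 2 * A.length + C.length + 4 < cap w) (hin : Input A B C s) (hp : s.reg 4 = p)
    (hc : s.reg 5 = c) (hp0 : 0 < p) (hpC : p ≤ C.length) :
    Run w analyzeA s (A.length * 112 + C.length * ((rle A).length * 100 + 100) +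
        (rle A).length * 36 + 60)
      fun s' => Analysis A C c p (s'.reg 30) (s'.arr 20) (s'.arr 21) (s'.arr 22) := by
  rw [runs_eq]
  have hRL := runs_le (str A) A.length
  set R := runs (str A) A.length with hR
  refine Run.mono (T := (A.length * 112 + C.length * (R * 100 + 100) + 30) + (2 + ((R * 12 + 6) +
    ((R * 12 + 6) + (R * 12 + 6))))) ?_ (by omega) hs fun _ _ _ h => h
  refine (run_analyze hs hw (by simp) (by simp) hin.lenA hin.strA hin.lenC hin.strC hp hc hp0
    hpC).seq hs fun s₁ hs₁ hf₁ h₁ => ?_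
  have h10 : s₁.reg 10 = R := h₁.eq_runs
  have hset : Run w (.assign 30 (.reg 10)) s₁ 2 fun s' => s'.reg 30 = R := by
    refine Run.of_wp hs₁ ?_
    simp [Prog.wp, Expr.Ok, Expr.eval, h10]
  refine hset.seq hs₁ fun s₂ hs₂ hf₂ h₂ => ?_
  refine (run_copy hs₂ (by simp) (by simp) (by omega) h₂).seq hs₂ fun s₃ hs₃ hf₃ h₃ => ?_
  refine (run_copy hs₃ (by simp) (by simp) (by omega) ((hf₃.1 30 (by decide)).trans h₂)).seq hs₃
    fun s₄ hs₄ hf₄ h₄ => ?_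
  refine (run_copy hs₄ (by simp) (by simp) (by omega) ((hf₄.1 30 (by decide)).trans
    ((hf₃.1 30 (by decide)).trans h₂))).mono le_rfl hs₄ fun s₅ hs₅ hf₅ h₅ => ?_
  rw [hf₅.1 30 (by decide), hf₄.1 30 (by decide), hf₃.1 30 (by decide), h₂]
  rw [h10] at h₁
  refine h₁.congr (fun r hr => ?_) (fun r hr => ?_) fun r hr => ?_
  · rw [hf₅.2 20 (by decide), hf₄.2 20 (by decide), h₃ r hr, hf₂.2 10 (by decide)]
  · rw [hf₅.2 21 (by decide), h₄ r hr, hf₃.2 13 (by decide), hf₂.2 13 (by decide)]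
  · rw [h₅ r hr, hf₄.2 14 (by decide), hf₃.2 14 (by decide), hf₂.2 14 (by decide)]

/-- Analyze the second string. -/
def analyzeB : Prog :=
  analyze 1 1 ;; .assign 31 (.reg 10) ;; fill 23 (.reg 31) (.get 13 (.reg 12)) ;;
  fill 24 (.reg 31) (.get 14 (.reg 12))

theorem run_analyzeB {w p c : ℕ} {s : State} {A B C : List ℕ} (hs : Bdd w s)
    (hw : 2 * B.length + C.length + 4 < cap w) (hin : Input A B C s) (hp : s.reg 4 = p)
    (hc : s.reg 5 = c) (hp0 : 0 < p) (hpC : p ≤ C.length) :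
    Run w analyzeB s (B.length * 112 + C.length * ((rle B).length * 100 + 100) +
        (rle B).length * 24 + 60)
      fun s' => Analysis B C c p (s'.reg 31) (s'.arr 10) (s'.arr 23) (s'.arr 24) := by
  rw [runs_eq]
  have hRL := runs_le (str B) B.length
  set R := runs (str B) B.length with hR
  refine Run.mono (T := (B.length * 112 + C.length * (R * 100 + 100) + 30) + (2 + ((R * 12 + 6) +
    (R * 12 + 6)))) ?_ (by omega) hs fun _ _ _ h => h
  refine (run_analyze hs hw (by simp) (by simp) hin.lenB hin.strB hin.lenC hin.strC hp hc hp0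
    hpC).seq hs fun s₁ hs₁ hf₁ h₁ => ?_
  have h10 : s₁.reg 10 = R := h₁.eq_runs
  have hset : Run w (.assign 31 (.reg 10)) s₁ 2 fun s' => s'.reg 31 = R := by
    refine Run.of_wp hs₁ ?_
    simp [Prog.wp, Expr.Ok, Expr.eval, h10]
  refine hset.seq hs₁ fun s₂ hs₂ hf₂ h₂ => ?_
  refine (run_copy hs₂ (by simp) (by simp) (by omega) h₂).seq hs₂ fun s₃ hs₃ hf₃ h₃ => ?_
  refine (run_copy hs₃ (by simp) (by simp) (by omega) ((hf₃.1 31 (by decide)).trans h₂)).mono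
    le_rfl hs₃ fun s₄ hs₄ hf₄ h₄ => ?_
  rw [hf₄.1 31 (by decide), hf₃.1 31 (by decide), h₂]
  rw [h10] at h₁
  refine h₁.congr (fun r hr => ?_) (fun r hr => ?_) fun r hr => ?_
  · rw [hf₄.2 10 (by decide), hf₃.2 10 (by decide), hf₂.2 10 (by decide)]
  · rw [hf₄.2 23 (by decide), h₃ r hr, hf₂.2 13 (by decide)]
  · rw [h₄ r hr, hf₃.2 14 (by decide), hf₂.2 14 (by decide)]

/-! ### The tables for prefixes and suffixes -/

/-- Compute the table for two strings, whose characters are given by `eX` and `eY`, and with rows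
at the positions given by `eU` and `eV`. -/
def tableOf (eX eY eU eV : Expr) : Prog :=
  fill 3 (.reg 0) eX ;; fill 4 (.reg 1) eY ;; fill 16 (.reg 30) eU ;; fill 17 (.reg 30) eV ;;
  (.assign 3 (.reg 0) ;; .assign 6 (.reg 1) ;; .assign 10 (.reg 30)) ;; table

/-- In states that agree with `s` on the memory that the tables depend on, the expression `e` with
the argument `i` in register `12` has the value `F i`. -/
def Computes (w : ℕ) (s : State) (m : ℕ) (e : Expr) (F : ℕ → ℕ) : Prop :=
  ∀ i s', i < m → s'.reg 12 = i → (∀ x, x ≠ 12 → s'.reg x = s.reg x) →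
    (∀ b, b ≠ 3 → b ≠ 4 → b ≠ 16 → b ≠ 17 → s'.arr b = s.arr b) → e.Ok w s' ∧ e.eval s' = F i

theorem run_tableOf {w : ℕ} {s : State} {X Y U V : ℕ → ℕ} {L n R : ℕ} {eX eY eU eV : Expr}
    (hs : Bdd w s) (hw : (L + 2) * (n + 1) + 2 * n + L + R + 10 < cap w) (hL : s.reg 0 = L)
    (hn : s.reg 1 = n) (hR : s.reg 30 = R) (hX : Computes w s L eX X) (hY : Computes w s n eY Y)
    (hU : Computes w s R eU U) (hV : Computes w s R eV V)
    (hb : ∀ k, 0 < k → k < L → X k ≠ X (k - 1) → ∃ r < R, U r = k)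
    (hcX : eX.cost ≤ 10) (hcY : eY.cost ≤ 10) (hcU : eU.cost ≤ 10) (hcV : eV.cost ≤ 10) :
    Run w (tableOf eX eY eU eV) s (L * 120 + R * 1040 + n * 120 + R * n * 400 + 300)
      fun s' => s'.reg 20 ≤ 2 * (R * n) + 2 * R ∧ s'.reg 20 ≤ L * (n + 1) ∧ s'.reg 3 = L ∧
        s'.reg 6 = n ∧ IsTable X Y (marks R U V) n L (s'.reg 20) (s'.arr 6) (s'.arr 7) := by
  -- One statement for all four copies: each writes only to an array on which the values of the
  -- later expressions do not depend.
  have hfill : ∀ {a m x : ℕ} {e : Expr} {F : ℕ → ℕ} {s' : State}, Bdd w s' → x ≠ 12 →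
      m + 1 < cap w → e.cost ≤ 10 → s.reg x = m → Computes w s m e F →
      (∀ x, x ≠ 12 → s'.reg x = s.reg x) →
      (∀ b, b ≠ 3 → b ≠ 4 → b ≠ 16 → b ≠ 17 → s'.arr b = s.arr b) →
      a = 3 ∨ a = 4 ∨ a = 16 ∨ a = 17 →
      Run w (fill a (.reg x) e) s' (m * 20 + 6) fun s'' => (∀ i < m, s''.arr a i = F i) ∧
        (∀ x, x ≠ 12 → s''.reg x = s.reg x) ∧
        (∀ b, b ≠ 3 → b ≠ 4 → b ≠ 16 → b ≠ 17 → s''.arr b = s.arr b) ∧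
        ∀ b, b ≠ a → s''.arr b = s'.arr b := by
    intro a m x e F s' hs' hx hm he hxm hc hr ha haa
    refine (run_fill (n := .reg x) (e := e) m F hs' hm
      (fun s'' h'' => ⟨trivial, ((h'' x hx).trans (hr x hx)).trans hxm⟩)
      fun i s'' hi h12 hr'' ha'' => hc i s'' hi h12 (fun x hx => (hr'' x hx).trans (hr x hx))
        fun b h1 h2 h3 h4 => (ha'' b (by omega)).trans (ha b h1 h2 h3 h4)).mono ?_ hs'
      fun s'' _ hf'' h'' => ⟨h'', fun y hy => ?_, fun b h1 h2 h3 h4 => ?_, fun b hb => ?_⟩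
    · simp only [Expr.cost]
      have : m * (1 + e.cost + 9) ≤ m * 20 := Nat.mul_le_mul_left _ (by omega)
      omega
    · rw [hf''.1 y (by simpa [fill, Prog.regs] using hy), hr y hy]
    · rw [hf''.2 b (by simp [fill, Prog.arrs]; omega), ha b h1 h2 h3 h4]
    · rw [hf''.2 b (by simpa [fill, Prog.arrs] using hb)]
  have hwL : L ≤ (L + 2) * (n + 1) := by nlinarith
  refine Run.mono (T := (L * 20 + 6) + ((n * 20 + 6) + ((R * 20 + 6) + ((R * 20 + 6) +
    (6 + ((L + 1) * 100 + R * 1000 + (n + 1) * 100 + R * n * 400)))))) ?_ (by omega) hs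
    fun _ _ _ h => h
  refine (hfill (a := 3) hs (by simp) (by omega) hcX hL hX (fun _ _ => rfl)
    (fun _ _ _ _ _ => rfl) (by simp)).seq hs fun s₁ hs₁ _ h₁ => ?_
  obtain ⟨f1, r1, a1, -⟩ := h₁
  refine (hfill (a := 4) hs₁ (by simp) (by omega) hcY hn hY r1 a1 (by simp)).seq hs₁
    fun s₂ hs₂ _ h₂ => ?_
  obtain ⟨f2, r2, a2, o2⟩ := h₂
  refine (hfill (a := 16) hs₂ (by simp) (by omega) hcU hR hU r2 a2 (by simp)).seq hs₂
    fun s₃ hs₃ _ h₃ => ?_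
  obtain ⟨f3, r3, a3, o3⟩ := h₃
  refine (hfill (a := 17) hs₃ (by simp) (by omega) hcV hR hV r3 a3 (by simp)).seq hs₃
    fun s₄ hs₄ _ h₄ => ?_
  obtain ⟨f4, r4, a4, o4⟩ := h₄
  have hset : Run w (.assign 3 (.reg 0) ;; .assign 6 (.reg 1) ;; .assign 10 (.reg 30)) s₄ 6
      fun s' => s'.reg 3 = L ∧ s'.reg 6 = n ∧ s'.reg 10 = R := by
    refine Run.of_wp hs₄ ?_
    simp [Prog.wp, Expr.Ok, Expr.eval, r4, hL, hn, hR]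
  refine hset.seq hs₄ fun s₅ hs₅ hf₅ h₅ => ?_
  obtain ⟨h3, h6, h10⟩ := h₅
  have o5 : s₅.arr = s₄.arr := by
    ext b
    rw [hf₅.2 b (by simp [Prog.arrs])]
  refine (run_table (X := X) (Y := Y) (U := U) (V := V) hs₅ hw h3 h6 h10
    (by rw [o5, o4 3 (by simp), o3 3 (by simp), o2 3 (by simp)]; exact f1)
    (by rw [o5, o4 4 (by simp), o3 4 (by simp)]; exact f2)
    (by rw [o5, o4 16 (by simp)]; exact f3) (by rw [o5]; exact f4) hb).mono le_rfl hs₅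
    fun s' _ hf h => ⟨h.1, h.2.1, (hf.1 3 (by decide)).trans h3, (hf.1 6 (by decide)).trans h6,
      h.2.2⟩

theorem IsTable.congr {X Y mk row tab row' tab' : ℕ → ℕ} {n i base : ℕ}
    (h : IsTable X Y mk n i base row tab) (hrow : ∀ e < i + 1, row' e = row e)
    (htab : ∀ x < base + n + 1, tab' x = tab x) : IsTable X Y mk n i base row' tab' := by
  intro e he hme
  obtain ⟨h1, h2⟩ := h e he hme
  rw [hrow e (by omega)]
  exact ⟨h1, fun j hj => by rw [htab _ (by omega), h2 j hj]⟩

theorem str_reverse {A : List ℕ} {k : ℕ} (h : k < A.length) :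
    str A.reverse k = str A (A.length - k - 1) := by
  rw [str, str, List.getD_eq_getElem _ _ (by simpa using h), List.getD_eq_getElem _ _ (by omega),
    List.getElem_reverse]
  congr 1
  omega

/-- Compute and save the table for the prefixes. -/
def prefixTable : Prog :=
  tableOf (.get 0 (.reg 12)) (.get 1 (.reg 12)) (.get 20 (.reg 12)) (.get 22 (.reg 12)) ;;
  fill 25 (.add (.add (.reg 20) (.reg 6)) (.const 1)) (.get 7 (.reg 12)) ;;
  fill 26 (.add (.reg 3) (.const 1)) (.get 6 (.reg 12))

theorem run_prefixTable {w : ℕ} {s : State} {A B C : List ℕ} {c p : ℕ} (hs : Bdd w s)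
    (hw : (A.length + 2) * (B.length + 1) + 2 * B.length + 2 * A.length + 10 < cap w)
    (hin : Input A B C s) (hA : Analysis A C c p (s.reg 30) (s.arr 20) (s.arr 21) (s.arr 22)) :
    Run w prefixTable s (A.length * 150 + (rle A).length * 1100 + B.length * 150 +
        (rle A).length * B.length * 450 + 400)
      fun s' => ∃ base ≤ A.length * (B.length + 1), IsTable (str A) (str B)
        (marks (s'.reg 30) (s'.arr 20) (s'.arr 22)) B.length A.length base
        (s'.arr 26) (s'.arr 25) := by
  rw [runs_eq, ← hA.eq_runs]
  have hR : s.reg 30 ≤ A.length := by rw [hA.eq_runs]; exact runs_le _ _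
  set R := s.reg 30 with hR'
  have hmul : (A.length + 2) * (B.length + 1) = A.length * (B.length + 1) + 2 * B.length + 2 := by ring
  refine Run.mono (T := (A.length * 120 + R * 1040 + B.length * 120 + R * B.length * 400 + 300) +
    (((2 * (R * B.length) + 2 * R + B.length + 1) * 16 + 10) + ((A.length + 1) * 14 + 8))) ?_
    (by omega) hs
    fun _ _ _ h => h
  refine (run_tableOf (eX := .get 0 (.reg 12)) (eY := .get 1 (.reg 12))
    (eU := .get 20 (.reg 12)) (eV := .get 22 (.reg 12)) (X := str A) (Y := str B) (U := s.arr 20)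
    (V := s.arr 22) (R := R) hs
    (by omega) hin.lenA hin.lenB rfl
    (fun i s' hi h12 hr ha => ⟨trivial, by
      simp only [Expr.eval, h12, ha 0 (by simp) (by simp) (by simp) (by simp), hin.strA]⟩)
    (fun i s' hi h12 hr ha => ⟨trivial, by
      simp only [Expr.eval, h12, ha 1 (by simp) (by simp) (by simp) (by simp), hin.strB]⟩)
    (fun i s' hi h12 hr ha => ⟨trivial, by
      simp only [Expr.eval, h12, ha 20 (by simp) (by simp) (by simp) (by simp)]⟩)
    (fun i s' hi h12 hr ha => ⟨trivial, by
      simp only [Expr.eval, h12, ha 22 (by simp) (by simp) (by simp) (by simp)]⟩)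
    hA.boundary (by decide) (by decide) (by decide) (by decide)).seq hs fun s₁ hs₁ hf₁ h₁ => ?_
  obtain ⟨h1, h2, h3, h4, h5⟩ := h₁
  -- Register `20` is the start of the last row, so this is the full extent of the table, which the
  -- suffix table is going to overwrite.
  refine Run.seq (Q := fun s' => ∀ i < s₁.reg 20 + B.length + 1, s'.arr 25 i = s₁.arr 7 i)
    ((run_fill (a := 25) (n := .add (.add (.reg 20) (.reg 6)) (.const 1))
    (e := .get 7 (.reg 12)) (s₁.reg 20 + B.length + 1) (s₁.arr 7) hs₁ (by omega)
    (fun s' hs' => ?_) fun i s' hi h12 hr ha => ⟨trivial, ?_⟩).mono ?_ hs₁ fun _ _ _ h => h) hs₁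
    fun s₂ hs₂ hf₂ h₂ => ?_
  · simp only [Expr.Ok, Expr.eval, hs' 20 (by simp), hs' 6 (by simp), h4, and_true, true_and]
    omega
  · simp only [Expr.eval, h12, ha 7 (by simp)]
  · simp only [Expr.cost]
    omega
  refine (run_fill (a := 26) (n := .add (.reg 3) (.const 1))
    (e := .get 6 (.reg 12)) (A.length + 1) (s₂.arr 6) hs₂ (by omega)
    (fun s' hs' => ?_) fun i s' hi h12 hr ha => ⟨trivial, ?_⟩).mono ?_ hs₂ fun s₃ _ hf₃ h₃ => ?_
  · simp only [Expr.Ok, Expr.eval, hs' 3 (by simp), hf₂.1 3 (by decide), h3, and_true, true_and]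
    omega
  · simp only [Expr.eval, h12, ha 6 (by simp)]
  · simp only [Expr.cost]
    omega
  refine ⟨s₁.reg 20, h2, ?_⟩
  rw [hf₃.1 30 (by decide), hf₂.1 30 (by decide), hf₁.1 30 (by decide), hf₃.2 20 (by decide),
    hf₂.2 20 (by decide), hf₁.2 20 (by decide), hf₃.2 22 (by decide), hf₂.2 22 (by decide),
    hf₁.2 22 (by decide)]
  refine h5.congr (fun e he => ?_) fun x hx => ?_
  · rw [h₃ e he, hf₂.2 6 (by decide)]
  · rw [hf₃.2 25 (by decide), h₂ x hx]

/-- Compute the table for the suffixes. -/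
def suffixTable : Prog :=
  tableOf (.get 0 (.sub (.sub (.reg 0) (.reg 12)) (.const 1)))
    (.get 1 (.sub (.sub (.reg 1) (.reg 12)) (.const 1)))
    (.sub (.reg 0) (.get 20 (.reg 12))) (.sub (.reg 0) (.get 21 (.reg 12)))

theorem run_suffixTable {w : ℕ} {s : State} {A B C : List ℕ} {c p : ℕ} (hs : Bdd w s)
    (hw : (A.length + 2) * (B.length + 1) + 2 * B.length + 2 * A.length + 10 < cap w)
    (hin : Input A B C s) (hA : Analysis A C c p (s.reg 30) (s.arr 20) (s.arr 21) (s.arr 22)) :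
    Run w suffixTable s (A.length * 120 + (rle A).length * 1040 + B.length * 120 +
        (rle A).length * B.length * 400 + 300)
      fun s' => ∃ base ≤ A.length * (B.length + 1), IsTable (str A.reverse) (str B.reverse)
        (marks (s'.reg 30) (fun r => A.length - s'.arr 20 r) (fun r => A.length - s'.arr 21 r))
        B.length A.length base (s'.arr 6) (s'.arr 7) := by
  rw [runs_eq, ← hA.eq_runs]
  have hR : s.reg 30 ≤ A.length := by rw [hA.eq_runs]; exact runs_le _ _
  have h1w : 1 < cap w := by omega
  refine (run_tableOf (eX := .get 0 (.sub (.sub (.reg 0) (.reg 12)) (.const 1)))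
    (eY := .get 1 (.sub (.sub (.reg 1) (.reg 12)) (.const 1)))
    (eU := .sub (.reg 0) (.get 20 (.reg 12))) (eV := .sub (.reg 0) (.get 21 (.reg 12)))
    (X := str A.reverse) (Y := str B.reverse)
    (U := fun r => A.length - s.arr 20 r) (V := fun r => A.length - s.arr 21 r)
    (R := s.reg 30) hs (by omega) hin.lenA hin.lenB rfl
    (fun i s' hi h12 hr ha => ⟨by simpa [Expr.Ok] using h1w, by
      simp only [Expr.eval, h12, ha 0 (by simp) (by simp) (by simp) (by simp), hin.strA,
        hr 0 (by simp), hin.lenA, str_reverse hi]⟩)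
    (fun i s' hi h12 hr ha => ⟨by simpa [Expr.Ok] using h1w, by
      simp only [Expr.eval, h12, ha 1 (by simp) (by simp) (by simp) (by simp), hin.strB,
        hr 1 (by simp), hin.lenB, str_reverse hi]⟩)
    (fun i s' hi h12 hr ha => ⟨⟨trivial, trivial⟩, by
      simp only [Expr.eval, h12, ha 20 (by simp) (by simp) (by simp) (by simp), hr 0 (by simp),
        hin.lenA]⟩)
    (fun i s' hi h12 hr ha => ⟨⟨trivial, trivial⟩, by
      simp only [Expr.eval, h12, ha 21 (by simp) (by simp) (by simp) (by simp), hr 0 (by simp),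
        hin.lenA]⟩)
    (fun k hk hk' hne => ?_) (by decide) (by decide) (by decide) (by decide)).mono le_rfl hs
    fun s' _ hf h => ⟨s'.reg 20, h.2.1, ?_⟩
  -- A change of character at `k` in the reversed string is one at `A.length - k` in `A`, so the
  -- mirrored run starts mark all boundaries.
  · rw [str_reverse hk', str_reverse (by omega)] at hne
    obtain ⟨r, hr, h⟩ := hA.boundary (A.length - k) (by omega) (by omega) fun h' => hne (by
      rw [show A.length - (k - 1) - 1 = A.length - k by omega, h'])
    exact ⟨r, hr, by rw [h]; omega⟩
  · rw [hf.1 30 (by decide), hf.2 20 (by decide), hf.2 21 (by decide)]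
    exact h.2.2.2.2

/-! ### The maximum over the pairs of slots -/

/-- Compute the maximum over the pairs with the slot of the first string in register `41`. -/
def pairRow : Prog :=
  (.assign 43 (.get 26 (.get 22 (.reg 41))) ;;
    .assign 44 (.get 6 (.sub (.reg 0) (.get 21 (.reg 41)))) ;; .assign 42 (.const 0)) ;;
  .loop (.lt (.reg 42) (.reg 31))
    (.ite (.not (.lt (.reg 1) (.get 23 (.reg 42))))
      (.assign 45 (.add (.add (.get 25 (.add (.reg 43) (.get 24 (.reg 42)))) (.reg 2))
        (.get 7 (.add (.reg 44) (.sub (.reg 1) (.get 23 (.reg 42)))))) ;;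
        .ite (.lt (.reg 40) (.reg 45)) (.assign 40 (.reg 45)) .skip)
      .skip ;;
    .assign 42 (.add (.reg 42) (.const 1)))

/-- The addresses of the two table rows depend only on the slot of `A` and are looked up once; each
slot of `B` then takes constant time. `S` is the set of pairs treated before. -/
theorem run_pairRow {w : ℕ} {s : State} {A B C : List ℕ} {k RB base base' : ℕ}
    {sr cur cur' : ℕ → ℕ} {S : ℕ → ℕ → Prop} (hs : Bdd w s)
    (hw : base + base' + 2 * A.length + 2 * B.length + C.length + RB + 10 < cap w)
    (hin : Input A B C s) (hk : s.reg 41 = k) (hRB : s.reg 31 = RB)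
    (hsr : s.arr 22 k = sr k) (hcur : s.arr 21 k = cur k)
    (hrow : s.arr 26 (sr k) ≤ base)
    (htab : ∀ j ≤ B.length, s.arr 25 (s.arr 26 (sr k) + j) = lcs (str A) (str B) (sr k) j)
    (hrow' : s.arr 6 (A.length - cur k) ≤ base')
    (htab' : ∀ j ≤ B.length, s.arr 7 (s.arr 6 (A.length - cur k) + j) =
      lcs (str A.reverse) (str B.reverse) (A.length - cur k) j)
    (hsrA : sr k ≤ A.length) (hsrB : ∀ r < RB, s.arr 24 r ≤ B.length)
    (hcur' : s.arr 23 = cur')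
    (hmax : IsMaxValue S (fun r r' => pairValue A B C (sr r) (cur r) (s.arr 24 r') (cur' r'))
      (s.reg 40)) :
    Run w pairRow s (RB * 60 + 30) fun s' => IsMaxValue
      (fun r r' => S r r' ∨ r = k ∧ r' < RB ∧ cur' r' ≤ B.length)
      (fun r r' => pairValue A B C (sr r) (cur r) (s.arr 24 r') (cur' r')) (s'.reg 40) := by
  have hinit : Run w (.assign 43 (.get 26 (.get 22 (.reg 41))) ;;
      .assign 44 (.get 6 (.sub (.reg 0) (.get 21 (.reg 41)))) ;; .assign 42 (.const 0)) s 15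
      fun s' => s'.reg 43 = s.arr 26 (sr k) ∧ s'.reg 44 = s.arr 6 (A.length - cur k) ∧
        s'.reg 42 = 0 := by
    refine (Run.of_wp hs ?_).mono (by decide) hs fun _ _ _ h => h
    simp [Prog.wp, Expr.Ok, Expr.eval, hk, hsr, hcur, hin.lenA]
    omega
  refine Run.mono (hinit.seq hs fun s₁ hs₁ hf₁ h₁ => Run.loop_const
    (fun j s' => s'.reg 42 = j ∧ IsMaxValue
      (fun r r' => S r r' ∨ r = k ∧ r' < j ∧ cur' r' ≤ B.length)
      (fun r r' => pairValue A B C (sr r) (cur r) (s.arr 24 r') (cur' r')) (s'.reg 40)) RB 50 hs₁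
    ?_ ?_ ?_) ?_ hs fun s' _ _ h => h.2
  · refine ⟨h₁.2.2, ?_⟩
    rw [hf₁.1 40 (by decide)]
    exact hmax.congr fun r r' => by simp
  · rintro j s' hj hs' hf ⟨h4, -⟩
    have e31 := ((hf.1 31 (by decide)).trans (hf₁.1 31 (by decide))).trans hRB
    simp only [Test.Ok, Test.Holds, Expr.Ok, Expr.eval, h4, e31, true_and, and_true]
  · rintro j s' hj hs' hf ⟨h4, h5⟩
    have e1 := ((hf.1 1 (by decide)).trans (hf₁.1 1 (by decide))).trans hin.lenB
    have e2 := ((hf.1 2 (by decide)).trans (hf₁.1 2 (by decide))).trans hin.lenC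
    have e43 := (hf.1 43 (by decide)).trans h₁.1
    have e44 := (hf.1 44 (by decide)).trans h₁.2.1
    have a7 := (hf.2 7 (by decide)).trans (hf₁.2 7 (by decide))
    have a23 := ((hf.2 23 (by decide)).trans (hf₁.2 23 (by decide))).trans hcur'
    have a24 := (hf.2 24 (by decide)).trans (hf₁.2 24 (by decide))
    have a25 := (hf.2 25 (by decide)).trans (hf₁.2 25 (by decide))
    have hB := hsrB j hj
    have ht := htab _ hB
    have ht' := htab' (B.length - cur' j) (Nat.sub_le _ _)
    have hl := lcs_le_left (str A) (str B) (sr k) (s.arr 24 j)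
    have hl' := lcs_le_left (str A.reverse) (str B.reverse) (A.length - cur k)
      (B.length - cur' j)
    have hpv : pairValue A B C (sr k) (cur k) (s.arr 24 j) (cur' j) =
      lcs (str A) (str B) (sr k) (s.arr 24 j) + C.length + lcs (str A.reverse) (str B.reverse)
        (A.length - cur k) (B.length - cur' j) := rfl
    refine (Run.of_wp hs' ?_).mono (by decide) hs' fun _ _ _ h => h
    simp only [h4, e1, e2, e43, e44, a7, a23, a24, a25, ht, ht', Prog.wp, Test.Ok, Test.Holds,
      Expr.Ok, Expr.eval, State.setReg_reg, State.setReg_arr, ne_eq, Nat.reduceEqDiff,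
      not_false_eq_true, if_true, if_false, true_and, and_true, ← hpv]
    refine ⟨fun hc => ⟨?_, fun hlt => ⟨by omega, h5.insert (k := k) (j := j) ?_ ?_⟩,
      fun hlt => ⟨by omega, h5.insert (k := k) (j := j) ?_ ?_⟩⟩, fun hc => ⟨by omega, h5.congr ?_⟩⟩
    · omega
    · intro r r'
      constructor
      · rintro (h | ⟨rfl, h1, h2⟩)
        · exact .inl (.inl h)
        · by_cases hr : r' = j
          · exact .inr ⟨rfl, hr⟩
          · exact .inl (.inr ⟨rfl, by omega, h2⟩)
      · rintro ((h | ⟨rfl, h1, h2⟩) | ⟨rfl, rfl⟩)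
        · exact .inl h
        · exact .inr ⟨rfl, by omega, h2⟩
        · exact .inr ⟨rfl, by omega, by omega⟩
    · omega
    · intro r r'
      constructor
      · rintro (h | ⟨rfl, h1, h2⟩)
        · exact .inl (.inl h)
        · by_cases hr : r' = j
          · exact .inr ⟨rfl, hr⟩
          · exact .inl (.inr ⟨rfl, by omega, h2⟩)
      · rintro ((h | ⟨rfl, h1, h2⟩) | ⟨rfl, rfl⟩)
        · exact .inl h
        · exact .inr ⟨rfl, by omega, h2⟩
        · exact .inr ⟨rfl, by omega, by omega⟩
    · omega
    · intro r r'
      constructor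
      · rintro (h | ⟨rfl, h1, h2⟩)
        · exact .inl h
        · by_cases hr : r' = j
          · subst hr
            omega
          · exact .inr ⟨rfl, by omega, h2⟩
      · rintro (h | ⟨rfl, h1, h2⟩)
        · exact .inl h
        · exact .inr ⟨rfl, by omega, h2⟩
  · simp only [Test.cost, Expr.cost]
    omega

/-- Compute the maximum over all pairs of slots. -/
def pairs : Prog :=
  (.assign 40 (.const 0) ;; .assign 41 (.const 0)) ;;
  .loop (.lt (.reg 41) (.reg 30))
    (.ite (.not (.lt (.reg 0) (.get 21 (.reg 41)))) pairRow .skip ;;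
      .assign 41 (.add (.reg 41) (.const 1))) ;;
  .assign 0 (.reg 40)

theorem run_pairs {w : ℕ} {s : State} {A B C : List ℕ} {base base' c p : ℕ} {stB : ℕ → ℕ}
    (hs : Bdd w s)
    (hw : base + base' + 3 * A.length + 3 * B.length + C.length + 10 < cap w)
    (hin : Input A B C s)
    (hA : Analysis A C c p (s.reg 30) (s.arr 20) (s.arr 21) (s.arr 22))
    (hB : Analysis B C c p (s.reg 31) stB (s.arr 23) (s.arr 24))
    (ht : IsTable (str A) (str B) (marks (s.reg 30) (s.arr 20) (s.arr 22)) B.length A.length base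
      (s.arr 26) (s.arr 25))
    (ht' : IsTable (str A.reverse) (str B.reverse)
      (marks (s.reg 30) (fun r => A.length - s.arr 20 r) (fun r => A.length - s.arr 21 r))
      B.length A.length base' (s.arr 6) (s.arr 7)) :
    Run w pairs s ((rle A).length * ((rle B).length * 60 + 60) + 20) fun s' => IsMaxValue
      (fun r r' => r < s.reg 30 ∧ r' < s.reg 31 ∧ s.arr 21 r ≤ A.length ∧ s.arr 23 r' ≤ B.length)
      (fun r r' => pairValue A B C (s.arr 22 r) (s.arr 21 r) (s.arr 24 r') (s.arr 23 r'))
      (s'.reg 0) := by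
  rw [runs_eq, runs_eq, ← hA.eq_runs, ← hB.eq_runs]
  have hRA : s.reg 30 ≤ A.length := by rw [hA.eq_runs]; exact runs_le _ _
  have hRB : s.reg 31 ≤ B.length := by rw [hB.eq_runs]; exact runs_le _ _
  have hinit : Run w (.assign 40 (.const 0) ;; .assign 41 (.const 0)) s 4
      fun s' => s'.reg 40 = 0 ∧ s'.reg 41 = 0 := by
    refine Run.of_wp hs ?_
    simp [Prog.wp, Expr.Ok, Expr.eval]
    omega
  refine Run.mono (hinit.seq hs fun s₁ hs₁ hf₁ h₁ => Run.seq (Q' := _) (Run.loop_const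
    (fun k s' => s'.reg 41 = k ∧ IsMaxValue
      (fun r r' => r < k ∧ r' < s.reg 31 ∧ s.arr 21 r ≤ A.length ∧ s.arr 23 r' ≤ B.length)
      (fun r r' => pairValue A B C (s.arr 22 r) (s.arr 21 r) (s.arr 24 r') (s.arr 23 r'))
      (s'.reg 40)) (s.reg 30) (s.reg 31 * 60 + 56) hs₁ ?_ ?_ ?_) hs₁ (T' := 2)
      fun s₂ hs₂ hf₂ h₂ => ?_) ?_ hs fun _ _ _ h => h
  · refine ⟨h₁.2, ?_, .inl h₁.1⟩
    rintro r r' ⟨h, -⟩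
    omega
  · rintro j s' hj hs' hf ⟨h4, -⟩
    have e30 := (hf.1 30 (by decide)).trans (hf₁.1 30 (by decide))
    simp only [Test.Ok, Test.Holds, Expr.Ok, Expr.eval, h4, e30, true_and, and_true]
  · rintro k s' hk hs' hf ⟨h4, h5⟩
    have hin' := (hin.frame hf₁ (by decide)).frame hf (by decide)
    have e31 := (hf.1 31 (by decide)).trans (hf₁.1 31 (by decide))
    have a6 := (hf.2 6 (by decide)).trans (hf₁.2 6 (by decide))
    have a7 := (hf.2 7 (by decide)).trans (hf₁.2 7 (by decide))
    have a21 := (hf.2 21 (by decide)).trans (hf₁.2 21 (by decide))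
    have a22 := (hf.2 22 (by decide)).trans (hf₁.2 22 (by decide))
    have a23 := (hf.2 23 (by decide)).trans (hf₁.2 23 (by decide))
    have a24 := (hf.2 24 (by decide)).trans (hf₁.2 24 (by decide))
    have a25 := (hf.2 25 (by decide)).trans (hf₁.2 25 (by decide))
    have a26 := (hf.2 26 (by decide)).trans (hf₁.2 26 (by decide))
    have hsrA := hA.sr_le k hk
    -- Both rows exist because the slot positions were marked, as the second family in each table.
    obtain ⟨t1, t2⟩ := ht _ hsrA (.inr (marks_eq_one.2 ⟨k, hk, .inr rfl⟩))
    obtain ⟨t3, t4⟩ := ht' (A.length - s.arr 21 k) (Nat.sub_le _ _)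
      (.inr (marks_eq_one.2 ⟨k, hk, .inr rfl⟩))
    refine Run.mono (T := (6 + (s.reg 31 * 60 + 30)) + 4) (Run.seq (Q := fun s' =>
      s'.reg 41 = k ∧ IsMaxValue
      (fun r r' => r < k + 1 ∧ r' < s.reg 31 ∧ s.arr 21 r ≤ A.length ∧ s.arr 23 r' ≤ B.length)
      (fun r r' => pairValue A B C (s.arr 22 r) (s.arr 21 r) (s.arr 24 r') (s.arr 23 r'))
      (s'.reg 40)) (Run.mono (Run.ite (T := s.reg 31 * 60 + 30) hs' ?_ (fun hc => ?_) fun hc => ?_)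
      ?_ hs' fun _ _ _ h => h) hs' fun s₂ hs₂ hf₂ h₂ => ?_) (by omega) hs' fun _ _ _ h => h
    · simp [Test.Ok, Expr.Ok]
    · simp only [Test.Holds, Expr.eval, h4, a21, hin'.lenA] at hc
      refine (run_pairRow (A := A) (B := B) (C := C) (k := k) (base := base) (base' := base')
        (sr := s.arr 22) (cur := s.arr 21) (cur' := s.arr 23) hs' (RB := s.reg 31) (by omega) hin'
        h4 e31 (by rw [a22]) (by rw [a21]) (by rw [a26]; exact t1)
        (by rw [a25, a26]; exact t2) (by rw [a6]; exact t3) (by rw [a6, a7]; exact t4) hsrA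
        (by rw [a24]; exact hB.sr_le) a23 (by rw [a24]; exact h5)).mono le_rfl hs'
        fun s₂ _ hf₂ h₂ => ⟨(hf₂.1 41 (by decide)).trans h4, ?_⟩
      rw [a24] at h₂
      refine h₂.congr fun r r' => ?_
      constructor
      · rintro ⟨h1, h2, h3, h4⟩
        by_cases hr : r = k
        · exact .inr ⟨hr, h2, h4⟩
        · exact .inl ⟨by omega, h2, h3, h4⟩
      · rintro (⟨h1, h2, h3, h4⟩ | ⟨rfl, h2, h3⟩)
        · exact ⟨by omega, h2, h3, h4⟩
        · exact ⟨by omega, h2, by omega, h3⟩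
    · simp only [Test.Holds, Expr.eval, h4, a21, hin'.lenA, not_not] at hc
      refine (Run.of_wp (Q := _) hs' ?_).mono (by simp only [Prog.cost]; omega) hs'
        fun _ _ _ h => h
      refine ⟨h4, h5.congr fun r r' => ?_⟩
      constructor
      · rintro ⟨h1, h2, h3, h4⟩
        by_cases hr : r = k
        · subst hr
          omega
        · exact ⟨by omega, h2, h3, h4⟩
      · rintro ⟨h1, h2, h3, h4⟩
        exact ⟨by omega, h2, h3, h4⟩
    · simp only [Test.cost, Expr.cost]
      omega
    · refine Run.of_wp hs₂ ?_
      simp only [Prog.wp, Expr.Ok, Expr.eval, State.setReg_reg, Nat.reduceEqDiff, if_true,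
        if_false, true_and, and_true, h₂.1]
      exact ⟨⟨by omega, by omega⟩, h₂.2⟩
  · refine Run.of_wp hs₂ ?_
    simp only [Prog.wp, Expr.Ok, Expr.eval, State.setReg_reg, if_true, true_and]
    exact h₂.2
  · have : s.reg 30 * (s.reg 31 * 60 + 56 + (1 + 1 + 1) + 1) = s.reg 30 * (s.reg 31 * 60 + 60) := rfl
    simp only [Test.cost, Expr.cost]
    omega

/-! ### Correctness and total running time -/

/-- Solve the problem if the pattern is not longer than the other strings. -/
def solve : Prog := firstRun ;; analyzeA ;; analyzeB ;; prefixTable ;; suffixTable ;; pairs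

theorem run_solve {w : ℕ} {s : State} {A B C : List ℕ} (hs : Bdd w s)
    (hw : 2 * (A.length + 2) * (B.length + 2) + 5 * A.length + 5 * B.length + C.length + 20 < cap w)
    (hin : Input A B C s) (hC : 1 < (rle C).length) (hCA : C.length ≤ A.length)
    (hCB : C.length ≤ B.length) :
    Run w solve s (9000 * ((rle A).length * B.length + (rle B).length * A.length)) fun s' =>
      (∀ Z, IsSTRICLCS A B C Z → s'.reg 0 = Z.length) ∧
        ((¬ ∃ Z, IsSTRICLCS A B C Z) → s'.reg 0 = 0) := by
  obtain ⟨p, hp0, hpC, hne, hrun, htake⟩ := exists_first_run hC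
  have hmul : 2 * (A.length + 2) * (B.length + 2) =
      2 * ((A.length + 2) * (B.length + 1)) + 2 * A.length + 4 := by ring
  have hmul' : (A.length + 2) * (B.length + 1) =
      A.length * (B.length + 1) + 2 * B.length + 2 := by ring
  have hmA : 0 < (rle A).length := by rw [runs_eq]; exact runs_pos (by omega)
  have hmB : 0 < (rle B).length := by rw [runs_eq]; exact runs_pos (by omega)
  have hnB : (rle B).length ≤ B.length := by rw [runs_eq]; exact runs_le _ _
  refine Run.mono (T := (C.length * 20 + 20) + ((A.length * 112 + C.length *
    ((rle A).length * 100 + 100) + (rle A).length * 36 + 60) + ((B.length * 112 + C.length *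
    ((rle B).length * 100 + 100) + (rle B).length * 24 + 60) + ((A.length * 150 +
    (rle A).length * 1100 + B.length * 150 + (rle A).length * B.length * 450 + 400) +
    ((A.length * 120 + (rle A).length * 1040 + B.length * 120 + (rle A).length * B.length * 400 +
    300) + ((rle A).length * ((rle B).length * 60 + 60) + 20)))))) ?_ ?_ hs fun _ _ _ h => h
  · refine (run_firstRun hs (by omega) hin hp0 hpC hne hrun).seq hs fun s₁ hs₁ hf₁ h₁ => ?_
    have hin₁ := hin.frame hf₁ (by decide)
    refine (run_analyzeA hs₁ (by omega) hin₁ h₁.1 h₁.2 hp0 hpC.le).seq hs₁ fun s₂ hs₂ hf₂ hA => ?_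
    have hin₂ := hin₁.frame hf₂ (by decide)
    refine (run_analyzeB hs₂ (by omega) hin₂ ((hf₂.1 4 (by decide)).trans h₁.1)
      ((hf₂.1 5 (by decide)).trans h₁.2) hp0 hpC.le).seq hs₂ fun s₃ hs₃ hf₃ hB => ?_
    have hin₃ := hin₂.frame hf₃ (by decide)
    rw [← hf₃.1 30 (by decide), ← hf₃.2 20 (by decide), ← hf₃.2 21 (by decide),
      ← hf₃.2 22 (by decide)] at hA
    refine (run_prefixTable hs₃ (by omega) hin₃ hA).seq hs₃ fun s₄ hs₄ hf₄ h₄ => ?_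
    obtain ⟨base, hb, ht⟩ := h₄
    have hin₄ := hin₃.frame hf₄ (by decide)
    rw [← hf₄.1 30 (by decide), ← hf₄.2 20 (by decide), ← hf₄.2 21 (by decide),
      ← hf₄.2 22 (by decide)] at hA
    rw [← hf₄.1 31 (by decide), ← hf₄.2 23 (by decide), ← hf₄.2 24 (by decide)] at hB
    refine (run_suffixTable hs₄ (by omega) hin₄ hA).seq hs₄ fun s₅ hs₅ hf₅ h₅ => ?_
    obtain ⟨base', hb', ht'⟩ := h₅
    have hin₅ := hin₄.frame hf₅ (by decide)
    rw [← hf₅.1 30 (by decide), ← hf₅.2 20 (by decide), ← hf₅.2 22 (by decide),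
      ← hf₅.2 25 (by decide), ← hf₅.2 26 (by decide)] at ht
    rw [← hf₅.1 30 (by decide), ← hf₅.2 20 (by decide), ← hf₅.2 21 (by decide),
      ← hf₅.2 22 (by decide)] at hA
    rw [← hf₅.1 31 (by decide), ← hf₅.2 23 (by decide), ← hf₅.2 24 (by decide)] at hB
    exact (run_pairs hs₅ (by omega) hin₅ hA hB ht ht').mono le_rfl hs₅
      fun s₆ _ _ h => h.spec hA hB hp0 htake hpC hne
  -- Every term of the time is absorbed by `mN + nM`: the linear ones since `m, n ≥ 1`, the pairs
  -- since `n ≤ N`, and the greedy extensions since `C` is not longer than `A` or `B`.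
  · have h1 : A.length ≤ (rle B).length * A.length := Nat.le_mul_of_pos_left _ hmB
    have h2 : B.length ≤ (rle A).length * B.length := Nat.le_mul_of_pos_left _ hmA
    have h3 : (rle A).length ≤ (rle A).length * B.length :=
      Nat.le_mul_of_pos_right _ (by omega)
    have h4 : (rle A).length * C.length ≤ (rle A).length * B.length :=
      Nat.mul_le_mul_left _ hCB
    have h5 : (rle B).length * C.length ≤ (rle B).length * A.length :=
      Nat.mul_le_mul_left _ hCA
    have h6 : (rle A).length * (rle B).length ≤ (rle A).length * B.length :=
      Nat.mul_le_mul_left _ hnB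
    have e1 : C.length * ((rle A).length * 100 + 100) =
      (rle A).length * C.length * 100 + C.length * 100 := by ring
    have e2 : C.length * ((rle B).length * 100 + 100) =
      (rle B).length * C.length * 100 + C.length * 100 := by ring
    have e3 : (rle A).length * ((rle B).length * 60 + 60) =
      (rle A).length * (rle B).length * 60 + (rle A).length * 60 := by ring
    rw [e1, e2, e3]
    omega

/-- The program of the theorem. -/
def program : Prog :=
  .ite (.lt (.reg 0) (.reg 2)) (.assign 0 (.const 0))
    (.ite (.lt (.reg 1) (.reg 2)) (.assign 0 (.const 0)) solve)

/-- This justifies answering `0` at once when `C` is too long; `C` could otherwise spoil the time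
bound, which does not mention its length. -/
theorem IsCandidate.length_le {α : Type} {A B C Z : List α} (h : IsCandidate A B C Z) :
    C.length ≤ A.length ∧ C.length ≤ B.length :=
  ⟨h.1.length_le.trans h.2.1.length_le, h.1.length_le.trans h.2.2.length_le⟩

theorem run_program {w : ℕ} {s : State} {A B C : List ℕ} (hs : Bdd w s)
    (hw : 2 * (A.length + 2) * (B.length + 2) + 5 * A.length + 5 * B.length + C.length + 20 < cap w)
    (hin : Input A B C s) (hA0 : 0 < A.length) (hB0 : 0 < B.length) (hC : 1 < (rle C).length) :
    Run w program s (9010 * ((rle A).length * B.length + (rle B).length * A.length)) fun s' =>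
      (∀ Z, IsSTRICLCS A B C Z → s'.reg 0 = Z.length) ∧
        ((¬ ∃ Z, IsSTRICLCS A B C Z) → s'.reg 0 = 0) := by
  have hpos : 0 < (rle A).length * B.length :=
    Nat.mul_pos (by rw [runs_eq]; exact runs_pos hA0) hB0
  have hzero : ¬ (C.length ≤ A.length ∧ C.length ≤ B.length) → Run w (.assign 0 (.const 0)) s 2
      fun s' => (∀ Z, IsSTRICLCS A B C Z → s'.reg 0 = Z.length) ∧
        ((¬ ∃ Z, IsSTRICLCS A B C Z) → s'.reg 0 = 0) := by
    intro hlen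
    refine Run.of_wp hs ?_
    simp only [Prog.wp, Expr.Ok, Expr.eval, State.setReg_reg, if_true]
    exact ⟨by omega, fun Z hZ => absurd hZ.1.length_le hlen, fun _ => trivial⟩
  refine (Run.ite (b := .lt (.reg 0) (.reg 2)) (T := 4 + 9000 * ((rle A).length * B.length + (rle B).length * A.length)) hs
    ⟨trivial, trivial⟩ (fun h => ?_) fun h => ?_).mono
    (by simp only [Test.cost, Expr.cost]; omega) hs fun _ _ _ h => h
  · simp only [Test.Holds, Expr.eval, hin.lenA, hin.lenC] at h
    exact (hzero (by omega)).mono (by omega) hs fun _ _ _ h => h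
  · simp only [Test.Holds, Expr.eval, hin.lenA, hin.lenC] at h
    refine (Run.ite (b := .lt (.reg 1) (.reg 2)) (T := 9000 * ((rle A).length * B.length + (rle B).length * A.length)) hs
      ⟨trivial, trivial⟩ (fun h' => ?_) fun h' => ?_).mono
      (by simp only [Test.cost, Expr.cost]; omega) hs fun _ _ _ h => h
    · simp only [Test.Holds, Expr.eval, hin.lenB, hin.lenC] at h'
      exact (hzero (by omega)).mono (by omega) hs fun _ _ _ h => h
    · simp only [Test.Holds, Expr.eval, hin.lenB, hin.lenC] at h'
      exact run_solve hs hw hin hC (by omega) (by omega)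

theorem input_initState {σ : ℕ} (A B C : List (Fin σ)) :
    Input (A.map Fin.val) (B.map Fin.val) (C.map Fin.val) (initState A B C) :=
  ⟨by simp [initState], by simp [initState], by simp [initState], rfl, rfl, rfl⟩

theorem bdd_initState {σ w : ℕ} {A B C : List (Fin σ)} (hσ : σ ≤ 2 ^ w)
    (hA : A.length < 2 ^ w) (hB : B.length < 2 ^ w) (hC : C.length < 2 ^ w) :
    Bdd w (initState A B C) := by
  have h0 : 0 < 2 ^ w := by positivity
  have hstr : ∀ (X : List (Fin σ)) (i : ℕ), (X.map Fin.val).getD i 0 < 2 ^ w := by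
    intro X i
    rw [List.getD_eq_getElem?_getD, List.getElem?_map]
    cases X[i]? with
    | none => simp
    | some a => exact lt_of_lt_of_le a.isLt hσ
  constructor
  · intro x
    simp only [cap, initState]
    split
    exacts [hA, hB, hC, h0]
  · intro a i
    simp only [cap, initState]
    split
    exacts [hstr A i, hstr B i, hstr C i, h0]

end StrIC

theorem theorem1 :
    ∃ (P : StrIC.Prog) (c : ℕ), ∀ (σ w : ℕ) (A B C : List (Fin σ)),
      A ≠ [] → B ≠ [] → 1 < (StrIC.rle C).length →
      σ ≤ 2 ^ w → (A.length + B.length + C.length) ^ c ≤ 2 ^ w →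
      ∃ (t : ℕ) (s : StrIC.State),
        StrIC.Exec w P (StrIC.initState A B C) t s ∧
        t ≤ c * ((StrIC.rle A).length * B.length + (StrIC.rle B).length * A.length) ∧
        (∀ Z : List (Fin σ), StrIC.IsSTRICLCS A B C Z → s.reg 0 = Z.length) ∧
        ((¬ ∃ Z : List (Fin σ), StrIC.IsSTRICLCS A B C Z) → s.reg 0 = 0) := by
  -- The constant `9010` comes from the time bound; as an exponent for the word length, `5` already
  -- suffices.
  refine ⟨StrIC.program, 9010, fun σ w A B C hA hB hC hσ hw => ?_⟩
  have hinj : Function.Injective (Fin.val : Fin σ → ℕ) := Fin.val_injective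
  have hrle : ∀ X : List (Fin σ),
      (StrIC.rle (X.map Fin.val)).length = (StrIC.rle X).length := fun X => by
    rw [StrIC.rle_map hinj, List.length_map]
  have hA0 : 0 < A.length := List.length_pos_of_ne_nil hA
  have hB0 : 0 < B.length := List.length_pos_of_ne_nil hB
  have hC' : 1 < (StrIC.rle (C.map Fin.val)).length := by rwa [hrle]
  obtain ⟨p, hp0, hpC, -⟩ := StrIC.exists_first_run hC'
  rw [List.length_map] at hpC
  obtain ⟨S, hS⟩ : ∃ S, S = A.length + B.length + C.length := ⟨_, rfl⟩
  have hcap : 2 * (A.length + 2) * (B.length + 2) + 5 * A.length + 5 * B.length + C.length + 20 <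
      2 ^ w := by
    have h1 : S ^ 5 ≤ 2 ^ w := by
      rw [← hS] at hw
      exact (Nat.pow_le_pow_right (by omega) (by norm_num)).trans hw
    clear hw hσ
    -- `S ≥ 4`, since `A` and `B` are nonempty and `C` has at least two characters; `64 * S ^ 2`
    -- exceeds the quadratic bound on all values that occur.
    have h2 : 4 ^ 3 * S ^ 2 ≤ S ^ 5 := by
      rw [show S ^ 5 = S ^ 3 * S ^ 2 by ring]
      exact Nat.mul_le_mul_right _ (Nat.pow_le_pow_left (by omega) 3)
    have h3 : (A.length + 2) * (B.length + 2) ≤ S * S :=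
      Nat.mul_le_mul (by omega) (by omega)
    have h4 : 4 * S ≤ S * S := Nat.mul_le_mul_right _ (by omega)
    have h5 : 4 ≤ S := by omega
    rw [sq] at h2
    rw [mul_assoc]
    omega
  clear hw
  obtain ⟨t, s, he, ht, h1, h2⟩ := StrIC.run_program (w := w)
    (StrIC.bdd_initState hσ (by lia) (by lia) (by lia))
    (by simpa [StrIC.cap] using hcap) (StrIC.input_initState A B C) (by simpa using hA0)
    (by simpa using hB0) hC'
  refine ⟨t, s, he, by simpa [hrle] using ht, fun Z hZ => ?_, fun hno => h2 ?_⟩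
  · simpa using h1 _ ((StrIC.isSTRICLCS_map hinj).2 hZ)
  · rintro ⟨Z, hZ⟩
    obtain ⟨Z', rfl⟩ := hZ.1.exists_map
    exact hno ⟨Z', (StrIC.isSTRICLCS_map hinj).1 hZ⟩
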